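/- Write $q=e^{2\pi i\tau}$ and $\zeta=e^{2\pi i z}$ for $\tau\in\mathbb{H}$, $z\in\mathbb{C}$, and $y=\operatorname{Im}\tau$. Let $\Gamma_\phi\le \mathrm{SL}_2(\mathbb{Z})$ be a congruence subgroup and let $\phi(z;\tau)$ be a weak Jacobi form of weight $0$ and index $1$ on $\Gamma_\phi\ltimes\mathbb{Z}^2$. That is, $\phi$ is holomorphic on $\mathbb{C}\times\mathbb{H}$, $\phi\big(\tfrac{z}{c\tau+d};\tfrac{a\tau+b}{c\tau+d}\big)=e^{2\pi i cz^2/(c\tau+d)}\phi(z;\tau)$ for $\left(\begin{smallmatrix}a&b\\c&d\end{smallmatrix}\right)\in\Gamma_\phi$, $\phi(z+\lambda\tau+u;\tau)=e^{-2\pi i(\lambda^2\tau+2\lambda z)}\phi(z;\tau)$ for $\lambda,u\in\mathbb{Z}$, and for every $\left(\begin{smallmatrix}a&b\\c&d\end{smallmatrix}\right)\in\mathrm{SL}_2(\mathbb{Z})$ the function $e^{-2\pi i cz^2/(c\tau+d)}\phi\big(\tfrac{z}{c\tau+d};\tfrac{a\tau+b}{c\tau+d}\big)$ has an expansion in terms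 $q^{n/N}\zeta^r$ with $n,r\in\mathbb{Z}$, $n\ge 0$, for some integer $N\ge1$. Let $h\ge 1$ be an integer such that the expansion of $\phi$ itself is $$\phi(z;\tau)=\sum_{n\ge0,\ r\in\mathbb{Z}}c(n,r)\,q^{n/h}\zeta^r$$ ($h=1$ if $\left(\begin{smallmatrix}1&1\\0&1\end{smallmatrix}\right)\in\Gamma_\phi$). For $r=0,1$ put $f_r(\tau)=\sum_{n\ge0}c(n,r)q^{n/h-r^2/4}$. Let $\vartheta\left[{a\atop b}\right](z;\tau)=\sum_{n\in\mathbb{Z}}e^{2\pi i(n+a)b}q^{(n+a)^2/2}\zeta^{n+a}$, $\theta_1=-\vartheta\left[{1/2\atop 1/2}\right]$, $\theta_2=\vartheta\left[{1/2\atop 0}\right]$, $\theta_3=\vartheta\left[{0\atop 0}\right]$, let $\eta$ be the Dedekind eta function, and let $$\mu(z;\tau)=\frac{-i\,\zeta^{1/2}}{\theta_1(z;\tau)}\sum_{n\in\mathbb{Z}}\frac{(-1)^nq^{n(n+1)/2}\zeta^n}{1-\zeta q^n}.$$ The function $\theta_1^2\mu$ extends holomorphically to all $z\in\mathbb{C}$;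 let $S_\ell(\tau)$, $\ell=0,1$, be $q^{-\ell^2/4}$ times the coefficient of $\zeta^\ell$ in its Fourier expansion in $z$. The index one $N=4$ Ramond characters are $$\mathrm{ch}_{\frac14,0}=\frac{\theta_1^2}{\eta^3}\mu,\qquad \mathrm{ch}_{\frac14,\frac12}=q^{-\frac18}\frac{\theta_1^2}{\eta^3}-2\,\mathrm{ch}_{\frac14,0},\qquad \mathrm{ch}_{\frac14+\ell,\frac12}=q^{\ell-\frac18}\frac{\theta_1^2}{\eta^3}\quad(\ell>0).$$ Finally let $$C(\tau)=\frac12\sum_{m\in\mathbb{Z}}(-1)^m\operatorname{sgn}\!\left(m+\tfrac12\right)\beta\!\left(2\left(m+\tfrac12\right)^2y\right)q^{-\frac12\left(m+\frac12\right)^2},\qquad \beta(x)=\int_x^\infty u^{-1/2}e^{-\pi u}\,du .$$ Then $\phi(z;\tau)=f_0(\tau)\theta_3(2z;2\tau)+f_1(\tau)\theta_2(2z;2\tau)$, and, with $F^\phi:=f_0S_1-f_1S_0$, the following hold. (i) There are constants $A_0$ and $B_n$ $(n\ge0)$ such that $$\phi=A_0\,\mathrm{ch}_{\frac14,0}+B_0\,\mathrm{ch}_{\frac14,\frac12}+\sum_{n\ge1}B_n\,\mathrm{ch}_{\frac14+\frac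 nh,\frac12}\qquad\text{and}\qquad F^\phi(\tau)=\sum_{n\ge0}B_n\,q^{\frac nh-\frac18}.$$ (ii) $\chi:=\phi(0;\tau)$ is constant, and $F^\phi$ is a mock modular form of weight $\tfrac12$ on $\Gamma_\phi$ with a multiplier system and with completion $\widehat F^\phi=F^\phi+\chi C$. That is, $F^\phi$ is holomorphic on $\mathbb{H}$ and there is a unitary multiplier system $\nu$ of weight $\tfrac12$ on $\Gamma_\phi$ such that $\widehat F^\phi\big(\tfrac{a\tau+b}{c\tau+d}\big)=\nu(\gamma)(c\tau+d)^{1/2}\widehat F^\phi(\tau)$ for all $\gamma=\left(\begin{smallmatrix}a&b\\c&d\end{smallmatrix}\right)\in\Gamma_\phi$; $\widehat F^\phi$ has at most linear exponential growth at all cusps; and there is a cusp form $g$ of weight $\tfrac32$ on $\Gamma_\phi$ with multiplier system $\overline\nu$ such that $\chi C(\tau)=\int_0^\infty (t+2y)^{-1/2}\,\overline{g(\tau+it)}\,dt$. -/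

import Mathlib

open UpperHalfPlane Filter Topology Asymptotics
open scoped MatrixGroups ComplexConjugate

noncomputable section

namespace N4Jacobi

/-! ### Weak Jacobi forms -/

/-- `q ^ α = exp (2 π i α τ)`, for any complex exponent `α`. -/
def qpow (α τ : ℂ) : ℂ := Complex.exp (2 * Real.pi * Complex.I * α * τ)

/-- The automorphy factor `c τ + d` of `γ = (a, b; c, d)`. -/
def cocyc (γ : SL(2, ℤ)) (τ : ℍ) : ℂ := (γ 1 0 : ℂ) * (τ : ℂ) + (γ 1 1 : ℂ)

/-- The weight `k`, index `m` action of `γ`: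
`(cτ+d)^(-k) e^(-2πi m c z²/(cτ+d)) φ(z/(cτ+d); γτ)`. -/
def jacobiSlash (k : ℤ) (m : ℕ) (φ : ℂ → ℍ → ℂ) (γ : SL(2, ℤ)) (z : ℂ) (τ : ℍ) : ℂ :=
  cocyc γ τ ^ (-k) *
    Complex.exp (-(2 * Real.pi * Complex.I * m * ((γ 1 0 : ℂ) * z ^ 2 / cocyc γ τ))) *
    φ (z / cocyc γ τ) (γ • τ)

/-- `φ(z;τ) = ∑_{n ≥ 0, r ∈ ℤ} c(n,r) q^(n/h) ζ^r` (with absolute convergence), `ζ = e^(2πiz)`. -/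
def HasJacobiExpansion (h : ℕ) (c : ℕ → ℤ → ℂ) (φ : ℂ → ℍ → ℂ) : Prop :=
  ∀ (z : ℂ) (τ : ℍ),
    HasSum (fun p : ℕ × ℤ => c p.1 p.2 * qpow ((p.1 : ℂ) / (h : ℂ)) τ *
      Complex.exp (2 * Real.pi * Complex.I * (p.2 : ℂ) * z)) (φ z τ)

/-- Weak Jacobi forms of weight `k` and index `m` on `Γ ⋉ ℤ²`. At each cusp the expansion is in
powers `q^(n/N)`, `n ≥ 0`, where the positive integer `N` may depend on the cusp. -/
structure IsWeakJacobiForm (k : ℤ) (m : ℕ) (Γ : Subgroup SL(2, ℤ)) (φ : ℂ → ℍ → ℂ) : Prop where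
  holo : DifferentiableOn ℂ (fun p : ℂ × ℂ => φ p.1 (ofComplex p.2)) {p | 0 < p.2.im}
  modular : ∀ γ ∈ Γ, ∀ (z : ℂ) (τ : ℍ),
    φ (z / cocyc γ τ) (γ • τ) =
      cocyc γ τ ^ k *
        Complex.exp (2 * Real.pi * Complex.I * m * ((γ 1 0 : ℂ) * z ^ 2 / cocyc γ τ)) * φ z τ
  elliptic : ∀ (l u : ℤ) (z : ℂ) (τ : ℍ),
    φ (z + l * (τ : ℂ) + u) τ =
      Complex.exp (-(2 * Real.pi * Complex.I * m * ((l : ℂ) ^ 2 * (τ : ℂ) + 2 * l * z))) * φ z τ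
  cusps : ∀ γ : SL(2, ℤ), ∃ N : ℕ, 0 < N ∧ ∃ c : ℕ → ℤ → ℂ,
    HasJacobiExpansion N c (jacobiSlash k m φ γ)

/-! ### Theta functions -/

/-- The theta series with real characteristics `a`, `b`. -/
def thetaChar (a b : ℝ) (z τ : ℂ) : ℂ :=
  ∑' n : ℤ, Complex.exp (2 * Real.pi * Complex.I * ((n : ℂ) + a) * b) *
    qpow (((n : ℂ) + a) ^ 2 / 2) τ * Complex.exp (2 * Real.pi * Complex.I * ((n : ℂ) + a) * z)

def theta1 (z τ : ℂ) : ℂ := -thetaChar (1 / 2) (1 / 2) z τ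

def theta2 (z τ : ℂ) : ℂ := thetaChar (1 / 2) 0 z τ

def theta3 (z τ : ℂ) : ℂ := thetaChar 0 0 z τ

/-! ### The functions `μ`, `θ₁² μ` and the index one `N = 4` Ramond characters -/

/-- The Appell-Lerch sum `μ(z;τ)`, for `z ∉ ℤτ + ℤ`; note `-θ₁ = ϑ[1/2,1/2]`, so that this is
`i ζ^(1/2) / ϑ[1/2,1/2](z;τ)` times the sum. -/
def mu (z : ℂ) (τ : ℍ) : ℂ :=
  -Complex.I * Complex.exp (Real.pi * Complex.I * z) / theta1 z τ *
    ∑' n : ℤ, (-1 : ℂ) ^ n * qpow ((n : ℂ) * ((n : ℂ) + 1) / 2) τ *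
      Complex.exp (2 * Real.pi * Complex.I * (n : ℂ) * z) /
        (1 - Complex.exp (2 * Real.pi * Complex.I * z) * qpow (n : ℂ) τ)

open Classical in
/-- The function `θ₁(z;τ)² μ(z;τ)`, extended to the lattice points `z ∈ ℤτ + ℤ`
(removable singularities) by its limit. -/
def thetaSqMu (z : ℂ) (τ : ℍ) : ℂ :=
  if ∃ l u : ℤ, z = l * (τ : ℂ) + u then
    limUnder (𝓝[≠] z) (fun w => theta1 w τ ^ 2 * mu w τ)
  else theta1 z τ ^ 2 * mu z τ

/-- The massive character `ch_{1/4+ℓ, 1/2}`. -/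
def chMassive (l : ℚ) (z : ℂ) (τ : ℍ) : ℂ :=
  qpow ((l : ℂ) - 1 / 8) τ * (theta1 z τ ^ 2 / ModularForm.eta τ ^ 3)

/-- The massless character `ch_{1/4, 0}`. -/
def chMassless0 (z : ℂ) (τ : ℍ) : ℂ := thetaSqMu z τ / ModularForm.eta τ ^ 3

/-- The massless character `ch_{1/4, 1/2}`. -/
def chMassless1 (z : ℂ) (τ : ℍ) : ℂ :=
  qpow (-(1 / 8)) τ * (theta1 z τ ^ 2 / ModularForm.eta τ ^ 3) - 2 * chMassless0 z τ

/-- An expansion of `φ` in Ramond characters,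
`φ = A₀ ch_{1/4,0} + B₀ ch_{1/4,1/2} + ∑_{n ≥ 1} Bₙ ch_{1/4+n/h,1/2}`. -/
def HasCharacterExpansion (h : ℕ) (A₀ : ℂ) (B : ℕ → ℂ) (φ : ℂ → ℍ → ℂ) : Prop :=
  ∀ (z : ℂ) (τ : ℍ),
    HasSum (fun n : ℕ => B (n + 1) * chMassive (((n : ℚ) + 1) / (h : ℚ)) z τ)
      (φ z τ - A₀ * chMassless0 z τ - B 0 * chMassless1 z τ)

/-! ### The components `f_r`, `S_ℓ` and the function `C` -/

/-- `f_r(τ) = ∑_{n ≥ 0} c(n,r) q^(n/h - r²/4)`, for `φ = ∑ c(n,r) q^(n/h) ζ^r`. -/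
def thetaComponent (h : ℕ) (c : ℕ → ℤ → ℂ) (r : ℤ) (τ : ℍ) : ℂ :=
  ∑' n : ℕ, c n r * qpow ((n : ℂ) / (h : ℂ) - (r : ℂ) ^ 2 / 4) τ

/-- `S_ℓ(τ) = [q^(ℓ²/4) ζ^ℓ] (θ₁² μ)`: the coefficient of `ζ^ℓ` in the Fourier expansion of
`z ↦ θ₁(z;τ)² μ(z;τ)`, divided by `q^(ℓ²/4)`. -/
def S (l : ℤ) (τ : ℍ) : ℂ :=
  qpow (-((l : ℂ) ^ 2 / 4)) τ *
    ∫ x in (0 : ℝ)..1, thetaSqMu (x : ℂ) τ *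
      Complex.exp (-(2 * Real.pi * Complex.I * (l : ℂ) * (x : ℂ)))

/-- The function `f₀ S₁ - f₁ S₀`. -/
def F (h : ℕ) (c : ℕ → ℤ → ℂ) (τ : ℍ) : ℂ :=
  thetaComponent h c 0 τ * S 1 τ - thetaComponent h c 1 τ * S 0 τ

/-- `β(x) = ∫_x^∞ u^(-1/2) e^(-πu) du`. -/
def beta (x : ℝ) : ℝ :=
  ∫ u in Set.Ioi x, u ^ (-(1 / 2) : ℝ) * Real.exp (-(Real.pi * u))

/-- `C(τ) = (1/2) ∑_m (-1)^m sgn(m+1/2) β(2(m+1/2)² y) q^(-(m+1/2)²/2)`. -/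
def C (τ : ℍ) : ℂ :=
  (1 / 2 : ℂ) * ∑' m : ℤ, (-1 : ℂ) ^ m * ((SignType.sign ((m : ℝ) + 1 / 2) : ℝ) : ℂ) *
    (beta (2 * ((m : ℝ) + 1 / 2) ^ 2 * τ.im) : ℂ) * qpow (-(((m : ℂ) + 1 / 2) ^ 2 / 2)) τ

/-! ### Mock modular forms of real weight with a multiplier system -/

/-- A (unitary) multiplier system of weight `k` on `Γ`, for the principal branch of
`(cτ+d)^k`. -/
structure IsMultiplierSystem (Γ : Subgroup SL(2, ℤ)) (k : ℝ) (ν : SL(2, ℤ) → ℂ) : Prop where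
  norm_eq_one : ∀ γ ∈ Γ, ‖ν γ‖ = 1
  cocycle : ∀ γ ∈ Γ, ∀ δ ∈ Γ, ∀ τ : ℍ,
    ν (γ * δ) * cocyc (γ * δ) τ ^ (k : ℂ) =
      (ν γ * cocyc γ (δ • τ) ^ (k : ℂ)) * (ν δ * cocyc δ τ ^ (k : ℂ))
  neg_one : -1 ∈ Γ → ∀ τ : ℍ, ν (-1) * cocyc (-1) τ ^ (k : ℂ) = 1

/-- `f(γτ) = ν(γ) (cτ+d)^k f(τ)` for `γ ∈ Γ`. -/
def IsModularOfWeight (Γ : Subgroup SL(2, ℤ)) (k : ℝ) (ν : SL(2, ℤ) → ℂ) (f : ℍ → ℂ) : Prop :=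
  ∀ γ ∈ Γ, ∀ τ : ℍ, f (γ • τ) = ν γ * cocyc γ τ ^ (k : ℂ) * f τ

/-- `(f|_k γ)(τ) = (cτ+d)^(-k) f(γτ)`. -/
def slash (k : ℝ) (f : ℍ → ℂ) (γ : SL(2, ℤ)) (τ : ℍ) : ℂ :=
  cocyc γ τ ^ (-(k : ℂ)) * f (γ • τ)

def IsHolomorphic (f : ℍ → ℂ) : Prop :=
  DifferentiableOn ℂ (fun w : ℂ => f (ofComplex w)) {w | 0 < w.im}

/-- Cusp forms of real weight `k` with multiplier `ν` on `Γ`. -/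
structure IsCuspForm (Γ : Subgroup SL(2, ℤ)) (k : ℝ) (ν : SL(2, ℤ) → ℂ) (g : ℍ → ℂ) : Prop where
  holo : IsHolomorphic g
  modular : IsModularOfWeight Γ k ν g
  cusps : ∀ γ : SL(2, ℤ), IsZeroAtImInfty (slash k g γ)

/-- The non-holomorphic Eichler integral of `g`, a cusp form of weight `2 - k`:
`∫_0^∞ (t + 2y)^(-k) conj (g(τ + i t)) dt`. Up to a constant this is the integral of
`(w + τ)^(-k) conj (g(-conj w))` over the vertical line from `-conj τ` to `i∞`, and its
derivative `∂/∂(conj τ)` is `-i (2y)^(-k) conj (g(τ))`. -/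
def eichlerIntegral (k : ℝ) (g : ℍ → ℂ) (τ : ℍ) : ℂ :=
  ∫ t in Set.Ioi (0 : ℝ), (((t + 2 * τ.im) ^ (-k) : ℝ) : ℂ) *
    conj (g (ofComplex ((τ : ℂ) + t * Complex.I)))

/-- `f` is a mock modular form of weight `k` with multiplier `ν` on `Γ`, with completion `fhat`:
`f` is holomorphic, `fhat` is `f` plus the non-holomorphic Eichler integral of a cusp form of
weight `2 - k` with the conjugate multiplier (the shadow), and `fhat` transforms as a modular form
of weight `k` on `Γ` and has at most linear exponential growth at all cusps. -/
structure IsMockModularForm (Γ : Subgroup SL(2, ℤ)) (k : ℝ) (ν : SL(2, ℤ) → ℂ)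
    (f fhat : ℍ → ℂ) : Prop where
  holo : IsHolomorphic f
  shadow : ∃ g : ℍ → ℂ, IsCuspForm Γ (2 - k) (fun γ => conj (ν γ)) g ∧
    ∀ τ : ℍ, fhat τ = f τ + eichlerIntegral k g τ
  modular : IsModularOfWeight Γ k ν fhat
  growth : ∀ γ : SL(2, ℤ), ∃ a : ℝ,
    slash k fhat γ =O[atImInfty] fun τ : ℍ => Real.exp (a * τ.im)

end N4Jacobi

end

noncomputable section

namespace N4Jacobi


/-! ### The Jacobi triple product -/

section TripleProduct

open Finset

/-! Fix `τ`. Entire functions of `z` with the index one law under `z ↦ z + 1` and `z ↦ z + τ` form a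
two-dimensional space spanned by `θ₃(2z;2τ)` and `θ₂(2z;2τ)`: moving the contour by `τ` ties the
Fourier coefficients `r` and `r + 2` together (`theta_decomposition`). The functions `φ`, `θ₁²` and
`θ₁²μ` all lie in it. Here `θ₁²` vanishes at `z = 0` with coordinates `(θ₂(0;2τ), -θ₃(0;2τ))`, while
`θ₁²μ` has coordinates `(S₀, S₁)` and value `η³` at `z = 0`. Cramer's rule gives `φ η³ = φ(0) θ₁²μ +
F θ₁²` (`IsEllipticIndexOne.mul_eta_cube`). Since `q^(1/8) F` is holomorphic, bounded at infinity
and `h`-periodic, expanding it in powers of `q^(1/h)` turns this identity into the character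
expansion, with `A₀ = χ + 2 B₀`. The value `φ(0;τ)` is a modular form of weight zero, hence a
constant `χ`.

For the modularity, put `K = θ₁/η³`; its weight is `-1`, its index `1/2`, and it has no multiplier
(`thetaK_smul`). The essential point is `cexp_mul_latticeG`: `2π θ₁ (μ - C)` equals `e^(-πz²/2y)`
times a sum over the lattice points `mτ + n` of a sign times a Gaussian over `z + mτ + n`. That sum
has weight `1` under all of `SL(2, ℤ)` by a mere permutation of the lattice. The identity is proved
row by row: for fixed `m`, Poisson summation over `n` produces tails of a normal density at
half-integers. A tail is a Heaviside function, whose geometric series is the term of index `m` of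
the Appell-Lerch sum, minus half of a signed `beta`, and the `beta` parts of all rows add up to `θ₁
C`.

Inserting this in the Cramer identity gives `(F + χC) η³ K² = φ - χ K e^(-πz²/2y) G / 2π`, where
every factor other than `F + χC` has a known transformation law (`completion_smul`). So `F + χC`
transforms with the multiplier of `η⁻³`. The same argument for an arbitrary element of `SL(2, ℤ)`,
with the Jacobi slash of `φ` on the other side, bounds the growth at all cusps. Finally Jacobi's
series for `η³`, integrated term by term, shows that `χC` is the Eichler integral of `conj χ / 2 ·
η³`. -/

/-- The finite `q`-Pochhammer symbol `(q; q)_n`. -/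
def qPoch (q : ℂ) (n : ℕ) : ℂ := ∏ i ∈ range n, (1 - q ^ (i + 1))

/-- The Gaussian binomial coefficient as a quotient of `q`-Pochhammer symbols. -/
def qBinom (q : ℂ) (M j : ℕ) : ℂ :=
  if j ≤ M then qPoch q M / (qPoch q j * qPoch q (M - j)) else 0

lemma one_sub_pow_succ_ne_zero {q : ℂ} (hq : ‖q‖ < 1) (i : ℕ) : 1 - q ^ (i + 1) ≠ 0 := by
  intro h
  have h1 : ‖q ^ (i + 1)‖ < 1 := by
    rw [norm_pow]; exact pow_lt_one₀ (norm_nonneg _) hq (by omega)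
  rw [← sub_eq_zero.mp h] at h1
  simp at h1

lemma qPoch_ne_zero {q : ℂ} (hq : ‖q‖ < 1) (n : ℕ) : qPoch q n ≠ 0 :=
  prod_ne_zero_iff.mpr fun i _ => one_sub_pow_succ_ne_zero hq i

lemma qPoch_succ (q : ℂ) (n : ℕ) : qPoch q (n + 1) = qPoch q n * (1 - q ^ (n + 1)) :=
  prod_range_succ _ _

lemma qBinom_zero {q : ℂ} (hq : ‖q‖ < 1) (M : ℕ) : qBinom q M 0 = 1 := by
  have := qPoch_ne_zero hq M
  rw [qBinom, if_pos (Nat.zero_le _), Nat.sub_zero, show qPoch q 0 = 1 by simp [qPoch], one_mul,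
    div_self this]

/-- The `q`-Pascal rule. The case `j = M` is separate because there the first term on the right is
zero only by the convention for `qBinom` above the diagonal. -/
lemma qBinom_succ_succ {q : ℂ} (hq : ‖q‖ < 1) {M j : ℕ} (hj : j ≤ M) :
    qBinom q (M + 1) (j + 1) = qBinom q M (j + 1) + q ^ (M - j) * qBinom q M j := by
  have h1 := qPoch_ne_zero hq M
  have h2 := qPoch_ne_zero hq j
  have h3 := one_sub_pow_succ_ne_zero hq j
  rcases hj.eq_or_lt with rfl | hlt
  · have h4 := one_sub_pow_succ_ne_zero hq j
    simp only [qBinom, le_refl, if_true, qPoch_succ, Nat.sub_self, pow_zero]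
    simp [qPoch]
    rw [div_self, div_self]
    · exact h1
    · exact mul_ne_zero h1 h4
  · obtain ⟨d, rfl⟩ : ∃ d, M = j + 1 + d := ⟨M - (j + 1), by omega⟩
    have h4 := qPoch_ne_zero hq d
    have h5 := one_sub_pow_succ_ne_zero hq d
    have e1 : j + 1 + d + 1 - (j + 1) = d + 1 := by omega
    have e2 : j + 1 + d - (j + 1) = d := by omega
    have e3 : j + 1 + d - j = d + 1 := by omega
    simp only [qBinom, e1, e2, e3, qPoch_succ, show j + 1 ≤ j + 1 + d + 1 by omega,
      show j + 1 ≤ j + 1 + d by omega, show j ≤ j + 1 + d by omega, if_true]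
    field_simp
    ring

/-- The `q`-binomial theorem. -/
theorem prod_one_add_mul_pow {q : ℂ} (hq : ‖q‖ < 1) (x : ℂ) (M : ℕ) :
    ∏ k ∈ range M, (1 + x * q ^ k) =
      ∑ j ∈ range (M + 1), qBinom q M j * q ^ (j.choose 2) * x ^ j := by
  induction M with
  | zero => simp [qBinom_zero hq]
  | succ M ih =>
    rw [prod_range_succ, ih, sum_range_succ' _ (M + 1), mul_add, mul_one]
    have e1 : ∑ j ∈ range (M + 1), qBinom q M j * q ^ (j.choose 2) * x ^ j =
        ∑ j ∈ range (M + 1), qBinom q M (j + 1) * q ^ ((j + 1).choose 2) * x ^ (j + 1) +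
          qBinom q M 0 * q ^ (Nat.choose 0 2) * x ^ 0 := by
      rw [← sum_range_succ' (fun j => qBinom q M j * q ^ (j.choose 2) * x ^ j), sum_range_succ _ (M + 1)]
      simp [qBinom]
    rw [sum_mul]
    nth_rewrite 1 [e1]
    rw [add_right_comm, ← sum_add_distrib, qBinom_zero hq, qBinom_zero hq]
    congr 1
    refine sum_congr rfl fun j hj => ?_
    have hj' : j ≤ M := by simpa [Nat.lt_succ_iff] using hj
    rw [qBinom_succ_succ hq hj', show (j + 1).choose 2 = j.choose 2 + j by
      rw [Nat.choose_succ_succ' j 1]; simp [add_comm]]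
    have : q ^ M = q ^ (M - j) * q ^ j := by rw [← pow_add]; congr 1; omega
    rw [this]; ring

lemma qPoch_tendsto {q : ℂ} (hq : ‖q‖ < 1) :
    Tendsto (qPoch q) atTop (𝓝 (∏' k : ℕ, (1 - q ^ (k + 1)))) :=
  (ModularForm.multipliable_one_sub_pow hq).hasProd.tendsto_prod_nat

/-- The infinite `q`-Pochhammer symbol `(x; q)_∞`. -/
def qPochInf (x q : ℂ) : ℂ := ∏' k : ℕ, (1 - x * q ^ k)

lemma summable_mul_pow {q : ℂ} (hq : ‖q‖ < 1) (x : ℂ) : Summable fun k : ℕ => ‖-(x * q ^ k)‖ := by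
  simpa [norm_mul, norm_pow] using
    (summable_geometric_of_lt_one (norm_nonneg _) hq).mul_left ‖x‖

lemma multipliable_one_sub_mul_pow {q : ℂ} (hq : ‖q‖ < 1) (x : ℂ) :
    Multipliable fun k : ℕ => 1 - x * q ^ k := by
  simpa [sub_eq_add_neg] using multipliable_one_add_of_summable (summable_mul_pow hq x)

lemma qPochInf_tendsto {q : ℂ} (hq : ‖q‖ < 1) (x : ℂ) :
    Tendsto (fun N => ∏ k ∈ range N, (1 - x * q ^ k)) atTop (𝓝 (qPochInf x q)) :=
  (multipliable_one_sub_mul_pow hq x).hasProd.tendsto_prod_nat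

lemma qPochInf_ne_zero {q : ℂ} (hq : ‖q‖ < 1) {x : ℂ} (hx : ∀ k : ℕ, x * q ^ k ≠ 1) :
    qPochInf x q ≠ 0 := by
  have := tprod_one_add_ne_zero_of_summable (f := fun k : ℕ => -(x * q ^ k))
    (fun k h => hx k (by linear_combination -h)) (summable_mul_pow hq x)
  simpa [qPochInf, sub_eq_add_neg] using this

lemma qPochInf_self (q : ℂ) : qPochInf q q = ∏' k : ℕ, (1 - q ^ (k + 1)) := by
  simp [qPochInf, pow_succ']

lemma qPochInf_self_ne_zero {q : ℂ} (hq : ‖q‖ < 1) : qPochInf q q ≠ 0 :=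
  qPochInf_ne_zero hq fun k h => one_sub_pow_succ_ne_zero hq k (by rw [pow_succ', h, sub_self])

lemma qPochInf_eq_mul {q : ℂ} (hq : ‖q‖ < 1) (x : ℂ) :
    qPochInf x q = (1 - x) * qPochInf (x * q) q := by
  have h := (multipliable_one_sub_mul_pow hq (x * q))
  rw [qPochInf, qPochInf, tprod_eq_zero_mul' (by simpa [pow_succ', mul_assoc] using h)]
  simp [pow_succ', mul_assoc]

lemma differentiable_qPochInf {q : ℂ} (hq : ‖q‖ < 1) : Differentiable ℂ fun x => qPochInf x q := by
  have key : HasProdLocallyUniformlyOn (fun (k : ℕ) (x : ℂ) => 1 + -(x * q ^ k))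
      (fun x => ∏' k : ℕ, (1 + -(x * q ^ k))) Set.univ := by
    apply hasProdLocallyUniformlyOn_of_forall_compact isOpen_univ
    intro K _ hcK
    obtain ⟨R, hR⟩ := hcK.isBounded.exists_norm_le
    refine ((summable_geometric_of_lt_one (norm_nonneg _) hq).mul_left R).hasProdUniformlyOn_nat_one_add
      hcK (.of_forall fun n x hx => ?_) (fun _ => by fun_prop)
    rw [norm_neg, norm_mul, norm_pow]
    exact mul_le_mul_of_nonneg_right (hR x hx) (by positivity)
  have := key.differentiableOn (.of_forall fun _ => by
    simpa [Finset.prod_fn] using DifferentiableOn.finsetProd (fun _ _ => by fun_prop)) isOpen_univ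
  rw [differentiableOn_univ] at this
  simpa [qPochInf, sub_eq_add_neg] using this

lemma norm_exp_lt_one {τ : ℂ} (hτ : 0 < τ.im) : ‖Complex.exp (2 * Real.pi * Complex.I * τ)‖ < 1 :=
  norm_exp_two_pi_I_lt_one ⟨τ, hτ⟩

/-- The finite form of the Jacobi triple product. -/
lemma finite_triple_product {τ : ℂ} (hτ : 0 < τ.im) (z : ℂ) (N : ℕ) :
    (∏ k ∈ range N, (1 - Complex.exp (2 * Real.pi * Complex.I * z) *
        Complex.exp (2 * Real.pi * Complex.I * τ) ^ k)) *
      (∏ k ∈ range N, (1 - Complex.exp (2 * Real.pi * Complex.I * (τ - z)) *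
        Complex.exp (2 * Real.pi * Complex.I * τ) ^ k)) =
      ∑ j ∈ range (2 * N + 1), qBinom (Complex.exp (2 * Real.pi * Complex.I * τ)) (2 * N) j *
        jacobiTheta₂_term ((j : ℤ) - N) (z + 1 / 2 - τ / 2) τ := by
  set q := Complex.exp (2 * Real.pi * Complex.I * τ) with hq
  -- The `q`-binomial theorem with `2N` factors is taken at `x = -ζ q^(-N)`. The last `N` factors
  -- are then `1 - ζ q^k`; the first `N`, in reversed order, are monomials times `1 - ζ⁻¹ q^(k+1)`.
  have h := prod_one_add_mul_pow (norm_exp_lt_one hτ)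
    (Complex.exp (2 * Real.pi * Complex.I * (z + 1 / 2 - N * τ))) (2 * N)
  rw [← hq, two_mul, prod_range_add, ← prod_range_reflect] at h
  have hpi : Complex.exp (2 * Real.pi * Complex.I * (1 / 2)) = -1 := by
    rw [← Complex.exp_pi_mul_I]; ring_nf
  have e2 : ∏ k ∈ range N, (1 + Complex.exp (2 * Real.pi * Complex.I * (z + 1 / 2 - N * τ)) *
      q ^ (N + k)) = ∏ k ∈ range N, (1 - Complex.exp (2 * Real.pi * Complex.I * z) * q ^ k) := by
    refine prod_congr rfl fun k _ => ?_
    have : Complex.exp (2 * Real.pi * Complex.I * (z + 1 / 2 - N * τ)) * q ^ (N + k) =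
        - (Complex.exp (2 * Real.pi * Complex.I * z) * q ^ k) := by
      rw [hq, ← Complex.exp_nat_mul, ← Complex.exp_nat_mul, ← Complex.exp_add, ← Complex.exp_add,
        ← neg_one_mul, ← hpi, ← Complex.exp_add]
      congr 1; push_cast; ring
    rw [this]; ring
  have e1 : ∏ k ∈ range N, (1 + Complex.exp (2 * Real.pi * Complex.I * (z + 1 / 2 - N * τ)) *
      q ^ (N - 1 - k)) = (∏ k ∈ range N, Complex.exp (2 * Real.pi * Complex.I *
        (z + 1 / 2 - (k + 1) * τ))) *
        ∏ k ∈ range N, (1 - Complex.exp (2 * Real.pi * Complex.I * (τ - z)) * q ^ k) := by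
    rw [← prod_mul_distrib]
    refine prod_congr rfl fun k hk => ?_
    have hk' : k < N := by simpa using hk
    have a1 : Complex.exp (2 * Real.pi * Complex.I * (z + 1 / 2 - N * τ)) * q ^ (N - 1 - k) =
        Complex.exp (2 * Real.pi * Complex.I * (z + 1 / 2 - (k + 1) * τ)) := by
      rw [hq, ← Complex.exp_nat_mul, ← Complex.exp_add]
      congr 1
      rw [Nat.cast_sub (by omega), Nat.cast_sub (by omega)]; push_cast; ring
    have a2 : Complex.exp (2 * Real.pi * Complex.I * (z + 1 / 2 - (k + 1) * τ)) *
        (Complex.exp (2 * Real.pi * Complex.I * (τ - z)) * q ^ k) = -1 := by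
      rw [hq, ← Complex.exp_nat_mul, ← Complex.exp_add, ← Complex.exp_add, ← hpi]
      congr 1; ring
    rw [a1]; linear_combination a2
  have e3 : ∀ n : ℕ, ∏ k ∈ range n, Complex.exp (2 * Real.pi * Complex.I *
      (z + 1 / 2 - (k + 1) * τ)) =
      Complex.exp (2 * Real.pi * Complex.I * (n * (z + 1 / 2) - n * (n + 1) / 2 * τ)) := by
    intro n
    induction n with
    | zero => simp
    | succ n ih =>
      rw [prod_range_succ, ih, ← Complex.exp_add]
      congr 1; push_cast; ring
  rw [e1, e2, e3, ← two_mul] at h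
  rw [mul_assoc, mul_comm, ← eq_div_iff (Complex.exp_ne_zero _), mul_comm] at h
  rw [h, div_eq_mul_inv, sum_mul]
  refine sum_congr rfl fun j _ => ?_
  rw [mul_assoc, mul_assoc, jacobiTheta₂_term, hq, ← Complex.exp_neg, ← Complex.exp_nat_mul,
    ← Complex.exp_nat_mul, ← Complex.exp_add, ← Complex.exp_add, Nat.cast_choose_two]
  congr 2
  push_cast
  ring

/-- A convergent sequence with nonzero limit is bounded together with its inverses. This bounds all
Gaussian binomials at once, as dominated convergence in the triple product requires. -/
lemma qPoch_norm_bounds {q : ℂ} (hq : ‖q‖ < 1) :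
    ∃ C : ℝ, 0 < C ∧ ∀ n, ‖qPoch q n‖ ≤ C ∧ ‖(qPoch q n)⁻¹‖ ≤ C := by
  have h1 := qPoch_tendsto hq
  have hne : (∏' k : ℕ, (1 - q ^ (k + 1))) ≠ 0 := by
    rw [← qPochInf_self]; exact qPochInf_self_ne_zero hq
  obtain ⟨A, hA⟩ := h1.norm.bddAbove_range
  obtain ⟨B, hB⟩ := (h1.inv₀ hne).norm.bddAbove_range
  refine ⟨max (max A B) 1, by positivity, fun n => ⟨?_, ?_⟩⟩
  · exact (hA ⟨n, rfl⟩).trans ((le_max_left _ _).trans (le_max_left _ _))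
  · exact (hB ⟨n, rfl⟩).trans ((le_max_right _ _).trans (le_max_left _ _))

/-- The Jacobi triple product. -/
theorem jacobiTheta₂_eq_qPochInf {τ : ℂ} (hτ : 0 < τ.im) (z : ℂ) :
    jacobiTheta₂ (z + 1 / 2 - τ / 2) τ =
      qPochInf (Complex.exp (2 * Real.pi * Complex.I * τ))
        (Complex.exp (2 * Real.pi * Complex.I * τ)) *
      (qPochInf (Complex.exp (2 * Real.pi * Complex.I * z))
        (Complex.exp (2 * Real.pi * Complex.I * τ)) *
      qPochInf (Complex.exp (2 * Real.pi * Complex.I * (τ - z)))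
        (Complex.exp (2 * Real.pi * Complex.I * τ))) := by
  have hq := norm_exp_lt_one hτ
  have hfin := finite_triple_product hτ z
  set q := Complex.exp (2 * Real.pi * Complex.I * τ)
  have hP := qPochInf_self_ne_zero hq
  have lim1 := (qPochInf_tendsto hq (Complex.exp (2 * Real.pi * Complex.I * z))).mul
    (qPochInf_tendsto hq (Complex.exp (2 * Real.pi * Complex.I * (τ - z))))
  obtain ⟨C, hC0, hC⟩ := qPoch_norm_bounds hq
  set J := fun n : ℤ => jacobiTheta₂_term n (z + 1 / 2 - τ / 2) τ
  have hJ : Summable J := (summable_jacobiTheta₂_term_iff _ _).mpr hτ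
  -- With `n = j - N` the finite sum becomes a sum over `ℤ` supported on `|n| ≤ N`. Each Gaussian
  -- binomial tends to `1/(q;q)_∞` and is bounded by the cube of the constant above.
  have lim2 : Tendsto (fun N : ℕ => ∑' n : ℤ,
      (if n.natAbs ≤ N then qBinom q (2 * N) (n + N).toNat * J n else 0)) atTop
      (𝓝 (∑' n : ℤ, (qPochInf q q)⁻¹ * J n)) := by
    refine tendsto_tsum_of_dominated_convergence (bound := fun n => C * (C * C) * ‖J n‖)
      (hJ.norm.mul_left _) (fun n => ?_) (.of_forall fun N n => ?_)
    · have hp := qPoch_tendsto hq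
      rw [← qPochInf_self] at hp
      have t1 : Tendsto (fun N : ℕ => 2 * N) atTop atTop :=
        tendsto_atTop_atTop.mpr fun b => ⟨b, fun a ha => by omega⟩
      have t2 : Tendsto (fun N : ℕ => (n + N).toNat) atTop atTop :=
        tendsto_atTop_atTop.mpr fun b => ⟨b + n.natAbs, fun a ha => by omega⟩
      have t3 : Tendsto (fun N : ℕ => 2 * N - (n + N).toNat) atTop atTop :=
        tendsto_atTop_atTop.mpr fun b => ⟨b + n.natAbs, fun a ha => by omega⟩
      have := (((hp.comp t1).div ((hp.comp t2).mul (hp.comp t3)) (mul_ne_zero hP hP))).mul_const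
        (J n)
      rw [show qPochInf q q / (qPochInf q q * qPochInf q q) = (qPochInf q q)⁻¹ by
        field_simp] at this
      refine this.congr' ?_
      filter_upwards [eventually_ge_atTop n.natAbs] with N hN
      rw [if_pos hN, qBinom, if_pos (by omega)]
      rfl
    · split_ifs with hN
      · rw [norm_mul]
        refine mul_le_mul_of_nonneg_right ?_ (norm_nonneg _)
        rw [qBinom, if_pos (by omega), div_eq_mul_inv, mul_inv, norm_mul, norm_mul]
        gcongr
        · exact (hC _).1
        · exact (hC _).2
        · exact (hC _).2
      · simp; positivity
  have heq : ∀ N : ℕ, ∑' n : ℤ,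
      (if n.natAbs ≤ N then qBinom q (2 * N) (n + N).toNat * J n else 0) =
      ∑ j ∈ range (2 * N + 1), qBinom q (2 * N) j * J ((j : ℤ) - N) := by
    intro N
    have hinj : Function.Injective fun j : ℕ => (j : ℤ) - N := fun a b h => by simpa using h
    rw [tsum_eq_sum (s := (range (2 * N + 1)).map
      ⟨fun j : ℕ => (j : ℤ) - N, hinj⟩)]
    · rw [sum_map]
      refine sum_congr rfl fun j hj => ?_
      have : j < 2 * N + 1 := by simpa using hj
      simp only [Function.Embedding.coeFn_mk]
      rw [if_pos (by omega)]
      congr 2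
      omega
    · intro b hb
      refine if_neg fun h => hb ?_
      simp only [Finset.mem_map, mem_range, Function.Embedding.coeFn_mk]
      exact ⟨(b + N).toNat, by omega, by omega⟩
  have := tendsto_nhds_unique lim1 (lim2.congr fun N => (heq N).trans (hfin N).symm)
  rw [this, tsum_mul_left, mul_inv_cancel_left₀ hP]
  rfl

end TripleProduct

local notation "π" => Real.pi
local notation "𝕚" => Complex.I
local notation "cexp" => Complex.exp

/-! ### Theta functions -/

section Theta

lemma hasSum_of_eq {ι : Type*} {f g : ι → ℂ} {a b : ℂ} (h : HasSum f a) (hf : ∀ i, g i = f i)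
    (ha : b = a) : HasSum g b := by
  rw [ha, funext hf]; exact h

lemma cexp_two_pi_half : cexp (2 * π * 𝕚 * (1 / 2)) = -1 := by
  rw [← Complex.exp_pi_mul_I]; ring_nf

lemma cexp_pi_half : cexp (π * 𝕚 * (1 / 2)) = 𝕚 := by
  rw [show π * 𝕚 * (1 / 2) = π / 2 * 𝕚 by ring, Complex.exp_pi_div_two_mul_I]

lemma cexp_int_mul_two_pi (n : ℤ) : cexp (2 * π * 𝕚 * n) = 1 := by
  rw [← Complex.exp_int_mul_two_pi_mul_I n]; ring_nf

lemma cexp_int_mul_pi (n : ℤ) : cexp (π * 𝕚 * n) = (-1) ^ n := by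
  rw [mul_comm, Complex.exp_int_mul, Complex.exp_pi_mul_I]

lemma thetaChar_eq (a b : ℝ) (z τ : ℂ) :
    thetaChar a b z τ =
      cexp (π * 𝕚 * a ^ 2 * τ + 2 * π * 𝕚 * a * (z + b)) * jacobiTheta₂ (z + b + a * τ) τ := by
  rw [thetaChar, jacobiTheta₂, ← tsum_mul_left]
  refine tsum_congr fun n => ?_
  rw [qpow, jacobiTheta₂_term, ← Complex.exp_add, ← Complex.exp_add, ← Complex.exp_add]
  congr 1; ring

lemma theta1_eq (z τ : ℂ) :
    theta1 z τ = -𝕚 * cexp (π * 𝕚 * τ / 4 + π * 𝕚 * z) * jacobiTheta₂ (z + 1 / 2 + τ / 2) τ := by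
  have h : 𝕚 * cexp (π * 𝕚 * τ / 4 + π * 𝕚 * z) =
      cexp (π * 𝕚 * (1 / 2) + (π * 𝕚 * τ / 4 + π * 𝕚 * z)) := by
    rw [Complex.exp_add (π * 𝕚 * (1 / 2)), cexp_pi_half]
  rw [theta1, thetaChar_eq, neg_mul, h, neg_mul]
  push_cast
  congr 3 <;> ring

lemma theta2_eq (z τ : ℂ) :
    theta2 z τ = cexp (π * 𝕚 * τ / 4 + π * 𝕚 * z) * jacobiTheta₂ (z + τ / 2) τ := by
  rw [theta2, thetaChar_eq]
  push_cast
  congr 2 <;> ring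

lemma theta3_eq (z τ : ℂ) : theta3 z τ = jacobiTheta₂ z τ := by
  rw [theta3, thetaChar_eq]; simp

/-- `theta1 z τ / (1 - exp (2 π i z))`, as a product without zero at `z = 0`. -/
def theta1Quot (z τ : ℂ) : ℂ :=
  𝕚 * cexp (π * 𝕚 * τ / 4 - π * 𝕚 * z) *
    (qPochInf (cexp (2 * π * 𝕚 * τ)) (cexp (2 * π * 𝕚 * τ)) *
      (qPochInf (cexp (2 * π * 𝕚 * (τ + z))) (cexp (2 * π * 𝕚 * τ)) *
        qPochInf (cexp (2 * π * 𝕚 * (τ - z))) (cexp (2 * π * 𝕚 * τ))))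

/-- The triple product is used at `z + τ`. Splitting the first factor `1 - ζ⁻¹` off the product in
`ζ⁻¹` isolates the zeros of `θ₁` at the integers. -/
lemma theta1_eq_mul_theta1Quot {τ : ℂ} (hτ : 0 < τ.im) (z : ℂ) :
    theta1 z τ = (1 - cexp (2 * π * 𝕚 * z)) * theta1Quot z τ := by
  have h := jacobiTheta₂_eq_qPochInf hτ (z + τ)
  rw [show z + τ + 1 / 2 - τ / 2 = z + 1 / 2 + τ / 2 by ring,
    show τ - (z + τ) = -z by ring, qPochInf_eq_mul (norm_exp_lt_one hτ) (cexp (2 * π * 𝕚 * -z)),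
    ← Complex.exp_add, show 2 * π * 𝕚 * -z + 2 * π * 𝕚 * τ = 2 * π * 𝕚 * (τ - z) by ring,
    add_comm z τ] at h
  rw [theta1_eq, h, theta1Quot]
  have e : -cexp (π * 𝕚 * τ / 4 + π * 𝕚 * z) * (1 - cexp (2 * π * 𝕚 * -z)) =
      (1 - cexp (2 * π * 𝕚 * z)) * cexp (π * 𝕚 * τ / 4 - π * 𝕚 * z) := by
    rw [neg_mul, mul_sub, sub_mul, ← Complex.exp_add, ← Complex.exp_add, one_mul, mul_one, neg_sub]
    congr 2 <;> ring
  linear_combination 𝕚 * (qPochInf (cexp (2 * π * 𝕚 * τ)) (cexp (2 * π * 𝕚 * τ)) *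
      (qPochInf (cexp (2 * π * 𝕚 * (τ + z))) (cexp (2 * π * 𝕚 * τ)) *
        qPochInf (cexp (2 * π * 𝕚 * (τ - z))) (cexp (2 * π * 𝕚 * τ)))) * e

lemma differentiable_theta1Quot {τ : ℂ} (hτ : 0 < τ.im) :
    Differentiable ℂ fun z => theta1Quot z τ := by
  have hE := differentiable_qPochInf (norm_exp_lt_one hτ)
  have h1 : Differentiable ℂ fun z =>
      qPochInf (cexp (2 * π * 𝕚 * (τ + z))) (cexp (2 * π * 𝕚 * τ)) :=
    hE.comp (g := fun x => qPochInf x (cexp (2 * π * 𝕚 * τ))) (by fun_prop)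
  have h2 : Differentiable ℂ fun z =>
      qPochInf (cexp (2 * π * 𝕚 * (τ - z))) (cexp (2 * π * 𝕚 * τ)) :=
    hE.comp (g := fun x => qPochInf x (cexp (2 * π * 𝕚 * τ))) (by fun_prop)
  unfold theta1Quot
  fun_prop

lemma eta_eq (τ : ℂ) : ModularForm.eta τ =
    cexp (2 * π * 𝕚 * τ / 24) * qPochInf (cexp (2 * π * 𝕚 * τ)) (cexp (2 * π * 𝕚 * τ)) := by
  rw [ModularForm.eta, qPochInf_self]
  simp [Function.Periodic.qParam, ModularForm.eta_q_eq_pow]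

lemma theta1Quot_zero (τ : ℂ) : theta1Quot 0 τ = 𝕚 * ModularForm.eta τ ^ 3 := by
  have : cexp (π * 𝕚 * τ / 4) = cexp (2 * π * 𝕚 * τ / 24) ^ 3 := by
    rw [← Complex.exp_nat_mul]; congr 1; push_cast; ring
  rw [theta1Quot, eta_eq, mul_zero, sub_zero, sub_zero, add_zero, this]; ring

lemma theta1Quot_ne_zero {τ : ℂ} (hτ : 0 < τ.im) {z : ℂ}
    (hz : ∀ l u : ℤ, l ≠ 0 → z ≠ l * τ + u) : theta1Quot z τ ≠ 0 := by
  have hq := norm_exp_lt_one hτ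
  refine mul_ne_zero (mul_ne_zero Complex.I_ne_zero (Complex.exp_ne_zero _))
    (mul_ne_zero (qPochInf_self_ne_zero hq) (mul_ne_zero (qPochInf_ne_zero hq fun k h => ?_)
      (qPochInf_ne_zero hq fun k h => ?_)))
  · rw [← Complex.exp_nat_mul, ← Complex.exp_add, Complex.exp_eq_one_iff] at h
    obtain ⟨n, hn⟩ := h
    refine hz (-(k + 1)) n (by omega) ?_
    have := Complex.two_pi_I_ne_zero
    push_cast
    refine mul_left_cancel₀ this ?_
    linear_combination hn
  · rw [← Complex.exp_nat_mul, ← Complex.exp_add, Complex.exp_eq_one_iff] at h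
    obtain ⟨n, hn⟩ := h
    refine hz (k + 1) (-n) (by omega) ?_
    have := Complex.two_pi_I_ne_zero
    push_cast
    refine mul_left_cancel₀ this ?_
    linear_combination -hn

lemma one_sub_cexp_ne_zero {z : ℂ} (hz : ∀ u : ℤ, z ≠ u) : 1 - cexp (2 * π * 𝕚 * z) ≠ 0 := by
  intro h
  obtain ⟨n, hn⟩ := Complex.exp_eq_one_iff.mp (sub_eq_zero.mp h).symm
  exact hz n (mul_left_cancel₀ Complex.two_pi_I_ne_zero (by linear_combination hn))

lemma theta1_ne_zero {τ : ℂ} (hτ : 0 < τ.im) {z : ℂ} (hz : ∀ l u : ℤ, z ≠ l * τ + u) :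
    theta1 z τ ≠ 0 := by
  rw [theta1_eq_mul_theta1Quot hτ]
  exact mul_ne_zero (one_sub_cexp_ne_zero fun u => by simpa using hz 0 u)
    (theta1Quot_ne_zero hτ fun l u _ => hz l u)

lemma differentiable_theta1 {τ : ℂ} (hτ : 0 < τ.im) : Differentiable ℂ fun z => theta1 z τ := by
  simp_rw [theta1_eq_mul_theta1Quot hτ]
  have := differentiable_theta1Quot hτ
  fun_prop

lemma theta1_add_one (z τ : ℂ) : theta1 (z + 1) τ = -theta1 z τ := by
  rw [theta1_eq, theta1_eq, show z + 1 + 1 / 2 + τ / 2 = (z + 1 / 2 + τ / 2) + 1 by ring,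
    jacobiTheta₂_add_left, show π * 𝕚 * τ / 4 + π * 𝕚 * (z + 1) =
      (π * 𝕚 * τ / 4 + π * 𝕚 * z) + π * 𝕚 by ring, Complex.exp_add _ (π * 𝕚),
    Complex.exp_pi_mul_I]
  ring

lemma theta1_add_tau (z τ : ℂ) :
    theta1 (z + τ) τ = -cexp (-(π * 𝕚 * τ) - 2 * π * 𝕚 * z) * theta1 z τ := by
  rw [theta1_eq, theta1_eq, show z + τ + 1 / 2 + τ / 2 = (z + 1 / 2 + τ / 2) + τ by ring,
    jacobiTheta₂_add_left']
  have : cexp (π * 𝕚 * τ / 4 + π * 𝕚 * (z + τ)) * cexp (-π * 𝕚 * (τ + 2 * (z + 1 / 2 + τ / 2))) =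
      cexp (π * 𝕚) * cexp (-(π * 𝕚 * τ) - 2 * π * 𝕚 * z) * cexp (π * 𝕚 * τ / 4 + π * 𝕚 * z) := by
    rw [← Complex.exp_add, ← Complex.exp_add, ← Complex.exp_add, Complex.exp_eq_exp_iff_exists_int]
    exact ⟨-1, by push_cast; ring⟩
  rw [Complex.exp_pi_mul_I] at this
  linear_combination (-𝕚 * jacobiTheta₂ (z + 1 / 2 + τ / 2) τ) * this

lemma theta1_half (τ : ℂ) : theta1 (1 / 2) τ = theta2 0 τ := by
  rw [theta1_eq, theta2_eq, show (1 / 2 + 1 / 2 + τ / 2 : ℂ) = (0 + τ / 2) + 1 by ring,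
    jacobiTheta₂_add_left, Complex.exp_add, cexp_pi_half, mul_zero, add_zero]
  linear_combination (-cexp (π * 𝕚 * τ / 4) * jacobiTheta₂ (0 + τ / 2) τ) * Complex.I_sq

lemma theta2_zero_eq {τ : ℂ} (hτ : 0 < τ.im) :
    theta2 0 τ = 2 * cexp (π * 𝕚 * τ / 4) *
      (qPochInf (cexp (2 * π * 𝕚 * τ)) (cexp (2 * π * 𝕚 * τ)) *
        qPochInf (-cexp (2 * π * 𝕚 * τ)) (cexp (2 * π * 𝕚 * τ)) ^ 2) := by
  rw [theta2_eq, show (0 + τ / 2 : ℂ) = (τ - 1 / 2) + 1 / 2 - τ / 2 by ring,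
    jacobiTheta₂_eq_qPochInf hτ, sub_sub_cancel, cexp_two_pi_half,
    qPochInf_eq_mul (norm_exp_lt_one hτ) (-1), mul_sub, Complex.exp_sub, cexp_two_pi_half]
  rw [mul_zero, add_zero, div_neg, div_one, neg_one_mul]; ring

lemma theta3_zero_eq {τ : ℂ} (hτ : 0 < τ.im) :
    theta3 0 τ = qPochInf (cexp (2 * π * 𝕚 * τ)) (cexp (2 * π * 𝕚 * τ)) *
        qPochInf (-cexp (π * 𝕚 * τ)) (cexp (2 * π * 𝕚 * τ)) ^ 2 := by
  have h1 : cexp (2 * π * 𝕚 * (τ / 2 - 1 / 2)) = -cexp (π * 𝕚 * τ) := by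
    rw [mul_sub, Complex.exp_sub, cexp_two_pi_half, div_neg, div_one]; congr 2; ring
  have h2 : cexp (2 * π * 𝕚 * (τ - (τ / 2 - 1 / 2))) = -cexp (π * 𝕚 * τ) := by
    rw [show τ - (τ / 2 - 1 / 2) = τ / 2 + 1 / 2 by ring, mul_add, Complex.exp_add,
      cexp_two_pi_half, mul_neg_one]; congr 2; ring
  rw [theta3_eq, show (0 : ℂ) = (τ / 2 - 1 / 2) + 1 / 2 - τ / 2 by ring,
    jacobiTheta₂_eq_qPochInf hτ, h1, h2]
  ring

lemma neg_mul_pow_ne_one {x q : ℂ} (hx : ‖x‖ < 1) (hq : ‖q‖ < 1) (k : ℕ) : x * q ^ k ≠ 1 := by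
  intro h
  have : ‖x * q ^ k‖ < 1 := by
    rw [norm_mul, norm_pow]
    exact mul_lt_one_of_nonneg_of_lt_one_left (norm_nonneg _) hx
      (pow_le_one₀ (norm_nonneg _) hq.le)
  rw [h, norm_one] at this
  exact lt_irrefl _ this

lemma norm_cexp_pi_lt_one {τ : ℂ} (hτ : 0 < τ.im) : ‖cexp (π * 𝕚 * τ)‖ < 1 := by
  have := norm_exp_lt_one (τ := τ / 2) (by simpa using hτ)
  rwa [show 2 * π * 𝕚 * (τ / 2) = π * 𝕚 * τ by ring] at this

lemma theta2_zero_ne_zero {τ : ℂ} (hτ : 0 < τ.im) : theta2 0 τ ≠ 0 := by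
  have hq := norm_exp_lt_one hτ
  rw [theta2_zero_eq hτ]
  exact mul_ne_zero (mul_ne_zero two_ne_zero (Complex.exp_ne_zero _))
    (mul_ne_zero (qPochInf_self_ne_zero hq) (pow_ne_zero _ (qPochInf_ne_zero hq fun k =>
      neg_mul_pow_ne_one (by rwa [norm_neg]) hq k)))

lemma theta3_zero_ne_zero {τ : ℂ} (hτ : 0 < τ.im) : theta3 0 τ ≠ 0 := by
  have hq := norm_exp_lt_one hτ
  rw [theta3_zero_eq hτ]
  exact mul_ne_zero (qPochInf_self_ne_zero hq) (pow_ne_zero _ (qPochInf_ne_zero hq fun k =>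
      neg_mul_pow_ne_one (by rw [norm_neg]; exact norm_cexp_pi_lt_one hτ) hq k))

lemma qPochInf_mul_neg {q : ℂ} (hq : ‖q‖ < 1) (x : ℂ) :
    qPochInf x q * qPochInf (-x) q = qPochInf (x ^ 2) (q ^ 2) := by
  rw [qPochInf, qPochInf, ← (multipliable_one_sub_mul_pow hq x).tprod_mul
    (multipliable_one_sub_mul_pow hq (-x)), qPochInf]
  refine tprod_congr fun k => ?_
  ring

lemma qPochInf_even_mul_odd {q : ℂ} (hq : ‖q‖ < 1) (x : ℂ) :
    qPochInf x (q ^ 2) * qPochInf (x * q) (q ^ 2) = qPochInf x q := by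
  have hq2 : ‖q ^ 2‖ < 1 := by rw [norm_pow]; exact pow_lt_one₀ (norm_nonneg _) hq two_ne_zero
  have h := tprod_even_mul_odd (f := fun k => 1 - x * q ^ k)
    (by simpa only [pow_mul] using multipliable_one_sub_mul_pow hq2 x)
    (by simpa only [pow_succ', pow_mul, mul_assoc] using multipliable_one_sub_mul_pow hq2 (x * q))
  rw [qPochInf, qPochInf, qPochInf, ← h]
  simp only [pow_succ', pow_mul, mul_assoc]

/-- In product form this reduces to `(q;q)_∞ (-q;q)_∞ = (q²;q²)_∞` and to the splitting of
`(-q;q)_∞` into even and odd factors. It evaluates `θ₁²` at `z = 1/2` in `theta1_sq_eq`. -/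
lemma theta2_sq {τ : ℂ} (hτ : 0 < τ.im) :
    theta2 0 τ ^ 2 = 2 * theta2 0 (2 * τ) * theta3 0 (2 * τ) := by
  have hq := norm_exp_lt_one hτ
  have hτ2 : 0 < (2 * τ).im := by simpa using hτ
  rw [theta2_zero_eq hτ, theta2_zero_eq hτ2, theta3_zero_eq hτ2]
  have e1 : cexp (2 * π * 𝕚 * (2 * τ)) = cexp (2 * π * 𝕚 * τ) ^ 2 := by
    rw [← Complex.exp_nat_mul]; congr 1; push_cast; ring
  have e2 : cexp (π * 𝕚 * (2 * τ)) = cexp (2 * π * 𝕚 * τ) := by congr 1; ring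
  have e3 : cexp (π * 𝕚 * (2 * τ) / 4) = cexp (π * 𝕚 * τ / 4) ^ 2 := by
    rw [← Complex.exp_nat_mul]; congr 1; push_cast; ring
  rw [e1, e2, e3]
  set q := cexp (2 * π * 𝕚 * τ)
  have h1 := qPochInf_mul_neg hq q
  have h2 := qPochInf_even_mul_odd hq (-q)
  rw [neg_mul, ← sq] at h2
  rw [← h1, ← h2]
  ring

/-- Jacobi's identity for `η³`. -/
theorem hasSum_eta_cube {τ : ℂ} (hτ : 0 < τ.im) :
    HasSum (fun m : ℤ => (-1 : ℂ) ^ m * ((m : ℂ) + 1 / 2) * qpow (((m : ℂ) + 1 / 2) ^ 2 / 2) τ)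
      (ModularForm.eta τ ^ 3) := by
  -- The derivative of `θ₁` at `z = 0` is computed twice: from the product, where only the simple
  -- zero contributes, and then from the theta series.
  have d1 : HasDerivAt (fun z => theta1 z τ) (2 * π * ModularForm.eta τ ^ 3) 0 := by
    simp_rw [theta1_eq_mul_theta1Quot hτ]
    have a1 : HasDerivAt (fun z : ℂ => 1 - cexp (2 * π * 𝕚 * z)) (-(2 * π * 𝕚)) 0 := by
      have := (((hasDerivAt_id (0 : ℂ)).const_mul (2 * π * 𝕚)).cexp).const_sub 1
      simpa using this
    have := a1.mul ((differentiable_theta1Quot hτ) 0).hasDerivAt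
    refine this.congr_deriv ?_
    rw [theta1Quot_zero]
    simp only [mul_zero, Complex.exp_zero, sub_self, zero_mul, add_zero]
    linear_combination (-2 * π * ModularForm.eta τ ^ 3) * Complex.I_sq
  have d2 : HasDerivAt (fun z => theta1 z τ) (-𝕚 * cexp (π * 𝕚 * τ / 4) *
      (π * 𝕚 * jacobiTheta₂ (1 / 2 + τ / 2) τ + jacobiTheta₂' (1 / 2 + τ / 2) τ)) 0 := by
    simp_rw [theta1_eq]
    have a1 : HasDerivAt (fun z : ℂ => -𝕚 * cexp (π * 𝕚 * τ / 4 + π * 𝕚 * z))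
        (-𝕚 * (cexp (π * 𝕚 * τ / 4) * (π * 𝕚))) 0 := by
      have := ((((hasDerivAt_id (0 : ℂ)).const_mul (π * 𝕚)).const_add
        (π * 𝕚 * τ / 4)).cexp).const_mul (-𝕚)
      simpa using this
    have a2 : HasDerivAt (fun z : ℂ => jacobiTheta₂ (z + 1 / 2 + τ / 2) τ)
        (jacobiTheta₂' (1 / 2 + τ / 2) τ) 0 := by
      have h := hasDerivAt_jacobiTheta₂_fst (0 + 1 / 2 + τ / 2) hτ
      have := h.comp (0 : ℂ) (((hasDerivAt_id (0 : ℂ)).add_const (1 / 2)).add_const (τ / 2))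
      simpa [Function.comp_def] using this
    have := a1.mul a2
    refine this.congr_deriv ?_
    simp only [mul_zero, add_zero, zero_add]; ring
  have heq := d1.unique d2
  have hs := ((hasSum_jacobiTheta₂_term (1 / 2 + τ / 2) hτ).mul_left (π * 𝕚)).add
    (hasSum_jacobiTheta₂'_term (1 / 2 + τ / 2) hτ)
  have hs2 := hs.mul_left (-𝕚 * cexp (π * 𝕚 * τ / 4) / (2 * π))
  have hpi : (π : ℂ) ≠ 0 := by exact_mod_cast Real.pi_ne_zero
  refine hasSum_of_eq hs2 (fun m => ?_) ?_
  · rw [jacobiTheta₂'_term, jacobiTheta₂_term, qpow, ← cexp_int_mul_pi]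
    have : cexp (π * 𝕚 * τ / 4) * cexp (2 * π * 𝕚 * m * (1 / 2 + τ / 2) + π * 𝕚 * m ^ 2 * τ) =
        cexp (π * 𝕚 * m) * cexp (2 * π * 𝕚 * ((m + 1 / 2) ^ 2 / 2) * τ) := by
      rw [← Complex.exp_add, ← Complex.exp_add]; congr 1; ring
    rw [eq_comm, div_mul_eq_mul_div, div_eq_iff (by simp)]
    linear_combination (-𝕚 ^ 2 * π * (1 + 2 * m)) * this - π * (1 + 2 * m) * cexp (π * 𝕚 * m) *
      cexp (2 * π * 𝕚 * ((m + 1 / 2) ^ 2 / 2) * τ) * Complex.I_sq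
  · rw [eq_comm, div_mul_eq_mul_div, div_eq_iff (by simp)]
    linear_combination -heq

end Theta

/-! ### The automorphy factor and the modular behaviour of `θ₁ / η³` -/

section Modular

lemma cocyc_eq_denom (γ : SL(2, ℤ)) (τ : ℍ) : cocyc γ τ = UpperHalfPlane.denom γ τ := by
  rw [cocyc, ModularGroup.denom_apply]

lemma cocyc_ne_zero (γ : SL(2, ℤ)) (τ : ℍ) : cocyc γ τ ≠ 0 := by
  rw [cocyc_eq_denom]; exact UpperHalfPlane.denom_ne_zero _ _

lemma coe_smul_eq (γ : SL(2, ℤ)) (τ : ℍ) :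
    ((γ • τ : ℍ) : ℂ) = ((γ 0 0 : ℂ) * τ + (γ 0 1 : ℂ)) / cocyc γ τ := by
  rw [UpperHalfPlane.specialLinearGroup_apply, cocyc]
  simp

lemma coe_smul_mul_cocyc (γ : SL(2, ℤ)) (τ : ℍ) :
    ((γ • τ : ℍ) : ℂ) * cocyc γ τ = (γ 0 0 : ℂ) * τ + (γ 0 1 : ℂ) := by
  rw [coe_smul_eq, div_mul_cancel₀ _ (cocyc_ne_zero γ τ)]

lemma cocyc_one (τ : ℍ) : cocyc 1 τ = 1 := by simp [cocyc]

lemma cocyc_mul (γ δ : SL(2, ℤ)) (τ : ℍ) :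
    cocyc (γ * δ) τ = cocyc γ (δ • τ) * cocyc δ τ := by
  have h := coe_smul_mul_cocyc δ τ
  have e0 : (γ * δ) 1 0 = γ 1 0 * δ 0 0 + γ 1 1 * δ 1 0 := by
    simp [Matrix.SpecialLinearGroup.coe_mul, Matrix.mul_apply, Fin.sum_univ_two]
  have e1 : (γ * δ) 1 1 = γ 1 0 * δ 0 1 + γ 1 1 * δ 1 1 := by
    simp [Matrix.SpecialLinearGroup.coe_mul, Matrix.mul_apply, Fin.sum_univ_two]
  have h2 : cocyc γ (δ • τ) * cocyc δ τ =
    (γ 1 0 : ℂ) * (((δ • τ : ℍ) : ℂ) * cocyc δ τ) + γ 1 1 * cocyc δ τ := by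
    rw [cocyc]; ring
  rw [h2, h, cocyc, cocyc, e0, e1]
  push_cast; ring

lemma det_eq (γ : SL(2, ℤ)) : (γ 0 0 : ℂ) * γ 1 1 - γ 0 1 * γ 1 0 = 1 := by
  have := γ.det_coe
  rw [Matrix.det_fin_two] at this
  exact_mod_cast this

/-- The index cocycle `c z² / (cτ + d)`. -/
lemma indexCocycle_mul (γ δ : SL(2, ℤ)) (τ : ℍ) (z : ℂ) :
    ((γ * δ) 1 0 : ℂ) * z ^ 2 / cocyc (γ * δ) τ =
      (γ 1 0 : ℂ) * (z / cocyc δ τ) ^ 2 / cocyc γ (δ • τ) + (δ 1 0 : ℂ) * z ^ 2 / cocyc δ τ := by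
  have h1 := cocyc_ne_zero δ τ
  have h2 := cocyc_ne_zero γ (δ • τ)
  have h3 : cocyc γ (δ • τ) * cocyc δ τ =
      (γ 1 0 : ℂ) * ((δ 0 0 : ℂ) * τ + δ 0 1) + γ 1 1 * cocyc δ τ := by
    rw [← coe_smul_mul_cocyc, cocyc]; ring
  have e0 : (γ * δ) 1 0 = γ 1 0 * δ 0 0 + γ 1 1 * δ 1 0 := by
    simp [Matrix.SpecialLinearGroup.coe_mul, Matrix.mul_apply, Fin.sum_univ_two]
  have hd := det_eq δ
  rw [cocyc_mul, e0]
  push_cast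
  field_simp
  have h4 : cocyc δ τ = (δ 1 0 : ℂ) * τ + δ 1 1 := rfl
  linear_combination z ^ 2 * ((-(δ 1 0 : ℂ)) * h3 + ((γ 1 0 : ℂ) * δ 0 0) * h4 + (γ 1 0 : ℂ) * hd)

/-- The quotient `θ₁ / η³`. -/
def thetaK (z : ℂ) (τ : ℍ) : ℂ := theta1 z τ / ModularForm.eta τ ^ 3

lemma eta_cube_ne_zero (τ : ℍ) : ModularForm.eta τ ^ 3 ≠ 0 :=
  pow_ne_zero _ (ModularForm.eta_ne_zero τ.2)

lemma thetaK_ne_zero {z : ℂ} {τ : ℍ} (hz : ∀ l u : ℤ, z ≠ l * (τ : ℂ) + u) : thetaK z τ ≠ 0 :=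
  div_ne_zero (theta1_ne_zero τ.2 hz) (eta_cube_ne_zero τ)

/-- The factors `q^(1/8)` of `θ₁` and `η³` cancel, so `τ` enters only through `q`. Invariance under
`τ ↦ τ + 1` is then visible. -/
lemma thetaK_eq (z : ℂ) (τ : ℍ) : thetaK z τ =
    (1 - cexp (2 * π * 𝕚 * z)) * (𝕚 * cexp (-(π * 𝕚 * z)) *
      (qPochInf (cexp (2 * π * 𝕚 * τ) * cexp (2 * π * 𝕚 * z)) (cexp (2 * π * 𝕚 * τ)) *
        qPochInf (cexp (2 * π * 𝕚 * τ) * cexp (-(2 * π * 𝕚 * z))) (cexp (2 * π * 𝕚 * τ)))) /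
      qPochInf (cexp (2 * π * 𝕚 * τ)) (cexp (2 * π * 𝕚 * τ)) ^ 2 := by
  have h0 := qPochInf_self_ne_zero (norm_exp_lt_one τ.2)
  have e : cexp (π * 𝕚 * τ / 4 - π * 𝕚 * z) =
      cexp (2 * π * 𝕚 * τ / 24) ^ 3 * cexp (-(π * 𝕚 * z)) := by
    rw [← Complex.exp_nat_mul, ← Complex.exp_add]; congr 1; push_cast; ring
  rw [thetaK, theta1_eq_mul_theta1Quot τ.2, theta1Quot, eta_eq, e, mul_add, mul_sub,
    Complex.exp_add, sub_eq_add_neg (2 * π * 𝕚 * (τ : ℂ)), Complex.exp_add (2 * π * 𝕚 * (τ : ℂ)),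
    div_eq_div_iff (pow_ne_zero _ (mul_ne_zero (Complex.exp_ne_zero _) h0)) (pow_ne_zero _ h0)]
  ring

/-- The weight `-1`, index `1/2` transformation law of `thetaK` under `γ`. -/
def ThetaKTransforms (γ : SL(2, ℤ)) : Prop := ∀ (z : ℂ) (τ : ℍ),
  thetaK (z / cocyc γ τ) (γ • τ) =
    (cocyc γ τ)⁻¹ * cexp (π * 𝕚 * ((γ 1 0 : ℂ) * z ^ 2 / cocyc γ τ)) * thetaK z τ

lemma ThetaKTransforms.mul {γ δ : SL(2, ℤ)} (hγ : ThetaKTransforms γ) (hδ : ThetaKTransforms δ) :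
    ThetaKTransforms (γ * δ) := by
  intro z τ
  rw [indexCocycle_mul, mul_smul, cocyc_mul, mul_comm (cocyc γ _), ← div_div, hγ, hδ, mul_add,
    Complex.exp_add, mul_inv]
  ring

lemma thetaKTransforms_one : ThetaKTransforms 1 := by
  intro z τ
  simp [cocyc_one]

lemma ThetaKTransforms.inv {γ : SL(2, ℤ)} (hγ : ThetaKTransforms γ) : ThetaKTransforms γ⁻¹ := by
  intro z τ
  have h := hγ (z / cocyc γ⁻¹ τ) (γ⁻¹ • τ)
  have hj := cocyc_mul γ γ⁻¹ τ
  have hi := indexCocycle_mul γ γ⁻¹ τ z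
  rw [mul_inv_cancel] at hi hj
  rw [cocyc_one] at hj
  have h0 := cocyc_ne_zero γ⁻¹ τ
  have h1 : (cocyc γ (γ⁻¹ • τ))⁻¹ = cocyc γ⁻¹ τ := inv_eq_of_mul_eq_one_right hj.symm
  have h2 : π * 𝕚 * ((γ 1 0 : ℂ) * (z / cocyc γ⁻¹ τ) ^ 2 / cocyc γ (γ⁻¹ • τ)) =
      -(π * 𝕚 * ((γ⁻¹ 1 0 : ℂ) * z ^ 2 / cocyc γ⁻¹ τ)) := by
    have : ((1 : SL(2, ℤ)) 1 0 : ℂ) = 0 := by simp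
    rw [this] at hi
    linear_combination (-(π * 𝕚)) * hi
  rw [smul_inv_smul, h1, div_div, mul_comm (cocyc γ⁻¹ τ), ← hj, div_one, h2, Complex.exp_neg] at h
  rw [h]
  field_simp

lemma thetaKTransforms_T : ThetaKTransforms ModularGroup.T := by
  intro z τ
  have e0 : cocyc ModularGroup.T τ = 1 := by simp [cocyc, ModularGroup.T]
  have e1 : (ModularGroup.T 1 0 : ℂ) = 0 := by simp [ModularGroup.T]
  have e2 : ((ModularGroup.T • τ : ℍ) : ℂ) = τ + 1 := by
    rw [UpperHalfPlane.modular_T_smul, UpperHalfPlane.coe_vadd]; push_cast; ring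
  have e3 : cexp (2 * π * 𝕚 * ((ModularGroup.T • τ : ℍ) : ℂ)) = cexp (2 * π * 𝕚 * τ) := by
    rw [e2, mul_add, mul_one, Complex.exp_add, Complex.exp_two_pi_mul_I, mul_one]
  rw [e0, e1, thetaK_eq, thetaK_eq z τ, e3]
  simp

/-- Reconciles the root `(-iτ)^(1/2)` in the functional equation of `jacobiTheta₂` with the square
roots in that of `η`. The arguments of `-i` and `τ` add up within the principal branch because `0 ≤
arg τ ≤ π`. -/
lemma neg_I_mul_cpow_half (τ : ℍ) :
    (-𝕚 * τ) ^ (1 / 2 : ℂ) = (Complex.sqrt 𝕚)⁻¹ * Complex.sqrt τ := by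
  have h0 : (τ : ℂ) ≠ 0 := UpperHalfPlane.ne_zero τ
  have hI : -𝕚 ≠ 0 := neg_ne_zero.mpr Complex.I_ne_zero
  have harg : 0 ≤ (τ : ℂ).arg := Complex.arg_nonneg_iff.mpr τ.2.le
  have harg2 := Complex.arg_le_pi (τ : ℂ)
  have hlog : Complex.log (-𝕚 * τ) = Complex.log (-𝕚) + Complex.log τ := by
    rw [Complex.log_mul_eq_add_log_iff hI h0, Complex.arg_neg_I]
    constructor <;> linarith [Real.pi_pos]
  rw [Complex.sqrt, Complex.sqrt, Complex.cpow_def_of_ne_zero (mul_ne_zero hI h0),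
    Complex.cpow_def_of_ne_zero Complex.I_ne_zero, Complex.cpow_def_of_ne_zero h0, hlog,
    ← Complex.exp_neg, ← Complex.exp_add, Complex.log_neg_I, Complex.log_I]
  congr 1; ring

lemma neg_I_mul_cpow_half_sq (τ : ℂ) : ((-𝕚 * τ) ^ (1 / 2 : ℂ)) ^ 2 = -𝕚 * τ := by
  rw [← Complex.cpow_nat_mul]; simp

lemma eta_neg_one_div (τ : ℍ) :
    ModularForm.eta (-1 / (τ : ℂ)) = (-𝕚 * τ) ^ (1 / 2 : ℂ) * ModularForm.eta τ := by
  have := ModularForm.eta_comp_eq_csqrt_I_inv τ.2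
  simp only [Function.comp_apply, Pi.smul_apply, Pi.mul_apply, smul_eq_mul] at this
  rw [this, neg_I_mul_cpow_half]; ring

lemma theta1_div_tau (z : ℂ) (τ : ℍ) :
    theta1 (z / τ) (-1 / τ) =
      -𝕚 * (-𝕚 * τ) ^ (1 / 2 : ℂ) * cexp (π * 𝕚 * z ^ 2 / τ) * theta1 z τ := by
  have h0 : (τ : ℂ) ≠ 0 := UpperHalfPlane.ne_zero τ
  have hs : (-𝕚 * (τ : ℂ)) ^ (1 / 2 : ℂ) ≠ 0 := by
    rw [Ne, Complex.cpow_eq_zero_iff]; simp [h0]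
  have hf := jacobiTheta₂_functional_equation (z + 1 / 2 + τ / 2) τ
  -- The functional equation evaluates the theta series at `z/τ + 1/2 + 1/(2τ)`; `θ₁` needs it at
  -- `z/τ + 1/2 - 1/(2τ)`, one quasi-period `-1/τ` away.
  have hq := jacobiTheta₂_add_left' ((z + 1 / 2 + τ / 2) / τ) (-1 / (τ : ℂ))
  rw [theta1_eq, theta1_eq, show z / τ + 1 / 2 + -1 / (τ : ℂ) / 2 =
    (z + 1 / 2 + τ / 2) / τ + -1 / (τ : ℂ) by field_simp; ring, hq, hf]
  have hI : (-𝕚 : ℂ) = cexp (-(π * 𝕚 * (1 / 2))) := by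
    rw [Complex.exp_neg, cexp_pi_half, Complex.inv_I]
  have key : cexp (π * 𝕚 * (-1 / (τ : ℂ)) / 4 + π * 𝕚 * (z / τ)) *
      cexp (-π * 𝕚 * (-1 / (τ : ℂ) + 2 * ((z + 1 / 2 + τ / 2) / τ))) =
      (-𝕚) * cexp (π * 𝕚 * z ^ 2 / τ) * (cexp (π * 𝕚 * τ / 4 + π * 𝕚 * z) *
        cexp (-π * 𝕚 * (z + 1 / 2 + τ / 2) ^ 2 / τ)) := by
    rw [hI, ← Complex.exp_add, ← Complex.exp_add, ← Complex.exp_add, ← Complex.exp_add]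
    congr 1
    field_simp
    ring
  set s := (-𝕚 * (τ : ℂ)) ^ (1 / 2 : ℂ)
  rw [one_div s, show -𝕚 * s * cexp (π * 𝕚 * z ^ 2 / τ) * (-𝕚 * cexp (π * 𝕚 * τ / 4 + π * 𝕚 * z) *
    (s⁻¹ * cexp (-π * 𝕚 * (z + 1 / 2 + τ / 2) ^ 2 / τ) *
      jacobiTheta₂ ((z + 1 / 2 + τ / 2) / τ) (-1 / τ))) = (s * s⁻¹) * (-𝕚) * ((-𝕚) *
      cexp (π * 𝕚 * z ^ 2 / τ) * (cexp (π * 𝕚 * τ / 4 + π * 𝕚 * z) *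
        cexp (-π * 𝕚 * (z + 1 / 2 + τ / 2) ^ 2 / τ))) *
        jacobiTheta₂ ((z + 1 / 2 + τ / 2) / τ) (-1 / τ) by ring, ← key, mul_inv_cancel₀ hs]
  ring

lemma thetaKTransforms_S : ThetaKTransforms ModularGroup.S := by
  intro z τ
  have h0 : (τ : ℂ) ≠ 0 := UpperHalfPlane.ne_zero τ
  have e0 : cocyc ModularGroup.S τ = τ := by simp [cocyc, ModularGroup.S]
  have e1 : (ModularGroup.S 1 0 : ℂ) = 1 := by simp [ModularGroup.S]
  have e2 : ((ModularGroup.S • τ : ℍ) : ℂ) = -1 / τ := by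
    rw [UpperHalfPlane.modular_S_smul]; simp [neg_div, inv_neg]
  have hη := eta_cube_ne_zero τ
  have hs2 := neg_I_mul_cpow_half_sq τ
  have hs : (-𝕚 * (τ : ℂ)) ^ (1 / 2 : ℂ) ≠ 0 := by
    rw [Ne, Complex.cpow_eq_zero_iff]; simp [h0]
  rw [e0, e1, thetaK, thetaK, e2, theta1_div_tau, eta_neg_one_div, one_mul,
    show π * 𝕚 * (z ^ 2 / (τ : ℂ)) = π * 𝕚 * z ^ 2 / τ by ring]
  set s := (-𝕚 * (τ : ℂ)) ^ (1 / 2 : ℂ)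
  rw [mul_pow, show s ^ 3 = s * s ^ 2 by ring, hs2]
  have hI := Complex.I_ne_zero
  field_simp

/-- The multipliers of `θ₁` and `η³` cancel, so the automorphy factor is a genuine cocycle. The law
is therefore stable under products and inverses and need only be checked on the generators `S` and
`T`. -/
theorem thetaK_smul (γ : SL(2, ℤ)) (z : ℂ) (τ : ℍ) :
    thetaK (z / cocyc γ τ) (γ • τ) =
      (cocyc γ τ)⁻¹ * cexp (π * 𝕚 * ((γ 1 0 : ℂ) * z ^ 2 / cocyc γ τ)) * thetaK z τ := by
  have hγ : γ ∈ Subgroup.closure {ModularGroup.S, ModularGroup.T} := by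
    simp [SpecialLinearGroup.SL2Z_generators]
  suffices ThetaKTransforms γ from this z τ
  induction hγ using Subgroup.closure_induction with
  | mem x hx =>
    rcases hx with rfl | rfl
    · exact thetaKTransforms_S
    · exact thetaKTransforms_T
  | one => exact thetaKTransforms_one
  | mul x y _ _ hx hy => exact hx.mul hy
  | inv x _ hx => exact hx.inv

end Modular

/-! ### Theta decomposition of entire functions of index one -/

section Decomposition

open MeasureTheory

lemma hasSum_int_even_odd {f : ℤ → ℂ} {a b : ℂ} (he : HasSum (fun k : ℤ => f (2 * k)) a)
    (ho : HasSum (fun k : ℤ => f (2 * k + 1)) b) : HasSum f (a + b) := by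
  have h2 : Function.Injective fun k : ℤ => 2 * k := mul_right_injective₀ (two_ne_zero' ℤ)
  replace ho := ((add_left_injective (1 : ℤ)).comp h2).hasSum_range_iff.2 ho
  refine (h2.hasSum_range_iff.2 he).add_isCompl ?_ ho
  simpa [Function.comp_def] using Int.isCompl_even_odd

/-- Cauchy's theorem on a rectangle of width one: its vertical sides cancel by periodicity. A real
translation is absorbed by periodicity as well. -/
lemma integral_add_eq_of_periodic {g : ℂ → ℂ} (hg : Differentiable ℂ g) (h1 : ∀ z, g (z + 1) = g z)
    (w : ℂ) : ∫ x in (0 : ℝ)..1, g (x + w) = ∫ x in (0 : ℝ)..1, g x := by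
  have hrect := Complex.integral_boundary_rect_eq_zero_of_differentiableOn g (w.re : ℂ)
    (w + 1) hg.differentiableOn
  simp only [Complex.ofReal_re, Complex.add_re, Complex.one_re, Complex.ofReal_im,
    Complex.ofReal_zero, zero_mul, add_zero, Complex.add_im, Complex.one_im] at hrect
  have hv : ∫ y in (0 : ℝ)..w.im, g (((w.re + 1 : ℝ) : ℂ) + y * 𝕚) =
      ∫ y in (0 : ℝ)..w.im, g ((w.re : ℂ) + y * 𝕚) := by
    refine intervalIntegral.integral_congr fun y _ => ?_
    rw [← h1 ((w.re : ℂ) + y * 𝕚)]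
    congr 1; push_cast; ring
  rw [hv, add_sub_cancel_right, sub_eq_zero] at hrect
  have hp : Function.Periodic (fun x : ℝ => g x) 1 := fun x => by
    have := h1 x
    simpa using this
  have e1 := hp.intervalIntegral_add_eq w.re 0
  rw [zero_add] at e1
  rw [← e1, hrect]
  have e2 := intervalIntegral.integral_comp_add_right (a := 0) (b := 1)
    (fun x : ℝ => g (x + w.im * 𝕚)) w.re
  rw [zero_add, add_comm 1 w.re] at e2
  rw [← e2]
  refine intervalIntegral.integral_congr fun x _ => ?_
  congr 1
  conv_lhs => rw [← Complex.re_add_im w]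
  push_cast; ring

/-- The coefficient of `ζ^r` in the Fourier expansion of a `1`-periodic function. -/
def fourierCoef (f : ℂ → ℂ) (r : ℤ) : ℂ :=
  ∫ x in (0 : ℝ)..1, f x * cexp (-(2 * π * 𝕚 * r * x))

lemma fourierCoef_add {f : ℂ → ℂ} (hf : Differentiable ℂ f) (h1 : ∀ z, f (z + 1) = f z) (r : ℤ)
    (w : ℂ) : ∫ x in (0 : ℝ)..1, f (x + w) * cexp (-(2 * π * 𝕚 * r * (x + w))) =
      fourierCoef f r := by
  refine integral_add_eq_of_periodic (g := fun z => f z * cexp (-(2 * π * 𝕚 * r * z)))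
    (by fun_prop) (fun z => ?_) w
  rw [h1, mul_add, neg_add, Complex.exp_add, mul_one, Complex.exp_neg (2 * π * 𝕚 * r),
    cexp_int_mul_two_pi]
  simp

/-- The contour is moved from `[0, 1]` to `[0, 1] + τ`; the factor `e^(-4πiz)` in the transformation
law then changes the frequency by two. -/
lemma fourierCoef_add_two {f : ℂ → ℂ} (hf : Differentiable ℂ f) {τ : ℂ}
    (h1 : ∀ z, f (z + 1) = f z) (h2 : ∀ z, f (z + τ) = cexp (-(2 * π * 𝕚 * (τ + 2 * z))) * f z)
    (r : ℤ) : fourierCoef f (r + 2) = cexp (2 * π * 𝕚 * (r + 1) * τ) * fourierCoef f r := by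
  rw [← fourierCoef_add hf h1 r τ, fourierCoef, ← intervalIntegral.integral_const_mul]
  refine intervalIntegral.integral_congr fun x _ => ?_
  have e : cexp (-(2 * π * 𝕚 * (r + 2 : ℤ) * x)) = cexp (2 * π * 𝕚 * (r + 1) * τ) *
      (cexp (-(2 * π * 𝕚 * (τ + 2 * x))) * cexp (-(2 * π * 𝕚 * r * (x + τ)))) := by
    rw [← Complex.exp_add, ← Complex.exp_add]
    congr 1; push_cast; ring
  rw [h2, e]; ring

lemma fourierCoef_even {f : ℂ → ℂ} (hf : Differentiable ℂ f) {τ : ℂ}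
    (h1 : ∀ z, f (z + 1) = f z) (h2 : ∀ z, f (z + τ) = cexp (-(2 * π * 𝕚 * (τ + 2 * z))) * f z)
    (l : ℤ) : fourierCoef f (2 * l) = cexp (2 * π * 𝕚 * l ^ 2 * τ) * fourierCoef f 0 := by
  have hrec := fourierCoef_add_two hf h1 h2
  induction l using Int.induction_on with
  | zero => simp
  | succ l ih =>
    rw [show (2 * ((l : ℤ) + 1)) = 2 * l + 2 by ring, hrec, ih, ← mul_assoc, ← Complex.exp_add]
    congr 2; push_cast; ring
  | pred l ih =>
    have h := hrec (2 * (-(l : ℤ) - 1))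
    rw [show 2 * (-(l : ℤ) - 1) + 2 = 2 * -l by ring, ih] at h
    have h' := congrArg (cexp (-(2 * π * 𝕚 * ((2 * (-(l : ℤ) - 1) : ℤ) + 1) * τ)) * ·) h
    simp only [← mul_assoc, ← Complex.exp_add, neg_add_cancel, Complex.exp_zero, one_mul] at h'
    rw [← h']
    congr 2; push_cast; ring

lemma fourierCoef_odd {f : ℂ → ℂ} (hf : Differentiable ℂ f) {τ : ℂ}
    (h1 : ∀ z, f (z + 1) = f z) (h2 : ∀ z, f (z + τ) = cexp (-(2 * π * 𝕚 * (τ + 2 * z))) * f z)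
    (l : ℤ) : fourierCoef f (2 * l + 1) =
      cexp (2 * π * 𝕚 * (l ^ 2 + l) * τ) * fourierCoef f 1 := by
  have hrec := fourierCoef_add_two hf h1 h2
  induction l using Int.induction_on with
  | zero => simp
  | succ l ih =>
    rw [show (2 * ((l : ℤ) + 1) + 1) = 2 * l + 1 + 2 by ring, hrec, ih, ← mul_assoc,
      ← Complex.exp_add]
    congr 2; push_cast; ring
  | pred l ih =>
    have h := hrec (2 * (-(l : ℤ) - 1) + 1)
    rw [show 2 * (-(l : ℤ) - 1) + 1 + 2 = 2 * -l + 1 by ring, ih] at h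
    have h' := congrArg (cexp (-(2 * π * 𝕚 * ((2 * (-(l : ℤ) - 1) + 1 : ℤ) + 1) * τ)) * ·) h
    simp only [← mul_assoc, ← Complex.exp_add, neg_add_cancel, Complex.exp_zero, one_mul] at h'
    rw [← h']
    congr 2; push_cast; ring

/-- Fourier inversion on the horizontal line through `z`, evaluated at the real parameter `0`. The
coefficients on that line are those on the real line times `e^(2πirz)`. -/
lemma hasSum_fourierCoef {f : ℂ → ℂ} (hf : Differentiable ℂ f) (h1 : ∀ z, f (z + 1) = f z) (z : ℂ)
    (hs : Summable fun r : ℤ => fourierCoef f r * cexp (2 * π * 𝕚 * r * z)) :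
    HasSum (fun r : ℤ => fourierCoef f r * cexp (2 * π * 𝕚 * r * z)) (f z) := by
  have hp : Function.Periodic (fun x : ℝ => f (x + z)) 1 := fun x => by
    beta_reduce
    rw [← h1 (x + z)]
    congr 1; push_cast; ring
  have hcont : Continuous fun x : ℝ => f (x + z) := hf.continuous.comp (by fun_prop)
  let F : C(AddCircle (1 : ℝ), ℂ) := ⟨hp.lift, continuous_coinduced_dom.mpr hcont⟩
  have hF : ∀ x : ℝ, F (x : AddCircle (1 : ℝ)) = f (x + z) := fun x => rfl
  have hc : ∀ r : ℤ, fourierCoeff F r = fourierCoef f r * cexp (2 * π * 𝕚 * r * z) := by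
    intro r
    rw [fourierCoeff_eq_intervalIntegral F r 0, ← fourierCoef_add hf h1 r z, div_one, one_smul,
      zero_add, ← intervalIntegral.integral_mul_const]
    refine intervalIntegral.integral_congr fun x _ => ?_
    rw [hF, fourier_coe_apply, smul_eq_mul, mul_assoc (f _), ← Complex.exp_add, mul_comm (f _)]
    congr 2; push_cast; ring
  have h := has_pointwise_sum_fourier_series_of_summable (f := F) (by rwa [funext hc])
    ((0 : ℝ) : AddCircle (1 : ℝ))
  rw [hF] at h
  refine hasSum_of_eq h (fun r => ?_) (by simp)
  rw [hc, fourier_coe_apply]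
  simp

/-- An entire function which is `1`-periodic and satisfies the index one transformation law under
`z ↦ z + τ` is a combination of `θ₃(2z;2τ)` and `θ₂(2z;2τ)`. -/
theorem theta_decomposition {f : ℂ → ℂ} (hf : Differentiable ℂ f) {τ : ℂ} (hτ : 0 < τ.im)
    (h1 : ∀ z, f (z + 1) = f z) (h2 : ∀ z, f (z + τ) = cexp (-(2 * π * 𝕚 * (τ + 2 * z))) * f z)
    (z : ℂ) : f z = fourierCoef f 0 * theta3 (2 * z) (2 * τ) +
      qpow (-(1 / 4)) τ * fourierCoef f 1 * theta2 (2 * z) (2 * τ) := by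
  have hτ2 : 0 < (2 * τ).im := by simpa using hτ
  have he := (hasSum_jacobiTheta₂_term (2 * z) hτ2).mul_left (fourierCoef f 0)
  have ho := (hasSum_jacobiTheta₂_term (2 * z + τ) hτ2).mul_left
    (fourierCoef f 1 * cexp (2 * π * 𝕚 * z))
  have hsum : HasSum (fun r : ℤ => fourierCoef f r * cexp (2 * π * 𝕚 * r * z)) _ :=
    hasSum_int_even_odd
      (hasSum_of_eq he (fun l => by
        rw [fourierCoef_even hf h1 h2, jacobiTheta₂_term, mul_comm (cexp _), mul_assoc,
          ← Complex.exp_add]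
        congr 2; push_cast; ring) rfl)
      (hasSum_of_eq ho (fun l => by
        have e : cexp (2 * π * 𝕚 * (l ^ 2 + l) * τ) * cexp (2 * π * 𝕚 * (2 * l + 1 : ℤ) * z) =
            cexp (2 * π * 𝕚 * z) *
              cexp (2 * π * 𝕚 * l * (2 * z + τ) + π * 𝕚 * l ^ 2 * (2 * τ)) := by
          rw [← Complex.exp_add, ← Complex.exp_add]
          congr 1; push_cast; ring
        rw [fourierCoef_odd hf h1 h2, jacobiTheta₂_term]
        linear_combination fourierCoef f 1 * e) rfl)
  have e : cexp (2 * π * 𝕚 * z) = cexp (2 * π * 𝕚 * -(1 / 4) * τ) *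
      cexp (π * 𝕚 * (2 * τ) / 4 + π * 𝕚 * (2 * z)) := by
    rw [← Complex.exp_add]; congr 1; ring
  rw [(hasSum_fourierCoef hf h1 z hsum.summable).unique hsum, theta3_eq, theta2_eq, qpow, e,
    show 2 * τ / 2 = τ by ring]
  ring

lemma theta3_two_mul_half (τ : ℂ) : theta3 (2 * (1 / 2)) (2 * τ) = theta3 0 (2 * τ) := by
  rw [theta3_eq, theta3_eq, show (2 * (1 / 2) : ℂ) = 0 + 1 by norm_num, jacobiTheta₂_add_left]

lemma theta2_two_mul_half (τ : ℂ) : theta2 (2 * (1 / 2)) (2 * τ) = -theta2 0 (2 * τ) := by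
  rw [theta2_eq, theta2_eq, show (2 * (1 / 2) + 2 * τ / 2 : ℂ) = (0 + 2 * τ / 2) + 1 by ring,
    jacobiTheta₂_add_left, show (2 * (1 / 2) : ℂ) = 1 by norm_num, Complex.exp_add, mul_one,
    Complex.exp_pi_mul_I, mul_zero, add_zero]
  ring

lemma theta1_zero {τ : ℂ} (hτ : 0 < τ.im) : theta1 0 τ = 0 := by
  rw [theta1_eq_mul_theta1Quot hτ]; simp

/-- The two coordinates are determined by the values at `z = 0`, where `θ₁` vanishes, and at `z =
1/2`, where `θ₁² = θ₂(0;τ)²` is given by `theta2_sq`. -/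
lemma theta1_sq_eq {τ : ℂ} (hτ : 0 < τ.im) (z : ℂ) :
    theta1 z τ ^ 2 = theta2 0 (2 * τ) * theta3 (2 * z) (2 * τ) -
      theta3 0 (2 * τ) * theta2 (2 * z) (2 * τ) := by
  have hτ2 : 0 < (2 * τ).im := by simpa using hτ
  have hd := theta_decomposition (f := fun z => theta1 z τ ^ 2) (τ := τ)
    ((differentiable_theta1 hτ).pow 2) hτ (fun z => by simp only [theta1_add_one, neg_sq])
    (fun z => by
      simp only [theta1_add_tau, mul_pow, neg_sq]
      rw [← Complex.exp_nat_mul]; congr 2; push_cast; ring)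
  set a := fourierCoef (fun z => theta1 z τ ^ 2) 0
  set b := qpow (-(1 / 4)) τ * fourierCoef (fun z => theta1 z τ ^ 2) 1
  have d0 := hd 0
  have d1 := hd (1 / 2)
  have t3 := theta3_zero_ne_zero hτ2
  have t2 := theta2_zero_ne_zero hτ2
  simp only [theta3_two_mul_half, theta2_two_mul_half, theta1_half, theta2_sq hτ] at d1
  simp only [theta1_zero hτ, mul_zero] at d0
  have ha : a = theta2 0 (2 * τ) := mul_right_cancel₀ t3 (by linear_combination -(d0 + d1) / 2)
  have hb : b = -theta3 0 (2 * τ) := mul_right_cancel₀ t2 (by linear_combination (d1 - d0) / 2)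
  rw [hd z, ha, hb]; ring

end Decomposition

/-! ### The Appell-Lerch sum and the function `θ₁² μ` -/

section Appell

/-- The terms of the Appell-Lerch sum. -/
def appellTerm (n : ℤ) (z τ : ℂ) : ℂ :=
  (-1 : ℂ) ^ n * qpow ((n : ℂ) * ((n : ℂ) + 1) / 2) τ * cexp (2 * π * 𝕚 * (n : ℂ) * z) /
    (1 - cexp (2 * π * 𝕚 * z) * qpow (n : ℂ) τ)

def appell (z τ : ℂ) : ℂ := ∑' n : ℤ, appellTerm n z τ

/-- The product `θ₁² μ`, without the extension to the lattice points. -/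
def thetaSqMuRaw (z : ℂ) (τ : ℍ) : ℂ := theta1 z τ ^ 2 * mu z τ

lemma theta1_mul_mu {z : ℂ} {τ : ℍ} (h : theta1 z τ ≠ 0) :
    theta1 z τ * mu z τ = -𝕚 * cexp (π * 𝕚 * z) * appell z τ := by
  rw [show mu z τ = -𝕚 * cexp (π * 𝕚 * z) / theta1 z τ * appell z τ from rfl,
    ← mul_assoc, mul_div_cancel₀ _ h]

/-- One factor `θ₁` cancels the denominator of `μ`. At a zero of `θ₁` both sides are zero, so no
condition on `z` is needed. -/
lemma thetaSqMuRaw_eq (z : ℂ) (τ : ℍ) :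
    thetaSqMuRaw z τ = -𝕚 * cexp (π * 𝕚 * z) * (theta1 z τ * appell z τ) := by
  by_cases h : theta1 z τ = 0
  · simp [thetaSqMuRaw, h]
  · rw [thetaSqMuRaw, sq, mul_assoc, theta1_mul_mu h]; ring

lemma appellTerm_add_one (n : ℤ) (z τ : ℂ) : appellTerm n (z + 1) τ = appellTerm n z τ := by
  rw [appellTerm, appellTerm, mul_add _ z, mul_add _ z, mul_one, mul_one, Complex.exp_add,
    Complex.exp_add, cexp_int_mul_two_pi, Complex.exp_two_pi_mul_I, mul_one, mul_one]

/-- Reindexing by `n ↦ n - 1` leaves the denominators unchanged and takes a common factor out of the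
numerators. -/
lemma appell_add_tau (z τ : ℂ) :
    appell (z + τ) τ = -cexp (-(2 * π * 𝕚 * (τ + z))) * appell z τ := by
  rw [appell, appell, ← tsum_mul_left, ← (Equiv.addRight (-1 : ℤ)).tsum_eq]
  refine tsum_congr fun n => ?_
  have e1 : cexp (2 * π * 𝕚 * (z + τ)) * qpow ((n : ℂ) - 1) τ =
      cexp (2 * π * 𝕚 * z) * qpow (n : ℂ) τ := by
    rw [qpow, qpow, ← Complex.exp_add, ← Complex.exp_add]; congr 1; ring
  have e2 : qpow (((n : ℂ) - 1) * ((n : ℂ) - 1 + 1) / 2) τ *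
      cexp (2 * π * 𝕚 * ((n : ℂ) - 1) * (z + τ)) = cexp (-(2 * π * 𝕚 * (τ + z))) *
        (qpow ((n : ℂ) * ((n : ℂ) + 1) / 2) τ * cexp (2 * π * 𝕚 * (n : ℂ) * z)) := by
    rw [qpow, qpow, ← Complex.exp_add, ← Complex.exp_add, ← Complex.exp_add]; congr 1; ring
  rw [appellTerm, appellTerm, Equiv.coe_addRight]
  push_cast
  rw [← sub_eq_add_neg, ← sub_eq_add_neg, e1, mul_assoc, e2, zpow_sub₀ (by norm_num), zpow_one]
  ring

lemma norm_cexp_mul_qpow (n : ℤ) (z τ : ℂ) :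
    ‖cexp (2 * π * 𝕚 * z) * qpow (n : ℂ) τ‖ = Real.exp (-(2 * π * (z.im + n * τ.im))) := by
  rw [qpow, ← Complex.exp_add, Complex.norm_exp]
  congr 1
  simp
  ring

/-- The modulus of `ζ qⁿ` is either at most `e^(-2πd)` or at least `e^(2πd)`, and `e^(2πd) - 1 ≥ 1 -
e^(-2πd)`. -/
lemma one_sub_le_norm_one_sub {d : ℝ} {n : ℤ} {z τ : ℂ} (hd : d ≤ |z.im + n * τ.im|) :
    1 - Real.exp (-(2 * π * d)) ≤ ‖1 - cexp (2 * π * 𝕚 * z) * qpow (n : ℂ) τ‖ := by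
  have hpi := Real.pi_pos
  rcases le_or_gt 0 (z.im + n * τ.im) with h | h
  · rw [abs_of_nonneg h] at hd
    refine le_trans ?_ (norm_sub_norm_le _ _)
    rw [norm_one, norm_cexp_mul_qpow]
    gcongr
  · rw [abs_of_neg h] at hd
    rw [norm_sub_rev]
    refine le_trans ?_ (norm_sub_norm_le _ _)
    rw [norm_one, norm_cexp_mul_qpow]
    have h1 : Real.exp (2 * π * d) ≤ Real.exp (-(2 * π * (z.im + n * τ.im))) := by
      gcongr; nlinarith
    have h2 : Real.exp (2 * π * d) * Real.exp (-(2 * π * d)) = 1 := by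
      rw [← Real.exp_add]; simp
    have h3 := Real.exp_pos (2 * π * d)
    have h4 := Real.exp_pos (-(2 * π * d))
    nlinarith [sq_nonneg (Real.exp (2 * π * d) - Real.exp (-(2 * π * d))),
      sq_nonneg (Real.exp (2 * π * d) - 1)]

/-- The numerators are terms of a Jacobi theta series, so the Gaussian bounds for
`jacobiTheta₂_term` apply to them. -/
lemma appellTerm_eq (n : ℤ) (z τ : ℂ) : appellTerm n z τ =
    jacobiTheta₂_term n (z + τ / 2 + 1 / 2) τ / (1 - cexp (2 * π * 𝕚 * z) * qpow (n : ℂ) τ) := by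
  rw [appellTerm, jacobiTheta₂_term, ← cexp_int_mul_pi, qpow, ← Complex.exp_add, ← Complex.exp_add]
  congr 2; ring

/-- A Gaussian bound for the terms of the Appell-Lerch sum. -/
lemma norm_appellTerm_le {d B T : ℝ} (hd0 : 0 < d) (hT : 0 < T) {n : ℤ} {z τ : ℂ}
    (hd : d ≤ |z.im + n * τ.im|) (hB : |(z + τ / 2 + 1 / 2).im| ≤ B) (hτ : T ≤ τ.im) :
    ‖appellTerm n z τ‖ ≤ (1 - Real.exp (-(2 * π * d)))⁻¹ *
      Real.exp (-π * (T * n ^ 2 - 2 * B * |n|)) := by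
  have h0 : 0 < 1 - Real.exp (-(2 * π * d)) := by
    rw [sub_pos, Real.exp_lt_one_iff]
    have := Real.pi_pos
    nlinarith [mul_pos this hd0]
  rw [appellTerm_eq, norm_div, div_eq_inv_mul]
  gcongr
  · exact one_sub_le_norm_one_sub hd
  · exact norm_jacobiTheta₂_term_le hT hB hτ n

lemma summable_appell_bound {T : ℝ} (hT : 0 < T) (B K : ℝ) :
    Summable fun n : ℤ => K * Real.exp (-π * (T * n ^ 2 - 2 * B * |n|)) := by
  have := summable_pow_mul_jacobiTheta₂_term_bound B hT 0
  simp only [pow_zero, one_mul] at this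
  exact this.mul_left K

/-- The strip of half-height `3/4 · Im τ` is low enough to stay away from the poles with `n ≠ 0`,
and high enough for its translates by `ℤτ` to cover the plane. -/
lemma le_abs_im_add {τ : ℂ} (hτ : 0 < τ.im) {z : ℂ} (hz : |z.im| < 3 / 4 * τ.im) {n : ℤ}
    (hn : n ≠ 0) : 1 / 4 * τ.im ≤ |z.im + n * τ.im| := by
  have h1 : (1 : ℝ) ≤ |(n : ℝ)| := by exact_mod_cast Int.one_le_abs hn
  have h2 : |(n : ℝ) * τ.im| = |(n : ℝ)| * τ.im := by rw [abs_mul, abs_of_pos hτ]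
  have h3 := abs_sub_abs_le_abs_add (n * τ.im) z.im
  rw [add_comm] at h3
  nlinarith

open Classical in
/-- The Appell-Lerch sum without the term of index `0`. -/
def appellReg (z τ : ℂ) : ℂ := ∑' n : ℤ, if n = 0 then 0 else appellTerm n z τ

lemma abs_im_add_le {τ : ℂ} {z : ℂ} (hz : |z.im| < 3 / 4 * τ.im) :
    |(z + τ / 2 + 1 / 2).im| ≤ 5 / 4 * τ.im := by
  have : (z + τ / 2 + 1 / 2).im = z.im + τ.im / 2 := by simp
  rw [this]
  have := abs_lt.mp hz
  exact abs_le.mpr ⟨by linarith, by linarith⟩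

lemma norm_appellReg_term_le {τ : ℂ} (hτ : 0 < τ.im) {z : ℂ} (hz : |z.im| < 3 / 4 * τ.im) (n : ℤ) :
    ‖if n = 0 then 0 else appellTerm n z τ‖ ≤ (1 - Real.exp (-(2 * π * (1 / 4 * τ.im))))⁻¹ *
      Real.exp (-π * (τ.im * n ^ 2 - 2 * (5 / 4 * τ.im) * |n|)) := by
  split_ifs with h
  · rw [norm_zero]
    have : 0 ≤ 1 - Real.exp (-(2 * π * (1 / 4 * τ.im))) := by
      rw [sub_nonneg, Real.exp_le_one_iff]
      have := Real.pi_pos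
      nlinarith [mul_pos this hτ]
    positivity
  · exact norm_appellTerm_le (by positivity) hτ (le_abs_im_add hτ hz h) (abs_im_add_le hz) le_rfl

lemma isOpen_strip (τ : ℂ) : IsOpen {z : ℂ | |z.im| < 3 / 4 * τ.im} :=
  isOpen_lt (by fun_prop) continuous_const

lemma differentiableOn_appellReg {τ : ℂ} (hτ : 0 < τ.im) :
    DifferentiableOn ℂ (fun z => appellReg z τ) {z : ℂ | |z.im| < 3 / 4 * τ.im} := by
  refine Complex.differentiableOn_tsum_of_summable_norm (summable_appell_bound hτ _ _) (fun n => ?_)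
    (isOpen_strip τ) (fun n z hz => norm_appellReg_term_le hτ hz n)
  split_ifs with h
  · exact differentiableOn_const 0
  · intro z hz
    unfold appellTerm
    refine DifferentiableAt.differentiableWithinAt (DifferentiableAt.div (by fun_prop) (by fun_prop) ?_)
    have h1 := one_sub_le_norm_one_sub (le_abs_im_add hτ hz h)
    have h2 : 0 < 1 - Real.exp (-(2 * π * (1 / 4 * τ.im))) := by
      rw [sub_pos, Real.exp_lt_one_iff]
      have := Real.pi_pos
      nlinarith [mul_pos this hτ]
    exact norm_pos_iff.mp (h2.trans_le h1)

lemma appell_eq_add_appellReg {τ : ℂ} (hτ : 0 < τ.im) {z : ℂ} (hz : |z.im| < 3 / 4 * τ.im) :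
    appell z τ = (1 - cexp (2 * π * 𝕚 * z))⁻¹ + appellReg z τ := by
  have hs : Summable fun n : ℤ => if n = 0 then (0 : ℂ) else appellTerm n z τ :=
    Summable.of_norm_bounded (summable_appell_bound hτ _ _)
      (fun n => norm_appellReg_term_le hτ hz n)
  have h1 := (hasSum_ite_eq (0 : ℤ) (appellTerm 0 z τ)).add hs.hasSum
  rw [appell]
  have h2 : HasSum (fun n => appellTerm n z τ) (appellTerm 0 z τ + appellReg z τ) :=
    hasSum_of_eq h1 (fun n => by split_ifs with h <;> simp [h]) (by unfold appellReg; congr!)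
  rw [h2.tsum_eq]
  simp [appellTerm, qpow]

/-- The holomorphic extension of `θ₁² μ` on a strip around the real line. -/
def thetaSqMuStrip (z : ℂ) (τ : ℍ) : ℂ :=
  -𝕚 * cexp (π * 𝕚 * z) * (theta1Quot z τ + theta1 z τ * appellReg z τ)

/-- Inside the strip only the term of index `0` of the Appell-Lerch sum has poles, and its
denominator `1 - ζ` is exactly the factor removed from `θ₁` in `theta1Quot`. -/
lemma thetaSqMuRaw_eq_strip {z : ℂ} {τ : ℍ} (hz : |z.im| < 3 / 4 * (τ : ℂ).im)
    (h : 1 - cexp (2 * π * 𝕚 * z) ≠ 0) : thetaSqMuRaw z τ = thetaSqMuStrip z τ := by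
  rw [thetaSqMuRaw_eq, thetaSqMuStrip, appell_eq_add_appellReg τ.2 hz,
    theta1_eq_mul_theta1Quot τ.2]
  set x := 1 - cexp (2 * π * 𝕚 * z)
  linear_combination (-𝕚 * cexp (π * 𝕚 * z) * theta1Quot z τ) * mul_inv_cancel₀ h

lemma differentiableOn_thetaSqMuStrip (τ : ℍ) :
    DifferentiableOn ℂ (fun z => thetaSqMuStrip z τ) {z : ℂ | |z.im| < 3 / 4 * (τ : ℂ).im} := by
  have h1 := (differentiable_theta1 τ.2).differentiableOn (s := {z : ℂ | |z.im| < 3 / 4 * (τ : ℂ).im})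
  have h2 := (differentiable_theta1Quot τ.2).differentiableOn (s := {z : ℂ | |z.im| < 3 / 4 * (τ : ℂ).im})
  have h3 := differentiableOn_appellReg τ.2
  have h4 : DifferentiableOn ℂ (fun z => -𝕚 * cexp (π * 𝕚 * z)) {z : ℂ | |z.im| < 3 / 4 * (τ : ℂ).im} := by
    fun_prop
  exact h4.mul (h2.add (h1.mul h3))

lemma thetaSqMuStrip_add_one (z : ℂ) (τ : ℍ) :
    thetaSqMuStrip (z + 1) τ = thetaSqMuStrip z τ := by
  have e1 : cexp (π * 𝕚 * (z + 1)) = -cexp (π * 𝕚 * z) := by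
    rw [mul_add, mul_one, Complex.exp_add, Complex.exp_pi_mul_I]; ring
  have e2 : theta1Quot (z + 1) τ = -theta1Quot z τ := by
    have a1 : cexp (π * 𝕚 * τ / 4 - π * 𝕚 * (z + 1)) = -cexp (π * 𝕚 * τ / 4 - π * 𝕚 * z) := by
      rw [mul_add, mul_one, ← sub_sub, Complex.exp_sub _ (π * 𝕚), Complex.exp_pi_mul_I]; ring
    have a2 : cexp (2 * π * 𝕚 * (τ + (z + 1))) = cexp (2 * π * 𝕚 * (τ + z)) := by
      rw [← add_assoc, mul_add _ _ 1, mul_one, Complex.exp_add, Complex.exp_two_pi_mul_I, mul_one]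
    have a3 : cexp (2 * π * 𝕚 * (τ - (z + 1))) = cexp (2 * π * 𝕚 * (τ - z)) := by
      rw [← sub_sub, mul_sub _ _ 1, mul_one, Complex.exp_sub, Complex.exp_two_pi_mul_I, div_one]
    rw [theta1Quot, theta1Quot, a1, a2, a3]; ring
  rw [thetaSqMuStrip, thetaSqMuStrip, e1, e2, theta1_add_one, appellReg, appellReg]
  simp only [appellTerm_add_one]
  ring

lemma thetaSqMuRaw_add_tau (z : ℂ) (τ : ℍ) : thetaSqMuRaw (z + τ) τ =
    cexp (-(2 * π * 𝕚 * (τ + 2 * z))) * thetaSqMuRaw z τ := by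
  rw [thetaSqMuRaw_eq, thetaSqMuRaw_eq, theta1_add_tau, appell_add_tau]
  have : cexp (π * 𝕚 * (z + τ)) * (cexp (-(π * 𝕚 * τ) - 2 * π * 𝕚 * z) *
      cexp (-(2 * π * 𝕚 * (τ + z)))) =
      cexp (-(2 * π * 𝕚 * (τ + 2 * z))) * cexp (π * 𝕚 * z) := by
    rw [← Complex.exp_add, ← Complex.exp_add, ← Complex.exp_add]
    congr 1; ring
  linear_combination (-𝕚 * theta1 z τ * appell z τ) * this

/-- The index one transformation law under `z ↦ z + τ` implies that under `z ↦ z + lτ`. -/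
lemma indexOne_add_int_mul {f : ℂ → ℂ} {τ : ℂ}
    (h2 : ∀ z, f (z + τ) = cexp (-(2 * π * 𝕚 * (τ + 2 * z))) * f z) (l : ℤ) (z : ℂ) :
    f (z + l * τ) = cexp (-(2 * π * 𝕚 * (l ^ 2 * τ + 2 * l * z))) * f z := by
  induction l using Int.induction_on with
  | zero => simp
  | succ l ih =>
    rw [show z + ((l : ℤ) + 1 : ℤ) * τ = z + (l : ℤ) * τ + τ by push_cast; ring, h2, ih,
      ← mul_assoc, ← Complex.exp_add]
    congr 2; push_cast; ring
  | pred l ih =>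
    have h := h2 (z + (-(l : ℤ) - 1 : ℤ) * τ)
    rw [show z + (-(l : ℤ) - 1 : ℤ) * τ + τ = z + (-(l : ℤ) : ℤ) * τ by push_cast; ring, ih] at h
    have h' := congrArg (cexp (2 * π * 𝕚 * (τ + 2 * (z + (-(l : ℤ) - 1 : ℤ) * τ))) * ·) h
    simp only [← mul_assoc, ← Complex.exp_add, add_neg_cancel, Complex.exp_zero, one_mul] at h'
    rw [← h']
    congr 2; push_cast; ring

lemma eventually_one_sub_cexp_ne_zero (z : ℂ) :
    ∀ᶠ w in 𝓝[≠] z, 1 - cexp (2 * π * 𝕚 * w) ≠ 0 := by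
  have h : HasDerivAt (fun w : ℂ => 1 - cexp (2 * π * 𝕚 * w))
      (-(cexp (2 * π * 𝕚 * z) * (2 * π * 𝕚 * 1))) z :=
    (((hasDerivAt_id z).const_mul (2 * π * 𝕚)).cexp).const_sub 1
  exact h.eventually_ne (by simp [Complex.exp_ne_zero])

/-- Every value of `thetaSqMu`, including its limits at lattice points, is expressed through the
function that is holomorphic on the strip. Entirety and both periodicity laws follow from this
formula. -/
lemma thetaSqMu_add_int_mul {z : ℂ} {τ : ℍ} (hz : |z.im| < 3 / 4 * (τ : ℂ).im) (l : ℤ) :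
    thetaSqMu (z + l * τ) τ =
      cexp (-(2 * π * 𝕚 * (l ^ 2 * τ + 2 * l * z))) * thetaSqMuStrip z τ := by
  rw [thetaSqMu]
  split_ifs with hlat
  -- At a lattice point the limit is moved to `z` by `w ↦ w - lτ`. The raw product agrees with the
  -- strip function on a punctured neighbourhood of `z`, because the zeros of `1 - ζ` are isolated.
  · refine Tendsto.limUnder_eq ?_
    have h1 : Tendsto (fun w => cexp (-(2 * π * 𝕚 * (l ^ 2 * τ + 2 * l * w))) * thetaSqMuStrip w τ)
        (𝓝[≠] z) (𝓝 (cexp (-(2 * π * 𝕚 * (l ^ 2 * τ + 2 * l * z))) * thetaSqMuStrip z τ)) := by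
      have : ContinuousAt (fun w => thetaSqMuStrip w τ) z :=
        ((differentiableOn_thetaSqMuStrip τ).differentiableAt
          ((isOpen_strip τ).mem_nhds hz)).continuousAt
      exact (ContinuousAt.mul (by fun_prop) this).tendsto.mono_left nhdsWithin_le_nhds
    have h2 : Tendsto (fun w : ℂ => w - l * τ) (𝓝[≠] (z + l * τ)) (𝓝[≠] z) := by
      refine tendsto_nhdsWithin_iff.mpr ⟨?_, ?_⟩
      · have : ContinuousAt (fun w : ℂ => w - l * τ) (z + l * τ) := by fun_prop
        have := this.tendsto
        rw [add_sub_cancel_right] at this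
        exact this.mono_left nhdsWithin_le_nhds
      · filter_upwards [self_mem_nhdsWithin] with w hw h
        exact hw (by rw [Set.mem_singleton_iff] at *; linear_combination h)
    refine (h1.comp h2).congr' ?_
    have h3 := h2.eventually (eventually_one_sub_cexp_ne_zero z)
    have h4 := h2.eventually (eventually_nhdsWithin_of_eventually_nhds
      ((isOpen_strip τ).mem_nhds hz))
    filter_upwards [h3, h4] with w hw1 hw2
    have := indexOne_add_int_mul (f := fun z => thetaSqMuRaw z τ)
      (fun z => thetaSqMuRaw_add_tau z τ) l (w - l * τ)
    simp only [sub_add_cancel] at this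
    rw [Function.comp_apply, ← thetaSqMuRaw_eq_strip hw2 hw1, ← this, thetaSqMuRaw]
  · have hne : 1 - cexp (2 * π * 𝕚 * z) ≠ 0 :=
      one_sub_cexp_ne_zero fun u hu => hlat ⟨l, u, by rw [hu]; ring⟩
    rw [← thetaSqMuRaw_eq_strip hz hne]
    exact indexOne_add_int_mul (f := fun z => thetaSqMuRaw z τ)
      (fun z => thetaSqMuRaw_add_tau z τ) l z

lemma exists_strip_add_int_mul (w : ℂ) (τ : ℍ) :
    ∃ (z : ℂ) (l : ℤ), |z.im| < 3 / 4 * (τ : ℂ).im ∧ w = z + l * τ := by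
  have hτ : 0 < (τ : ℂ).im := τ.2
  refine ⟨w - round (w.im / (τ : ℂ).im) * τ, round (w.im / (τ : ℂ).im), ?_, by ring⟩
  have h := abs_sub_round (w.im / (τ : ℂ).im)
  have e : (w - round (w.im / (τ : ℂ).im) * τ).im =
      (w.im / (τ : ℂ).im - round (w.im / (τ : ℂ).im)) * (τ : ℂ).im := by
    rw [sub_mul, div_mul_cancel₀ _ hτ.ne']; simp
  rw [e, abs_mul, abs_of_pos hτ]
  nlinarith

lemma differentiable_thetaSqMu (τ : ℍ) : Differentiable ℂ fun z => thetaSqMu z τ := by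
  intro w
  obtain ⟨z, l, hz, rfl⟩ := exists_strip_add_int_mul w τ
  have h1 : DifferentiableAt ℂ (fun w => cexp (-(2 * π * 𝕚 * (l ^ 2 * τ + 2 * l * (w - l * τ)))) *
      thetaSqMuStrip (w - l * τ) τ) (z + l * τ) := by
    refine DifferentiableAt.mul (by fun_prop) ?_
    have h2 := (differentiableOn_thetaSqMuStrip τ).differentiableAt ((isOpen_strip τ).mem_nhds hz)
    rw [← add_sub_cancel_right z ((l : ℂ) * τ)] at h2
    exact h2.comp (z + l * τ) (f := fun w : ℂ => w - l * τ) (by fun_prop)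
  refine h1.congr_of_eventuallyEq ?_
  have hc : ContinuousAt (fun w : ℂ => w - l * τ) (z + l * τ) := by fun_prop
  have h3 : ∀ᶠ w in 𝓝 (z + l * τ), |(w - l * τ : ℂ).im| < 3 / 4 * (τ : ℂ).im :=
    hc.eventually_mem ((isOpen_strip τ).mem_nhds (by simpa using hz))
  filter_upwards [h3] with w hw
  have := thetaSqMu_add_int_mul hw l
  rwa [sub_add_cancel] at this

lemma thetaSqMu_add_one (w : ℂ) (τ : ℍ) : thetaSqMu (w + 1) τ = thetaSqMu w τ := by
  obtain ⟨z, l, hz, rfl⟩ := exists_strip_add_int_mul w τ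
  rw [add_right_comm, thetaSqMu_add_int_mul hz, thetaSqMu_add_int_mul (by simpa using hz),
    thetaSqMuStrip_add_one]
  congr 1
  rw [Complex.exp_eq_exp_iff_exists_int]
  exact ⟨-(2 * l), by push_cast; ring⟩

lemma thetaSqMu_add_tau (w : ℂ) (τ : ℍ) : thetaSqMu (w + τ) τ =
    cexp (-(2 * π * 𝕚 * (τ + 2 * w))) * thetaSqMu w τ := by
  obtain ⟨z, l, hz, rfl⟩ := exists_strip_add_int_mul w τ
  rw [thetaSqMu_add_int_mul hz, show z + l * τ + τ = z + (l + 1 : ℤ) * (τ : ℂ) by push_cast; ring,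
    thetaSqMu_add_int_mul hz, ← mul_assoc, ← Complex.exp_add]
  congr 2; push_cast; ring

lemma thetaSqMu_zero (τ : ℍ) : thetaSqMu 0 τ = ModularForm.eta τ ^ 3 := by
  have h := thetaSqMu_add_int_mul (z := 0) (τ := τ) (by simpa using τ.2) 0
  simp only [Int.cast_zero, zero_mul, add_zero, mul_zero, ne_eq, OfNat.ofNat_ne_zero,
    not_false_eq_true, zero_pow, neg_zero, Complex.exp_zero, one_mul] at h
  rw [h, thetaSqMuStrip, theta1Quot_zero, theta1_zero τ.2]
  simp only [mul_zero, zero_mul, Complex.exp_zero]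
  linear_combination (-ModularForm.eta τ ^ 3) * Complex.I_sq

lemma thetaSqMu_half (τ : ℍ) : thetaSqMu (1 / 2) τ = theta2 0 τ * appell (1 / 2) τ := by
  have hlat : ¬ ∃ l u : ℤ, (1 / 2 : ℂ) = l * (τ : ℂ) + u := by
    rintro ⟨l, u, h⟩
    have him := congrArg Complex.im h
    have hτ : τ.im ≠ 0 := τ.2.ne'
    have hl : l = 0 := by
      simpa [hτ] using him
    rw [hl] at h
    have : (1 : ℂ) = ((2 * u : ℤ) : ℂ) := by push_cast; linear_combination 2 * h
    have : (1 : ℤ) = 2 * u := by exact_mod_cast this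
    omega
  rw [thetaSqMu, if_neg hlat]
  have := thetaSqMuRaw_eq (1 / 2) τ
  rw [thetaSqMuRaw] at this
  rw [this, theta1_half, cexp_pi_half]
  linear_combination (-theta2 0 τ * appell (1 / 2) τ) * Complex.I_sq

lemma thetaSqMu_eq (z : ℂ) (τ : ℍ) : thetaSqMu z τ =
    S 0 τ * theta3 (2 * z) (2 * τ) + S 1 τ * theta2 (2 * z) (2 * τ) := by
  rw [theta_decomposition (differentiable_thetaSqMu τ) τ.2 (fun z => thetaSqMu_add_one z τ)
    (fun z => thetaSqMu_add_tau z τ) z, S, S, fourierCoef, fourierCoef]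
  simp [qpow]

/-- The value at `z = 0`. Together with the value at `z = 1/2` in the next lemma it is a linear
system which determines `S₀` and `S₁`. -/
lemma S_mul_theta_add (τ : ℍ) : S 0 τ * theta3 0 (2 * τ) + S 1 τ * theta2 0 (2 * τ) =
    ModularForm.eta τ ^ 3 := by
  have h := thetaSqMu_eq 0 τ
  rw [thetaSqMu_zero, mul_zero] at h
  exact h.symm

lemma S_mul_theta_sub (τ : ℍ) : S 0 τ * theta3 0 (2 * τ) - S 1 τ * theta2 0 (2 * τ) =
    theta2 0 τ * appell (1 / 2) τ := by
  have h := thetaSqMu_eq (1 / 2) τ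
  rw [thetaSqMu_half, theta3_two_mul_half, theta2_two_mul_half] at h
  rw [h]; ring

end Appell

/-! ### The incomplete Gamma function `beta` and a Poisson summation formula -/

section Poisson

open MeasureTheory

/-- The left tail of the normal density of variance `1 / (4 π y)`. -/
def gaussTail (y r : ℝ) : ℝ := √(2 * y) * ∫ s in Set.Iic r, Real.exp (-(2 * π * y) * s ^ 2)

lemma integral_gauss_mul_cexp {y : ℝ} (hy : 0 < y) (w : ℂ) (s : ℝ) :
    ∫ x : ℝ, cexp (-(π * (x + w) ^ 2 / (2 * y))) * cexp (-(2 * π * 𝕚 * (x + w)) * s) =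
      ((√(2 * y) * Real.exp (-(2 * π * y) * s ^ 2) : ℝ) : ℂ) := by
  have hy' : (y : ℂ) ≠ 0 := by exact_mod_cast hy.ne'
  have hpi : (π : ℂ) ≠ 0 := by exact_mod_cast Real.pi_ne_zero
  have hb : (((-(π / (2 * y)) : ℝ)) : ℂ).re < 0 := by
    rw [Complex.ofReal_re, neg_lt_zero]; positivity
  have h := integral_cexp_quadratic hb (-(π * w / y) - 2 * π * 𝕚 * s)
    (-(π * w ^ 2 / (2 * y)) - 2 * π * 𝕚 * s * w)
  have e1 : ∀ x : ℝ, cexp (-(π * (x + w) ^ 2 / (2 * y))) * cexp (-(2 * π * 𝕚 * (x + w)) * s) =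
      cexp (((-(π / (2 * y)) : ℝ) : ℂ) * x ^ 2 + (-(π * w / y) - 2 * π * 𝕚 * s) * x +
        (-(π * w ^ 2 / (2 * y)) - 2 * π * 𝕚 * s * w)) := by
    intro x
    rw [← Complex.exp_add]
    congr 1
    push_cast
    field_simp
    ring
  simp_rw [e1]
  rw [h]
  have e2 : ((π : ℂ) / -((-(π / (2 * y)) : ℝ) : ℂ)) ^ (1 / 2 : ℂ) = ((√(2 * y) : ℝ) : ℂ) := by
    rw [show (π : ℂ) / -((-(π / (2 * y)) : ℝ) : ℂ) = ((2 * y : ℝ) : ℂ) by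
      push_cast; field_simp, Real.sqrt_eq_rpow, Complex.ofReal_cpow (by positivity)]
    norm_num
  rw [e2]
  push_cast
  congr 2
  have hI := Complex.I_sq
  field_simp
  linear_combination (16 * y ^ 2 * s ^ 2) * hI

/-- Since `Im w > 0`, the quotient `e^(-2πi(x+w)r)/(x+w)` is `-2πi` times the integral of
`e^(-2πi(x+w)s)` over `s ≤ r`. After Fubini the inner integral is the Fourier transform of a
Gaussian. -/
lemma integral_gauss_div_mul_cexp {y : ℝ} (hy : 0 < y) {w : ℂ} (hw : 0 < w.im) (r : ℝ) :
    ∫ x : ℝ, cexp (-(π * (x + w) ^ 2 / (2 * y))) / (x + w) * cexp (-(2 * π * 𝕚 * (x + w)) * r) =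
      -(2 * π * 𝕚) * (gaussTail y r : ℂ) := by
  have hpi := Real.pi_pos
  have hre : ∀ x : ℝ, (-(2 * π * 𝕚 * (x + w))).re = 2 * π * w.im := by
    intro x; simp
  have hne : ∀ x : ℝ, (x + w : ℂ) ≠ 0 := by
    intro x h
    have := congrArg Complex.im h
    simp at this
    exact hw.ne' this
  have e1 : ∀ x : ℝ, cexp (-(π * (x + w) ^ 2 / (2 * y))) / (x + w) *
      cexp (-(2 * π * 𝕚 * (x + w)) * r) = -(2 * π * 𝕚) * ∫ s in Set.Iic r,
        cexp (-(π * (x + w) ^ 2 / (2 * y))) * cexp (-(2 * π * 𝕚 * (x + w)) * s) := by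
    intro x
    rw [integral_const_mul, integral_exp_mul_complex_Iic (by rw [hre]; positivity)]
    have h1 := hne x
    have h2 := Complex.two_pi_I_ne_zero
    rw [show -(2 * π * 𝕚 * (x + w)) = -(2 * π * 𝕚) * (x + w) by ring]
    rw [mul_left_comm, ← mul_div_assoc, mul_div_mul_left _ _ (neg_ne_zero.mpr h2)]
    ring
  simp_rw [e1]
  rw [integral_const_mul, integral_integral_swap]
  · simp_rw [integral_gauss_mul_cexp hy]
    rw [integral_complex_ofReal, integral_const_mul, gaussTail]
  · have i1 : Integrable fun x : ℝ => ‖cexp (-(π * (x + w) ^ 2 / (2 * y)))‖ := by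
      have hb : (((-(π / (2 * y)) : ℝ)) : ℂ).re < 0 := by
        rw [Complex.ofReal_re, neg_lt_zero]; positivity
      have := (integrable_cexp_quadratic' hb (-(π * w / y)) (-(π * w ^ 2 / (2 * y)))).norm
      refine this.congr (.of_forall fun x => ?_)
      have hy' : (y : ℂ) ≠ 0 := by exact_mod_cast hy.ne'
      simp only
      congr 2
      push_cast
      field_simp
      ring
    have i2 : Integrable (fun s : ℝ => Real.exp (2 * π * w.im * s))
        (volume.restrict (Set.Iic r)) := integrableOn_exp_mul_Iic (by positivity) r
    refine (i1.mul_prod i2).mono' ?_ (.of_forall fun p => ?_)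
    · refine Continuous.aestronglyMeasurable ?_
      unfold Function.uncurry
      fun_prop
    · simp only [Function.uncurry]
      rw [norm_mul, Complex.norm_exp (_ * _), Complex.re_mul_ofReal, hre]

lemma gaussTail_zero {y : ℝ} (hy : 0 < y) :
    √(2 * y) * ∫ s : ℝ, Real.exp (-(2 * π * y) * s ^ 2) = 1 := by
  have hpi := Real.pi_pos
  rw [integral_gaussian, ← Real.sqrt_mul (by positivity), show 2 * y * (π / (2 * π * y)) = 1 by
    field_simp, Real.sqrt_one]

/-- Substitution `u = 2ys²`. -/
lemma beta_eq_gauss {y r : ℝ} (hy : 0 < y) (hr : 0 < r) :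
    beta (2 * r ^ 2 * y) = 2 * (√(2 * y) * ∫ s in Set.Ioi r, Real.exp (-(2 * π * y) * s ^ 2)) := by
  have himg : (fun s : ℝ => 2 * y * s ^ 2) '' Set.Ioi r = Set.Ioi (2 * r ^ 2 * y) := by
    ext u
    simp only [Set.mem_image, Set.mem_Ioi]
    constructor
    · rintro ⟨s, hs, rfl⟩
      have : r ^ 2 < s ^ 2 := by gcongr
      nlinarith
    · intro hu
      have hu0 : 0 < u := lt_trans (by positivity) hu
      refine ⟨√(u / (2 * y)), ?_, ?_⟩
      · refine Real.lt_sqrt_of_sq_lt ?_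
        rw [lt_div_iff₀ (by positivity)]; linarith
      · rw [Real.sq_sqrt (by positivity)]; field_simp
  have hinj : Set.InjOn (fun s : ℝ => 2 * y * s ^ 2) (Set.Ioi r) := by
    intro a ha b hb hab
    have ha' : 0 < a := hr.trans ha
    have hb' : 0 < b := hr.trans hb
    have : a ^ 2 = b ^ 2 := mul_left_cancel₀ (by positivity : 2 * y ≠ 0) hab
    exact (pow_left_inj₀ ha'.le hb'.le two_ne_zero).mp this
  rw [beta, ← himg, integral_image_eq_integral_abs_deriv_smul measurableSet_Ioi
    (f' := fun s => 2 * y * (2 * s)) (fun s _ => ?_) hinj, ← integral_const_mul,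
    ← integral_const_mul]
  · refine setIntegral_congr_fun measurableSet_Ioi fun s hs => ?_
    have hs' : 0 < s := hr.trans hs
    simp only [smul_eq_mul]
    rw [abs_of_pos (by positivity), Real.rpow_neg (by positivity), ← Real.sqrt_eq_rpow,
      Real.sqrt_mul (by positivity), Real.sqrt_sq hs'.le,
      show -(π * (2 * y * s ^ 2)) = -(2 * π * y) * s ^ 2 by ring]
    have h2 : √(2 * y) * √(2 * y) = 2 * y := Real.mul_self_sqrt (by positivity)
    have h3 : √(2 * y) ≠ 0 := (Real.sqrt_pos.mpr (by positivity)).ne'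
    field_simp
    linear_combination -h2
  · have := ((hasDerivAt_pow 2 s).const_mul (2 * y)).hasDerivWithinAt (s := Set.Ioi r)
    simpa using this

lemma integrable_gauss {y : ℝ} (hy : 0 < y) :
    Integrable fun s : ℝ => Real.exp (-(2 * π * y) * s ^ 2) :=
  integrable_exp_neg_mul_sq (by have := Real.pi_pos; positivity)

lemma gaussTail_of_pos {y r : ℝ} (hy : 0 < y) (hr : 0 < r) :
    gaussTail y r = 1 - beta (2 * r ^ 2 * y) / 2 := by
  have h := intervalIntegral.integral_Iic_add_Ioi (b := r) (integrable_gauss hy).integrableOn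
    (integrable_gauss hy).integrableOn
  have h0 := gaussTail_zero hy
  rw [beta_eq_gauss hy hr, gaussTail]
  rw [← h, mul_add] at h0
  linarith

lemma gaussTail_of_neg {y r : ℝ} (hy : 0 < y) (hr : r < 0) :
    gaussTail y r = beta (2 * r ^ 2 * y) / 2 := by
  have h := integral_comp_neg_Ioi (c := -r) (f := fun s : ℝ => Real.exp (-(2 * π * y) * s ^ 2))
  simp only [neg_sq, neg_neg] at h
  rw [← neg_sq, beta_eq_gauss hy (neg_pos.mpr hr), gaussTail, h]
  ring

lemma beta_nonneg {x : ℝ} (hx : 0 ≤ x) : 0 ≤ beta x :=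
  setIntegral_nonneg measurableSet_Ioi fun u hu => by
    have : 0 < u := hx.trans_lt hu
    positivity

lemma integrableOn_beta {x : ℝ} (hx : 0 < x) :
    IntegrableOn (fun u : ℝ => u ^ (-(1 / 2) : ℝ) * Real.exp (-(π * u))) (Set.Ioi x) := by
  have hpi := Real.pi_pos
  have h1 : IntegrableOn (fun u : ℝ => x ^ (-(1 / 2) : ℝ) * Real.exp (-π * u)) (Set.Ioi x) :=
    (integrableOn_exp_mul_Ioi (by linarith) x).const_mul _
  refine h1.mono' ?_ ?_
  · refine ContinuousOn.aestronglyMeasurable (fun u hu => ?_) measurableSet_Ioi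
    have : u ≠ 0 := (hx.trans hu).ne'
    exact ((Real.continuousAt_rpow_const _ _ (Or.inl this)).mul (by fun_prop)).continuousWithinAt
  · refine (ae_restrict_iff' measurableSet_Ioi).mpr (.of_forall fun u hu => ?_)
    have hu0 : 0 < u := hx.trans hu
    rw [Real.norm_of_nonneg (by positivity), neg_mul]
    gcongr ?_ * _
    exact Real.rpow_le_rpow_of_nonpos hx (le_of_lt hu) (by norm_num)

lemma beta_le {x x₀ : ℝ} (hx₀ : 0 < x₀) (hx : x₀ ≤ x) :
    beta x ≤ x₀ ^ (-(1 / 2) : ℝ) / π * Real.exp (-(π * x)) := by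
  have hpi := Real.pi_pos
  have hx0 : 0 < x := hx₀.trans_le hx
  have h1 : IntegrableOn (fun u : ℝ => x₀ ^ (-(1 / 2) : ℝ) * Real.exp (-π * u)) (Set.Ioi x) :=
    (integrableOn_exp_mul_Ioi (by linarith) x).const_mul _
  refine (setIntegral_mono_on (integrableOn_beta hx0) h1 measurableSet_Ioi fun u hu => ?_).trans ?_
  · rw [neg_mul]
    gcongr ?_ * _
    exact Real.rpow_le_rpow_of_nonpos hx₀ (hx.trans (le_of_lt hu)) (by norm_num)
  · rw [integral_const_mul, integral_exp_mul_Ioi (by linarith), neg_div_neg_eq, neg_mul]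
    apply le_of_eq; ring

/-- The terms of the theta-like series of `beta`, with `r = m + 1/2`. -/
def betaCoef (y : ℝ) (m : ℤ) : ℝ :=
  (SignType.sign ((m : ℝ) + 1 / 2) : ℝ) * beta (2 * ((m : ℝ) + 1 / 2) ^ 2 * y)

lemma norm_betaCoef_le {y : ℝ} (hy : 0 < y) (m : ℤ) :
    ‖(betaCoef y m : ℂ)‖ ≤ (y / 2) ^ (-(1 / 2) : ℝ) / π *
      Real.exp (-(2 * π * ((m : ℝ) + 1 / 2) ^ 2 * y)) := by
  -- Since `m(m+1) ≥ 0` for integers, all arguments of `beta` are at least `y/2`; this is the base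
  -- point used in `beta_le`.
  have h1 : (1 : ℝ) / 4 ≤ ((m : ℝ) + 1 / 2) ^ 2 := by
    have : (0 : ℝ) ≤ (m : ℝ) * (m + 1) := by
      rcases le_or_gt 0 m with h | h
      · have : (0 : ℝ) ≤ m := by exact_mod_cast h
        positivity
      · have : (m : ℝ) + 1 ≤ 0 := by exact_mod_cast h
        nlinarith
    nlinarith
  have h2 : y / 2 ≤ 2 * ((m : ℝ) + 1 / 2) ^ 2 * y := by nlinarith
  have h3 := beta_le (by positivity) h2
  have hs : |((SignType.sign ((m : ℝ) + 1 / 2) : SignType) : ℝ)| ≤ 1 := by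
    rcases SignType.sign ((m : ℝ) + 1 / 2) <;> simp
  rw [Complex.norm_real, betaCoef, norm_mul, Real.norm_eq_abs, Real.norm_eq_abs,
    abs_of_nonneg (beta_nonneg (by positivity))]
  calc _ ≤ 1 * beta (2 * ((m : ℝ) + 1 / 2) ^ 2 * y) := by
        gcongr; exact beta_nonneg (by positivity)
    _ ≤ _ := by
        rw [one_mul]; refine h3.trans (le_of_eq ?_); congr 2; ring

/-- The splitting behind the completion: the Heaviside part sums to the meromorphic Appell-Lerch
term, while the remainder decays like a Gaussian and yields the non-holomorphic correction. -/
lemma gaussTail_eq {y : ℝ} (hy : 0 < y) (m : ℤ) :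
    (gaussTail y ((m : ℝ) + 1 / 2) : ℂ) = (if 0 ≤ m then 1 else 0) - (betaCoef y m : ℂ) / 2 := by
  rw [betaCoef]
  split_ifs with h
  · have : (0 : ℝ) ≤ m := by exact_mod_cast h
    have hr : 0 < (m : ℝ) + 1 / 2 := by positivity
    rw [gaussTail_of_pos hy hr, sign_pos hr, SignType.coe_one]
    push_cast; ring
  · have : (m : ℝ) ≤ -1 := by exact_mod_cast (by omega : m ≤ -1)
    have hr : (m : ℝ) + 1 / 2 < 0 := by linarith
    rw [gaussTail_of_neg hy hr, sign_neg hr, SignType.coe_neg_one]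
    push_cast; ring

lemma norm_cexp_shift (m : ℤ) (w : ℂ) :
    ‖cexp (2 * π * 𝕚 * ((m : ℂ) + 1 / 2) * w)‖ = Real.exp (-(2 * π * ((m : ℝ) + 1 / 2) * w.im)) := by
  rw [Complex.norm_exp]
  congr 1
  rw [show 2 * π * 𝕚 * ((m : ℂ) + 1 / 2) * w = ((2 * π * ((m : ℝ) + 1 / 2) : ℝ) : ℂ) * w * 𝕚 by
    push_cast; ring, Complex.mul_I_re, Complex.im_ofReal_mul]

lemma summable_gauss_shift {y : ℝ} (hy : 0 < y) (v : ℝ) :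
    Summable fun m : ℤ => Real.exp (-(π * ((m : ℝ) + 1 / 2) ^ 2 * y)) *
      Real.exp (-(2 * π * ((m : ℝ) + 1 / 2) * v)) := by
  have h := ((summable_jacobiTheta₂_term_iff (𝕚 * (v + y / 2)) (𝕚 * y)).mpr (by simpa using hy)).norm
  refine (h.mul_left (Real.exp (-(π * y / 4) - π * v))).congr fun m => ?_
  rw [norm_jacobiTheta₂_term, ← Real.exp_add, ← Real.exp_add]
  congr 1
  simp
  ring

lemma summable_betaCoef {y : ℝ} (hy : 0 < y) (w : ℂ) :
    Summable fun m : ℤ => ‖(betaCoef y m : ℂ) * cexp (2 * π * 𝕚 * ((m : ℂ) + 1 / 2) * w)‖ := by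
  refine Summable.of_nonneg_of_le (fun _ => norm_nonneg _) (fun m => ?_)
    ((summable_gauss_shift hy w.im).mul_left ((y / 2) ^ (-(1 / 2) : ℝ) / π))
  have hpi := Real.pi_pos
  rw [norm_mul, norm_cexp_shift, ← mul_assoc]
  gcongr
  refine (norm_betaCoef_le hy m).trans ?_
  gcongr
  nlinarith [mul_nonneg (mul_nonneg hpi.le (sq_nonneg ((m : ℝ) + 1 / 2))) hy.le]

lemma hasSum_geometric_half {w : ℂ} (hw : 0 < w.im) :
    HasSum (fun m : ℤ => (if 0 ≤ m then (1 : ℂ) else 0) * cexp (2 * π * 𝕚 * ((m : ℂ) + 1 / 2) * w))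
      (cexp (π * 𝕚 * w) / (1 - cexp (2 * π * 𝕚 * w))) := by
  have hg := (hasSum_geometric_of_norm_lt_one (norm_exp_lt_one hw)).mul_left (cexp (π * 𝕚 * w))
  rw [← div_eq_mul_inv] at hg
  have hinj : Function.Injective (fun n : ℕ => (n : ℤ)) := Nat.cast_injective
  rw [← hinj.hasSum_iff]
  · refine hasSum_of_eq hg (fun n => ?_) rfl
    rw [← Complex.exp_nat_mul, ← Complex.exp_add]
    simp only [Function.comp_apply, Nat.cast_nonneg, if_true, one_mul]
    congr 1; push_cast; ring
  · intro m hm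
    rw [if_neg, zero_mul]
    intro h0
    exact hm ⟨m.toNat, by simpa using h0⟩

/-- The terms of the one-dimensional sum `∑ₙ (-1)ⁿ exp(-π (w+n)² / 2y) / (w+n)`. -/
def gaussTerm (y : ℝ) (w : ℂ) (n : ℤ) : ℂ :=
  (-1) ^ n * (cexp (-(π * (w + n) ^ 2 / (2 * y))) / (w + n))

/-- Poisson summation. The sign `(-1)ⁿ`, written as `e^(πix)`, moves the frequencies from the
integers `k` to `k - 1/2 = m + 1/2` with `m = k - 1`. -/
lemma tsum_gaussTerm_of_pos {y : ℝ} (hy : 0 < y) {w : ℂ} (hw : 0 < w.im) :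
    ∑' n : ℤ, gaussTerm y w n = -(2 * π * 𝕚) * (cexp (π * 𝕚 * w) / (1 - cexp (2 * π * 𝕚 * w))) +
      π * 𝕚 * ∑' m : ℤ, (betaCoef y m : ℂ) * cexp (2 * π * 𝕚 * ((m : ℂ) + 1 / 2) * w) := by
  have hpi := Real.pi_pos
  have hy' : (y : ℂ) ≠ 0 := by exact_mod_cast hy.ne'
  have hne : ∀ x : ℝ, (x + w : ℂ) ≠ 0 := by
    intro x h
    have := congrArg Complex.im h
    simp at this
    exact hw.ne' this
  set f : ℝ → ℂ := fun x => cexp (π * 𝕚 * x) * (cexp (-(π * (x + w) ^ 2 / (2 * y))) / (x + w))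
    with hf
  have hcont : Continuous f := by
    refine Continuous.mul (by fun_prop) (Continuous.div (by fun_prop) (by fun_prop) hne)
  have hdecay : f =O[cocompact ℝ] fun x => |x| ^ (-(2 : ℝ)) := by
    have hb : (((-(π / (2 * y)) : ℝ)) : ℂ).re < 0 := by
      rw [Complex.ofReal_re, neg_lt_zero]; positivity
    have h1 := (cexp_neg_quadratic_isLittleO_abs_rpow_cocompact hb (π * 𝕚 - π * w / y) (-2)).isBigO
    refine IsBigO.trans ?_ h1
    refine IsBigO.of_bound (‖cexp (-(π * w ^ 2 / (2 * y)))‖ / w.im) (.of_forall fun x => ?_)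
    have e : f x = cexp (-(π * w ^ 2 / (2 * y))) * (cexp (((-(π / (2 * y)) : ℝ) : ℂ) * x ^ 2 +
        (π * 𝕚 - π * w / y) * x)) / (x + w) := by
      rw [hf]
      simp only
      rw [← mul_div_assoc, ← Complex.exp_add, ← Complex.exp_add]
      congr 2
      push_cast
      field_simp
      ring
    have hle : w.im ≤ ‖(x + w : ℂ)‖ := by
      have := Complex.abs_im_le_norm (x + w : ℂ)
      simp at this
      exact (le_abs_self _).trans this
    rw [e, norm_div, norm_mul, div_mul_eq_mul_div]
    gcongr
  have hF : ∀ k : ℤ, FourierTransform.fourier f k = -(2 * π * 𝕚) *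
      ((gaussTail y (((k - 1 : ℤ) : ℝ) + 1 / 2) : ℂ) *
        cexp (2 * π * 𝕚 * (((k - 1 : ℤ) : ℂ) + 1 / 2) * w)) := by
    intro k
    rw [Real.fourier_eq', ← mul_assoc, ← integral_gauss_div_mul_cexp hy hw, ← integral_mul_const]
    refine integral_congr_ae (.of_forall fun x => ?_)
    simp only [hf, smul_eq_mul]
    have : cexp ((-2 * π * inner ℝ x (k : ℝ) : ℝ) * 𝕚) * cexp (π * 𝕚 * x) =
        cexp (-(2 * π * 𝕚 * (x + w)) * (((k - 1 : ℤ) : ℝ) + 1 / 2 : ℝ)) *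
          cexp (2 * π * 𝕚 * (((k - 1 : ℤ) : ℂ) + 1 / 2) * w) := by
      rw [← Complex.exp_add, ← Complex.exp_add]
      congr 1
      simp
      ring
    linear_combination (cexp (-(π * (x + w) ^ 2 / (2 * y))) / (x + w)) * this
  have hb := (summable_betaCoef hy w).of_norm.hasSum
  have hsum : HasSum (fun m : ℤ => -(2 * π * 𝕚) * ((gaussTail y ((m : ℝ) + 1 / 2) : ℂ) *
        cexp (2 * π * 𝕚 * ((m : ℂ) + 1 / 2) * w))) _ :=
    hasSum_of_eq (((hasSum_geometric_half hw).sub (hb.div_const 2)).mul_left (-(2 * π * 𝕚)))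
      (fun m => by rw [gaussTail_eq hy]; ring) rfl
  have hsum2 := (Equiv.subRight (1 : ℤ)).hasSum_iff.mpr hsum
  have hP := Real.tsum_eq_tsum_fourier_of_rpow_decay_of_summable hcont (by norm_num : (1 : ℝ) < 2)
    hdecay (by
      refine hsum2.summable.congr fun k => ?_
      rw [hF k]; simp) 0
  have e1 : ∀ n : ℤ, f (0 + n) = gaussTerm y w n := by
    intro n
    simp only [hf, gaussTerm, zero_add]
    rw [← cexp_int_mul_pi]
    push_cast
    rw [add_comm w]
  have e2 : ∀ k : ℤ, FourierTransform.fourier f k * fourier k ((0 : ℝ) : UnitAddCircle) =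
      (fun m : ℤ => -(2 * π * 𝕚) * ((gaussTail y ((m : ℝ) + 1 / 2) : ℂ) *
        cexp (2 * π * 𝕚 * ((m : ℂ) + 1 / 2) * w))) (Equiv.subRight (1 : ℤ) k) := by
    intro k
    rw [hF]
    simp
  rw [tsum_congr e1, tsum_congr e2] at hP
  rw [hP]
  refine Eq.trans hsum2.tsum_eq ?_
  ring

/-- Both sides are odd in `w`, by `n ↦ -n` on the left and `m ↦ -1 - m` on the right, so the lower
half-plane follows from the upper one. -/
lemma tsum_gaussTerm {y : ℝ} (hy : 0 < y) {w : ℂ} (hw : w.im ≠ 0) :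
    ∑' n : ℤ, gaussTerm y w n = -(2 * π * 𝕚) * (cexp (π * 𝕚 * w) / (1 - cexp (2 * π * 𝕚 * w))) +
      π * 𝕚 * ∑' m : ℤ, (betaCoef y m : ℂ) * cexp (2 * π * 𝕚 * ((m : ℂ) + 1 / 2) * w) := by
  rcases hw.lt_or_gt with h | h
  · have h1 := tsum_gaussTerm_of_pos hy (w := -w) (by simpa using h)
    have e1 : ∑' n : ℤ, gaussTerm y (-w) n = -∑' n : ℤ, gaussTerm y w n := by
      rw [← tsum_neg, ← (Equiv.neg ℤ).tsum_eq]
      refine tsum_congr fun n => ?_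
      simp only [gaussTerm, Equiv.neg_apply, Int.cast_neg]
      rw [show -w + -(n : ℂ) = -(w + n) by ring, neg_sq, div_neg, zpow_neg,
        ← inv_zpow, show ((-1 : ℂ))⁻¹ = -1 by norm_num]
      ring
    have e2 : ∑' m : ℤ, (betaCoef y m : ℂ) * cexp (2 * π * 𝕚 * ((m : ℂ) + 1 / 2) * -w) =
        -∑' m : ℤ, (betaCoef y m : ℂ) * cexp (2 * π * 𝕚 * ((m : ℂ) + 1 / 2) * w) := by
      rw [← tsum_neg, ← (Equiv.subLeft (-1 : ℤ)).tsum_eq]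
      refine tsum_congr fun m => ?_
      have hr : (((-1 - m : ℤ) : ℝ) + 1 / 2) = -((m : ℝ) + 1 / 2) := by push_cast; ring
      have hb : betaCoef y (-1 - m) = -betaCoef y m := by
        rw [betaCoef, betaCoef, hr, neg_sq, Left.sign_neg]
        push_cast; ring
      rw [Equiv.subLeft_apply, hb]
      push_cast
      rw [neg_mul]
      congr 3; ring
    have e3 : cexp (π * 𝕚 * -w) / (1 - cexp (2 * π * 𝕚 * -w)) =
        -(cexp (π * 𝕚 * w) / (1 - cexp (2 * π * 𝕚 * w))) := by
      have hx := Complex.exp_ne_zero (π * 𝕚 * w)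
      have hz : ∀ u : ℤ, w ≠ u := fun u hu => h.ne (by rw [hu]; simp)
      have hden := one_sub_cexp_ne_zero hz
      rw [show 2 * π * 𝕚 * -w = -(π * 𝕚 * w + π * 𝕚 * w) by ring, mul_neg, Complex.exp_neg,
        Complex.exp_neg, Complex.exp_add]
      rw [show 2 * π * 𝕚 * w = π * 𝕚 * w + π * 𝕚 * w by ring, Complex.exp_add] at hden ⊢
      have hden2 : cexp (π * 𝕚 * w) * cexp (π * 𝕚 * w) - 1 ≠ 0 := by
        rw [← neg_ne_zero, neg_sub]; exact hden
      have hden3 : 1 - (cexp (π * 𝕚 * w) * cexp (π * 𝕚 * w))⁻¹ ≠ 0 := by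
        have : 1 - (cexp (π * 𝕚 * w) * cexp (π * 𝕚 * w))⁻¹ =
            (cexp (π * 𝕚 * w) * cexp (π * 𝕚 * w) - 1) / (cexp (π * 𝕚 * w) * cexp (π * 𝕚 * w)) := by
          field_simp
        rw [this]
        exact div_ne_zero hden2 (mul_ne_zero hx hx)
      rw [← neg_div, div_eq_div_iff hden3 hden]
      field_simp
      ring
    rw [e1, e2, e3] at h1
    linear_combination -h1
  · exact tsum_gaussTerm_of_pos hy h

end Poisson

/-! ### The Gaussian lattice sum -/

/-- The lattice point `mτ + n`. -/
def latticePt (p : ℤ × ℤ) (τ : ℂ) : ℂ := p.1 * τ + p.2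

/-- The sign which is `1` on `2ℤ × 2ℤ` and `-1` elsewhere. -/
def latticeSign (p : ℤ × ℤ) : ℂ := if Even p.1 ∧ Even p.2 then 1 else -1

/-- Under `γ` the quantities `z` and `ω = mτ + n` are divided by `j = cτ + d`, and `Im τ` by `|j|²`.
The exponent is thus invariant, and the denominator produces weight one. -/
def latticeTerm (z : ℂ) (τ : ℍ) (p : ℤ × ℤ) : ℂ :=
  latticeSign p * cexp (-(π / τ.im) * (conj (latticePt p τ) * z +
    latticePt p τ * conj (latticePt p τ) / 2)) / (z + latticePt p τ)

def latticeG (z : ℂ) (τ : ℍ) : ℂ := ∑' p : ℤ × ℤ, latticeTerm z τ p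

/-- The sign is `(-1)^(m+n+mn)`. It is defined through parity classes because `2ℤ × 2ℤ` is visibly
stable under `SL(2, ℤ)`; the factor `(-1)^(mn)` comes from completing the square in
`cexp_mul_latticeTerm`. -/
lemma latticeSign_mul (p : ℤ × ℤ) :
    latticeSign p * (-1) ^ (p.1 * p.2) = (-1) ^ p.1 * (-1) ^ p.2 := by
  obtain ⟨m, n⟩ := p
  simp only [latticeSign]
  rcases Int.even_or_odd m with hm | hm <;> rcases Int.even_or_odd n with hn | hn
  · rw [if_pos ⟨hm, hn⟩, (hm.mul_right n).neg_one_zpow, hm.neg_one_zpow, hn.neg_one_zpow, one_mul]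
  · rw [if_neg (fun h => Int.not_even_iff_odd.mpr hn h.2), (hm.mul_right n).neg_one_zpow,
      hm.neg_one_zpow, hn.neg_one_zpow]; ring
  · rw [if_neg (fun h => Int.not_even_iff_odd.mpr hm h.1), (hn.mul_left m).neg_one_zpow,
      hm.neg_one_zpow, hn.neg_one_zpow]
  · rw [if_neg (fun h => Int.not_even_iff_odd.mpr hm h.1), (hm.mul hn).neg_one_zpow,
      hm.neg_one_zpow, hn.neg_one_zpow]

lemma det_int_eq (γ : SL(2, ℤ)) : γ 0 0 * γ 1 1 - γ 0 1 * γ 1 0 = 1 := by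
  have := γ.det_coe
  rwa [Matrix.det_fin_two] at this

/-- Right multiplication of row vectors by `γ`. -/
def rowEquiv (γ : SL(2, ℤ)) : ℤ × ℤ ≃ ℤ × ℤ where
  toFun p := (p.1 * γ 0 0 + p.2 * γ 1 0, p.1 * γ 0 1 + p.2 * γ 1 1)
  invFun p := (p.1 * γ 1 1 - p.2 * γ 1 0, -p.1 * γ 0 1 + p.2 * γ 0 0)
  left_inv p := by
    have h := det_int_eq γ
    ext
    · dsimp only; linear_combination p.1 * h
    · dsimp only; linear_combination p.2 * h
  right_inv p := by
    have h := det_int_eq γ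
    ext
    · dsimp only; linear_combination p.1 * h
    · dsimp only; linear_combination p.2 * h

lemma latticePt_smul (γ : SL(2, ℤ)) (τ : ℍ) (p : ℤ × ℤ) :
    latticePt p ((γ • τ : ℍ) : ℂ) = latticePt (rowEquiv γ p) τ / cocyc γ τ := by
  rw [eq_div_iff (cocyc_ne_zero γ τ)]
  simp only [latticePt, rowEquiv, Equiv.coe_fn_mk]
  have := coe_smul_mul_cocyc γ τ
  push_cast
  rw [add_mul, mul_assoc, this, cocyc]
  ring

lemma latticeSign_rowEquiv (γ : SL(2, ℤ)) (p : ℤ × ℤ) :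
    latticeSign (rowEquiv γ p) = latticeSign p := by
  have key : ∀ (δ : SL(2, ℤ)) (p : ℤ × ℤ), (Even p.1 ∧ Even p.2) →
      (Even (rowEquiv δ p).1 ∧ Even (rowEquiv δ p).2) := by
    intro δ p h
    exact ⟨(h.1.mul_right _).add (h.2.mul_right _), (h.1.mul_right _).add (h.2.mul_right _)⟩
  have h' : (Even (rowEquiv γ p).1 ∧ Even (rowEquiv γ p).2) ↔ (Even p.1 ∧ Even p.2) := by
    refine ⟨fun h => ?_, key γ p⟩
    have e : p = (rowEquiv γ).symm (rowEquiv γ p) := ((rowEquiv γ).symm_apply_apply p).symm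
    rw [e]
    have e2 : ∀ x : ℤ × ℤ, (rowEquiv γ).symm x =
      (x.1 * γ 1 1 - x.2 * γ 1 0, -x.1 * γ 0 1 + x.2 * γ 0 0) := fun x => rfl
    rw [e2]
    exact ⟨(h.1.mul_right _).sub (h.2.mul_right _), (h.1.neg.mul_right _).add (h.2.mul_right _)⟩
  simp only [latticeSign, h']

lemma im_smul_mul (γ : SL(2, ℤ)) (τ : ℍ) :
    (((γ • τ).im : ℝ) : ℂ) * (cocyc γ τ * conj (cocyc γ τ)) = (τ.im : ℂ) := by
  have h0 : Complex.normSq (cocyc γ τ) ≠ 0 := by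
    rw [Ne, Complex.normSq_eq_zero]; exact cocyc_ne_zero γ τ
  rw [Complex.mul_conj, ModularGroup.im_smul_eq_div_normSq, ← cocyc_eq_denom]
  rw [← Complex.ofReal_mul, div_mul_cancel₀ _ h0]

lemma im_ne_zero_complex (τ : ℍ) : ((τ.im : ℝ) : ℂ) ≠ 0 := by
  exact_mod_cast τ.im_ne_zero

lemma latticeTerm_smul (γ : SL(2, ℤ)) (z : ℂ) (τ : ℍ) (p : ℤ × ℤ) :
    latticeTerm (z / cocyc γ τ) (γ • τ) p = cocyc γ τ * latticeTerm z τ (rowEquiv γ p) := by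
  have hj := cocyc_ne_zero γ τ
  have hjc : conj (cocyc γ τ) ≠ 0 := by simpa using hj
  have hy := im_ne_zero_complex (γ • τ)
  rw [latticeTerm, latticeTerm, latticeSign_rowEquiv, latticePt_smul, map_div₀, ← add_div]
  set ω := latticePt (rowEquiv γ p) τ
  have : -((π : ℂ) / ((γ • τ).im : ℝ)) * (conj ω / conj (cocyc γ τ) * (z / cocyc γ τ) +
      ω / cocyc γ τ * (conj ω / conj (cocyc γ τ)) / 2) =
      -((π : ℂ) / (τ.im : ℝ)) * (conj ω * z + ω * conj ω / 2) := by
    rw [← im_smul_mul γ τ]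
    field_simp
  rw [this, div_div_eq_mul_div]
  ring

lemma latticeG_smul (γ : SL(2, ℤ)) (z : ℂ) (τ : ℍ) :
    latticeG (z / cocyc γ τ) (γ • τ) = cocyc γ τ * latticeG z τ := by
  rw [latticeG, latticeG, ← tsum_mul_left,
    ← (rowEquiv γ).tsum_eq (fun p => cocyc γ τ * latticeTerm z τ p)]
  exact tsum_congr fun p => latticeTerm_smul γ z τ p

lemma exists_le_abs_add_int_mul {y v : ℝ} (hy : 0 < y) (hv : ∀ m : ℤ, v + m * y ≠ 0) :
    ∃ d, 0 < d ∧ ∀ m : ℤ, d ≤ |v + m * y| := by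
  -- The witness is the distance from `v` to the nearest multiple of `y`.
  refine ⟨y * |v / y - round (v / y)|, mul_pos hy (abs_pos.mpr fun h => ?_), fun m => ?_⟩
  · apply hv (-round (v / y))
    have : v = y * (v / y) := by field_simp
    push_cast
    rw [sub_eq_zero] at h
    linear_combination this + y * h
  · have h := round_le (v / y) (-m)
    calc y * |v / y - round (v / y)| ≤ y * |v / y - (-m : ℤ)| := by gcongr
      _ = |v + m * y| := by
        rw [← abs_of_pos hy, ← abs_mul, abs_of_pos hy]
        congr 1; push_cast; field_simp; ring

lemma summable_exp_neg_mul_sq {a : ℝ} (ha : 0 < a) :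
    Summable fun n : ℤ => Real.exp (-(a * (n : ℝ) ^ 2)) := by
  have h := summable_appell_bound (T := a / π) (by positivity) 0 1
  refine h.congr fun n => ?_
  rw [one_mul]
  congr 1
  field_simp
  ring

/-- One has `|ω|² ≥ r²(m² + n²)/2` for the constant `r` of Eisenstein series, and `|ω||z| ≤ |ω|²/4 +
|z|²`. The remaining `|ω|²/4` accounts for the `r²/8` in the Gaussian. -/
lemma norm_latticeTerm_le {z : ℂ} {τ : ℍ} {d : ℝ} (hd0 : 0 < d)
    (hd : ∀ m : ℤ, d ≤ |z.im + m * τ.im|) (p : ℤ × ℤ) :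
    ‖latticeTerm z τ p‖ ≤ d⁻¹ * Real.exp (π / τ.im * ‖z‖ ^ 2) *
      (Real.exp (-(π / τ.im * (EisensteinSeries.r τ ^ 2 / 8) * (p.1 : ℝ) ^ 2)) *
        Real.exp (-(π / τ.im * (EisensteinSeries.r τ ^ 2 / 8) * (p.2 : ℝ) ^ 2))) := by
  have hy := τ.im_pos
  have hpi := Real.pi_pos
  have hr := EisensteinSeries.r_pos τ
  set ω := latticePt p τ with hω
  have hs : ‖latticeSign p‖ = 1 := by rw [latticeSign]; split_ifs <;> simp
  have him : (z + ω).im = z.im + p.1 * τ.im := by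
    simp [hω, latticePt]
  have hden : d ≤ ‖z + ω‖ := (hd p.1).trans (him ▸ Complex.abs_im_le_norm (z + ω))
  have hmax : EisensteinSeries.r τ ^ 2 * (((p.1 : ℝ) ^ 2 + (p.2 : ℝ) ^ 2) / 2) ≤ ‖ω‖ ^ 2 := by
    by_cases h0 : (![p.1, p.2] : Fin 2 → ℤ) = 0
    · have h1 : p.1 = 0 := by simpa using congrFun h0 0
      have h2 : p.2 = 0 := by simpa using congrFun h0 1
      rw [h1, h2]; simp
    · have h := EisensteinSeries.r_mul_max_le τ h0
      have h1 : |(p.1 : ℝ)| ≤ ‖(![p.1, p.2] : Fin 2 → ℤ)‖ := by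
        simpa [Int.norm_eq_abs] using norm_le_pi_norm (![p.1, p.2] : Fin 2 → ℤ) 0
      have h2 : |(p.2 : ℝ)| ≤ ‖(![p.1, p.2] : Fin 2 → ℤ)‖ := by
        simpa [Int.norm_eq_abs] using norm_le_pi_norm (![p.1, p.2] : Fin 2 → ℤ) 1
      have h3 : EisensteinSeries.r τ * ‖(![p.1, p.2] : Fin 2 → ℤ)‖ ≤ ‖ω‖ := by
        simpa [hω, latticePt] using h
      set N := ‖(![p.1, p.2] : Fin 2 → ℤ)‖
      have h1' : (p.1 : ℝ) ^ 2 ≤ N ^ 2 := by rw [← sq_abs]; gcongr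
      have h2' : (p.2 : ℝ) ^ 2 ≤ N ^ 2 := by rw [← sq_abs]; gcongr
      calc EisensteinSeries.r τ ^ 2 * (((p.1 : ℝ) ^ 2 + (p.2 : ℝ) ^ 2) / 2)
          ≤ EisensteinSeries.r τ ^ 2 * ((N ^ 2 + N ^ 2) / 2) := by gcongr
        _ = (EisensteinSeries.r τ * N) ^ 2 := by ring
        _ ≤ ‖ω‖ ^ 2 := by gcongr
  have hre : (conj ω * z + ω * conj ω / 2).re = (conj ω * z).re + ‖ω‖ ^ 2 / 2 := by
    rw [Complex.add_re, Complex.mul_conj, Complex.normSq_eq_norm_sq]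
    congr 1
    rw [show (((‖ω‖ ^ 2 : ℝ) : ℂ) / 2) = ((‖ω‖ ^ 2 / 2 : ℝ) : ℂ) by push_cast; ring,
      Complex.ofReal_re]
  have hlow : -(‖ω‖ * ‖z‖) ≤ (conj ω * z).re := by
    have := Complex.abs_re_le_norm (conj ω * z)
    rw [norm_mul, RCLike.norm_conj] at this
    exact (abs_le.mp this).1
  have hexp : ‖cexp (-(π / τ.im) * (conj ω * z + ω * conj ω / 2))‖ ≤
      Real.exp (π / τ.im * ‖z‖ ^ 2) *
      (Real.exp (-(π / τ.im * (EisensteinSeries.r τ ^ 2 / 8) * (p.1 : ℝ) ^ 2)) *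
        Real.exp (-(π / τ.im * (EisensteinSeries.r τ ^ 2 / 8) * (p.2 : ℝ) ^ 2))) := by
    rw [Complex.norm_exp, ← Real.exp_add, ← Real.exp_add]
    refine Real.exp_le_exp.mpr ?_
    rw [show (-((π : ℂ) / (τ.im : ℝ)) * (conj ω * z + ω * conj ω / 2)).re =
      -(π / τ.im) * (conj ω * z + ω * conj ω / 2).re by
        rw [← Complex.ofReal_div, ← Complex.ofReal_neg, Complex.re_ofReal_mul], hre]
    have hpos : 0 < π / τ.im := by positivity
    have : 0 ≤ (π / τ.im) * ((conj ω * z).re + ‖ω‖ ^ 2 / 2 + ‖z‖ ^ 2 -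
        EisensteinSeries.r τ ^ 2 / 8 * ((p.1 : ℝ) ^ 2 + (p.2 : ℝ) ^ 2)) := by
      refine mul_nonneg hpos.le ?_
      nlinarith [sq_nonneg (‖ω‖ / 2 - ‖z‖)]
    linarith
  rw [latticeTerm, norm_div, norm_mul, hs, one_mul, div_eq_inv_mul, mul_assoc]
  gcongr

lemma summable_latticeTerm {z : ℂ} {τ : ℍ} (hz : ∀ m : ℤ, z.im + m * τ.im ≠ 0) :
    Summable (latticeTerm z τ) := by
  obtain ⟨d, hd0, hd⟩ := exists_le_abs_add_int_mul τ.im_pos hz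
  have hy := τ.im_pos
  have hr := EisensteinSeries.r_pos τ
  have ha : 0 < π / τ.im * (EisensteinSeries.r τ ^ 2 / 8) := by positivity
  have hs := summable_exp_neg_mul_sq ha
  have := Summable.mul_of_nonneg hs hs (fun _ => (Real.exp_pos _).le) (fun _ => (Real.exp_pos _).le)
  exact Summable.of_norm_bounded (this.mul_left _) (norm_latticeTerm_le hd0 hd)

/-- Completing the square: substituting `conj ω = ω - 2imy` leaves `-π(z+ω)²/2y`, a theta exponent
in `m`, and the sign `(-1)^(mn)`. -/
lemma cexp_mul_latticeTerm (z : ℂ) (τ : ℍ) (m n : ℤ) :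
    cexp (-(π * z ^ 2 / (2 * τ.im))) * latticeTerm z τ (m, n) =
      (-1) ^ m * cexp (π * 𝕚 * m ^ 2 * τ + 2 * π * 𝕚 * m * z) *
        gaussTerm τ.im (z + m * τ) n := by
  have hy := im_ne_zero_complex τ
  have hs := latticeSign_mul (m, n)
  set ω := latticePt (m, n) τ with hω
  have hw : z + m * (τ : ℂ) + n = z + ω := by rw [hω, latticePt]; ring
  have hc : conj ω = ω - 2 * 𝕚 * (m * (τ.im : ℝ)) := by
    have := Complex.sub_conj ω
    rw [show ω.im = m * τ.im by simp [hω, latticePt]] at this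
    push_cast at this
    linear_combination -this
  have hpar : ((-1 : ℂ)) ^ (m * n) = cexp (π * 𝕚 * (m * n)) := by
    rw [← cexp_int_mul_pi]; push_cast; congr 1
  have hexp : cexp (-(π * z ^ 2 / (2 * τ.im))) *
      cexp (-(π / τ.im) * (conj ω * z + ω * conj ω / 2)) =
      (-1) ^ (m * n) * cexp (π * 𝕚 * m ^ 2 * τ + 2 * π * 𝕚 * m * z) *
        cexp (-(π * (z + m * τ + n) ^ 2 / (2 * τ.im))) := by
    rw [hpar, ← Complex.exp_add, ← Complex.exp_add, ← Complex.exp_add, hc, hw]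
    congr 1
    have : ω = m * τ + n := rfl
    field_simp
    rw [this]
    ring
  rw [latticeTerm, gaussTerm, ← hω, hw, ← hw]
  rw [show cexp (-(π * z ^ 2 / (2 * τ.im))) * (latticeSign (m, n) *
    cexp (-(π / τ.im) * (conj ω * z + ω * conj ω / 2)) / (z + m * τ + n)) =
    latticeSign (m, n) * (cexp (-(π * z ^ 2 / (2 * τ.im))) *
      cexp (-(π / τ.im) * (conj ω * z + ω * conj ω / 2))) / (z + m * τ + n) by ring, hexp]
  dsimp only at hs
  linear_combination (cexp (π * 𝕚 * m ^ 2 * τ + 2 * π * 𝕚 * m * z) *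
        cexp (-(π * (z + m * τ + n) ^ 2 / (2 * τ.im)))) / (z + m * τ + n) * hs

/-! ### Convergence of `C`, the product `θ₁ C` row by row, and the lattice sum identity -/

lemma hasSum_theta1 {τ : ℂ} (hτ : 0 < τ.im) (z : ℂ) :
    HasSum (fun n : ℤ => (-1) ^ n * cexp (π * 𝕚 * ((n : ℂ) + 1 / 2) ^ 2 * τ +
      2 * π * 𝕚 * ((n : ℂ) + 1 / 2) * z)) (𝕚 * theta1 z τ) := by
  have h := (hasSum_jacobiTheta₂_term (z + 1 / 2 + τ / 2) hτ).mul_left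
    (cexp (π * 𝕚 * τ / 4 + π * 𝕚 * z))
  refine hasSum_of_eq h (fun n => ?_) ?_
  · rw [jacobiTheta₂_term, ← cexp_int_mul_pi, ← Complex.exp_add, ← Complex.exp_add]
    congr 1; ring
  · rw [theta1_eq]; linear_combination (-cexp (π * 𝕚 * τ / 4 + π * 𝕚 * z) *
      jacobiTheta₂ (z + 1 / 2 + τ / 2) τ) * Complex.I_sq

lemma summable_norm_theta1 {τ : ℂ} (hτ : 0 < τ.im) (z : ℂ) :
    Summable (fun n : ℤ => ‖(-1 : ℂ) ^ n * cexp (π * 𝕚 * ((n : ℂ) + 1 / 2) ^ 2 * τ +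
      2 * π * 𝕚 * ((n : ℂ) + 1 / 2) * z)‖) :=
  (hasSum_theta1 hτ z).summable.norm

/-- With `r = m + 1/2`, the decay `e^(-2πr²y)` of `beta` outweighs the growth `e^(πr²y)` of the
negative power of `q`. -/
lemma norm_C_term_le (τ : ℍ) (m : ℤ) :
    ‖(-1 : ℂ) ^ m * (betaCoef τ.im m : ℂ) * qpow (-(((m : ℂ) + 1 / 2) ^ 2 / 2)) τ‖ ≤
      (τ.im / 2) ^ (-(1 / 2) : ℝ) / π * Real.exp (-(π * ((m : ℝ) + 1 / 2) ^ 2 * τ.im)) := by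
  have h : ‖qpow (-(((m : ℂ) + 1 / 2) ^ 2 / 2)) τ‖ =
      Real.exp (π * ((m : ℝ) + 1 / 2) ^ 2 * τ.im) := by
    rw [qpow, Complex.norm_exp]
    congr 1
    rw [show 2 * π * 𝕚 * -(((m : ℂ) + 1 / 2) ^ 2 / 2) * τ =
      ((-(π * ((m : ℝ) + 1 / 2) ^ 2) : ℝ) : ℂ) * τ * 𝕚 by push_cast; ring, Complex.mul_I_re,
      Complex.im_ofReal_mul, UpperHalfPlane.coe_im]
    ring
  have h1 : ‖(-1 : ℂ) ^ m‖ = 1 := by rw [norm_zpow, norm_neg, norm_one, one_zpow]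
  rw [norm_mul, norm_mul, h1, one_mul, h]
  calc _ ≤ (τ.im / 2) ^ (-(1 / 2) : ℝ) / π *
      Real.exp (-(2 * π * ((m : ℝ) + 1 / 2) ^ 2 * τ.im)) *
        Real.exp (π * ((m : ℝ) + 1 / 2) ^ 2 * τ.im) := by
        gcongr; exact norm_betaCoef_le τ.im_pos m
    _ = _ := by
        rw [mul_assoc, ← Real.exp_add]
        congr 2; ring

lemma summable_gauss_half {y : ℝ} (hy : 0 < y) :
    Summable fun m : ℤ => Real.exp (-(π * ((m : ℝ) + 1 / 2) ^ 2 * y)) := by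
  simpa using summable_gauss_shift hy 0

lemma summable_norm_C_term (τ : ℍ) : Summable fun m : ℤ =>
    ‖(-1 : ℂ) ^ m * (betaCoef τ.im m : ℂ) * qpow (-(((m : ℂ) + 1 / 2) ^ 2 / 2)) τ‖ :=
  Summable.of_nonneg_of_le (fun _ => norm_nonneg _) (norm_C_term_le τ)
    ((summable_gauss_half τ.im_pos).mul_left _)

lemma C_eq (τ : ℍ) : C τ = (1 / 2) *
    ∑' m : ℤ, (-1 : ℂ) ^ m * (betaCoef τ.im m : ℂ) * qpow (-(((m : ℂ) + 1 / 2) ^ 2 / 2)) τ := by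
  rw [C]
  congr 1
  refine tsum_congr fun m => ?_
  rw [betaCoef]; push_cast; ring

/-- In the absolutely convergent double series, the index `n` of `θ₁` and the index `k` of `C` are
regrouped by `m = n - k`. The quadratic parts in `k` cancel, leaving the `beta` series of row `m`.
-/
lemma hasSum_theta1_mul_C (z : ℂ) (τ : ℍ) :
    HasSum (fun m : ℤ => (-1) ^ m * cexp (π * 𝕚 * m ^ 2 * τ + 2 * π * 𝕚 * m * z) *
      ∑' k : ℤ, (betaCoef τ.im k : ℂ) * cexp (2 * π * 𝕚 * ((k : ℂ) + 1 / 2) * (z + m * τ)))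
      (𝕚 * theta1 z τ * (2 * C τ)) := by
  have h1 := summable_mul_of_summable_norm (summable_norm_theta1 τ.im_pos z) (summable_norm_C_term τ)
  have h2 := (hasSum_theta1 τ.im_pos z).mul (summable_norm_C_term τ).of_norm.hasSum h1
  rw [show ∑' m : ℤ, (-1 : ℂ) ^ m * (betaCoef τ.im m : ℂ) *
    qpow (-(((m : ℂ) + 1 / 2) ^ 2 / 2)) τ = 2 * C τ by rw [C_eq]; ring] at h2
  let e : ℤ × ℤ ≃ ℤ × ℤ :=
    { toFun := fun p => (p.1 + p.2, p.2)
      invFun := fun p => (p.1 - p.2, p.2)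
      left_inv := fun p => by simp
      right_inv := fun p => by simp }
  have h3 := e.hasSum_iff.mpr h2
  refine h3.prod_fiberwise fun m => ?_
  have h4 := ((summable_betaCoef τ.im_pos (z + m * τ)).of_norm.hasSum).mul_left
    ((-1) ^ m * cexp (π * 𝕚 * m ^ 2 * τ + 2 * π * 𝕚 * m * z))
  refine hasSum_of_eq h4 (fun k => ?_) rfl
  have hsgn : (-1 : ℂ) ^ (m + k) * (-1) ^ k = (-1) ^ m := by
    rw [zpow_add₀ (by norm_num), mul_assoc, ← mul_zpow]; simp
  have hE : cexp (π * 𝕚 * (((m + k : ℤ) : ℂ) + 1 / 2) ^ 2 * τ +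
      2 * π * 𝕚 * (((m + k : ℤ) : ℂ) + 1 / 2) * z) * qpow (-(((k : ℂ) + 1 / 2) ^ 2 / 2)) τ =
      cexp (π * 𝕚 * m ^ 2 * τ + 2 * π * 𝕚 * m * z) *
        cexp (2 * π * 𝕚 * ((k : ℂ) + 1 / 2) * (z + m * τ)) := by
    rw [qpow, ← Complex.exp_add, ← Complex.exp_add]
    congr 1; push_cast; ring
  simp only [Function.comp_apply, e, Equiv.coe_fn_mk]
  rw [← hsgn]
  linear_combination ((-1 : ℂ) ^ (m + k) * (-1) ^ k * (betaCoef τ.im k : ℂ)) * hE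

lemma summable_appellTerm {z τ : ℂ} (hτ : 0 < τ.im) (hz : ∀ m : ℤ, z.im + m * τ.im ≠ 0) :
    Summable fun n : ℤ => appellTerm n z τ := by
  obtain ⟨d, hd0, hd⟩ := exists_le_abs_add_int_mul hτ hz
  exact Summable.of_norm_bounded (summable_appell_bound hτ _ _)
    (fun n => norm_appellTerm_le hd0 hτ (hd n) le_rfl le_rfl)

/-- The completed Appell-Lerch sum as a Gaussian lattice sum. -/
theorem cexp_mul_latticeG {z : ℂ} {τ : ℍ} (hz : ∀ m : ℤ, z.im + m * τ.im ≠ 0) :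
    cexp (-(π * z ^ 2 / (2 * τ.im))) * latticeG z τ =
      2 * π * (theta1 z τ * mu z τ - theta1 z τ * C τ) := by
  have hne : ∀ l u : ℤ, z ≠ l * (τ : ℂ) + u := by
    intro l u h
    apply hz (-l)
    rw [h]; simp
  have hG := ((summable_latticeTerm hz).hasSum).mul_left (cexp (-(π * z ^ 2 / (2 * τ.im))))
  have hrow := hG.prod_fiberwise (g := fun m : ℤ =>
      (-1) ^ m * cexp (π * 𝕚 * m ^ 2 * τ + 2 * π * 𝕚 * m * z) *
        ∑' n, gaussTerm τ.im (z + m * τ) n) (fun m => by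
    have hs := hG.summable.prod_factor m
    have e : ∑' n : ℤ, cexp (-(π * z ^ 2 / (2 * τ.im))) * latticeTerm z τ (m, n) =
        (-1) ^ m * cexp (π * 𝕚 * m ^ 2 * τ + 2 * π * 𝕚 * m * z) *
        ∑' n, gaussTerm τ.im (z + m * τ) n := by
      rw [← tsum_mul_left]
      exact tsum_congr fun n => cexp_mul_latticeTerm z τ m n
    rw [← e]
    exact hs.hasSum)
  have hA := ((summable_appellTerm τ.im_pos hz).hasSum).mul_left (-(2 * π * 𝕚) * cexp (π * 𝕚 * z))
  have hC := (hasSum_theta1_mul_C z τ).mul_left (π * 𝕚)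
  have hsum := hA.add hC
  -- The lattice sum is known by rows; Poisson summation shows that row `m` is an Appell-Lerch term
  -- plus a row of `θ₁ C`, both up to constants.
  have heq := hrow.unique (hasSum_of_eq hsum (fun m => ?_) rfl)
  · rw [show ∑' n : ℤ, appellTerm n z τ = appell z τ from rfl] at heq
    rw [show latticeG z τ = ∑' p : ℤ × ℤ, latticeTerm z τ p from rfl, heq,
      theta1_mul_mu (theta1_ne_zero τ.2 hne)]
    linear_combination (2 * π * theta1 z τ * C τ) * Complex.I_sq
  · have him : (z + m * (τ : ℂ)).im ≠ 0 := by
      have := hz m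
      simpa using this
    rw [tsum_gaussTerm τ.im_pos him, appellTerm]
    have e1 : cexp (π * 𝕚 * m ^ 2 * τ + 2 * π * 𝕚 * m * z) * cexp (π * 𝕚 * (z + m * τ)) =
        cexp (π * 𝕚 * z) * (qpow ((m : ℂ) * ((m : ℂ) + 1) / 2) τ * cexp (2 * π * 𝕚 * (m : ℂ) * z)) := by
      rw [qpow, ← Complex.exp_add, ← Complex.exp_add, ← Complex.exp_add]; congr 1; ring
    have e2 : cexp (2 * π * 𝕚 * (z + m * τ)) = cexp (2 * π * 𝕚 * z) * qpow (m : ℂ) τ := by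
      rw [qpow, ← Complex.exp_add]; congr 1; ring
    rw [e2]
    linear_combination (-(2 * π * 𝕚) * (-1 : ℂ) ^ m /
      (1 - cexp (2 * π * 𝕚 * z) * qpow (m : ℂ) τ)) * e1

/-! ### The components of `θ₁² μ` -/

/-- A bound uniform in `q`, needed because both arguments vary as `τ → i∞`. -/
lemma norm_qPochInf_sub_one_le {q : ℂ} (hq : ‖q‖ ≤ 1 / 2) (x : ℂ) :
    ‖qPochInf x q - 1‖ ≤ Real.exp (2 * ‖x‖) - 1 := by
  have hq1 : ‖q‖ < 1 := by linarith
  refine le_of_tendsto (((qPochInf_tendsto hq1 x).sub_const 1).norm) (Eventually.of_forall fun N => ?_)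
  have h := Finset.norm_prod_one_add_sub_one_le (Finset.range N) (fun k => -(x * q ^ k))
  simp only [← sub_eq_add_neg] at h
  refine h.trans ?_
  gcongr
  calc ∑ k ∈ Finset.range N, ‖-(x * q ^ k)‖ = ‖x‖ * ∑ k ∈ Finset.range N, ‖q‖ ^ k := by
        rw [Finset.mul_sum]; simp
    _ ≤ ‖x‖ * (1 - ‖q‖)⁻¹ := by
        gcongr
        rw [← tsum_geometric_of_lt_one (norm_nonneg _) hq1]
        exact (summable_geometric_of_lt_one (norm_nonneg _) hq1).sum_le_tsum _
          (fun _ _ => by positivity)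
    _ ≤ ‖x‖ * 2 := by
        gcongr
        rw [inv_le_comm₀ (by linarith) (by norm_num)]
        linarith
    _ = 2 * ‖x‖ := mul_comm _ _

lemma tendsto_qPochInf {α : Type*} {l : Filter α} {x q : α → ℂ} (hx : Tendsto x l (𝓝 0))
    (hq : Tendsto q l (𝓝 0)) : Tendsto (fun a => qPochInf (x a) (q a)) l (𝓝 1) := by
  rw [tendsto_iff_norm_sub_tendsto_zero]
  have h1 : Tendsto (fun a => Real.exp (2 * ‖x a‖) - 1) l (𝓝 0) := by
    have := ((Real.continuous_exp.tendsto (2 * ‖(0 : ℂ)‖)).comp ((hx.norm).const_mul 2)).sub_const 1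
    simpa using this
  refine squeeze_zero' (Eventually.of_forall fun _ => norm_nonneg _) ?_ h1
  have h2 : ∀ᶠ a in l, ‖q a‖ ≤ 1 / 2 := by
    have := hq.norm
    rw [norm_zero] at this
    exact (this.eventually (Iio_mem_nhds (by norm_num : (0 : ℝ) < 1 / 2))).mono fun a ha => ha.le
  exact h2.mono fun a ha => norm_qPochInf_sub_one_le ha _

lemma tendsto_cexp_mul {a : ℝ} (ha : 0 < a) :
    Tendsto (fun τ : ℍ => cexp (2 * π * 𝕚 * (a * τ))) atImInfty (𝓝 0) := by
  have h := qParam_tendsto_atImInfty (h := a⁻¹) (inv_pos.mpr ha)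
  refine h.congr fun τ => ?_
  rw [Function.Periodic.qParam]
  congr 1
  push_cast
  have : (a : ℂ) ≠ 0 := by exact_mod_cast ha.ne'
  field_simp

/-- Because `n² ≥ |n|`, the Gaussian exponent is monotone in `Im τ`, so one summable bound serves
for all `Im τ ≥ T`. It gives both holomorphy in `τ` and boundedness at infinity. -/
lemma norm_appellTerm_half_le {T : ℝ} (hT : 0 < T) {τ : ℂ} (hτ : T ≤ τ.im) (n : ℤ) :
    ‖if n = 0 then 0 else appellTerm n (1 / 2) τ‖ ≤ (1 - Real.exp (-(2 * π * (1 / 4 * T))))⁻¹ *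
      Real.exp (-π * (T * n ^ 2 - 2 * (T / 2) * |n|)) := by
  have hpi := Real.pi_pos
  have hTpos : 0 < τ.im := hT.trans_le hτ
  have hpos : 0 < 1 - Real.exp (-(2 * π * (1 / 4 * T))) := by
    rw [sub_pos, Real.exp_lt_one_iff]
    have : 0 < 2 * π * (1 / 4 * T) := by positivity
    linarith
  split_ifs with h
  · rw [norm_zero]; positivity
  · have hz : |((1 / 2 : ℂ)).im| < 3 / 4 * τ.im := by simpa using hTpos
    have hd := le_abs_im_add hTpos hz h
    have hB : |((1 / 2 : ℂ) + τ / 2 + 1 / 2).im| ≤ τ.im / 2 := by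
      rw [show ((1 / 2 : ℂ) + τ / 2 + 1 / 2).im = τ.im / 2 by simp, abs_of_pos (half_pos hTpos)]
    have hd' : 1 / 4 * T ≤ |(1 / 2 : ℂ).im + n * τ.im| := le_trans (by linarith) hd
    refine (norm_appellTerm_le (by positivity : 0 < 1 / 4 * T) hTpos hd' hB le_rfl).trans ?_
    gcongr ?_ * Real.exp ?_
    have h1 : (1 : ℝ) ≤ |(n : ℝ)| := by exact_mod_cast Int.one_le_abs h
    have h2 : 0 ≤ (n : ℝ) ^ 2 - |(n : ℝ)| := by
      rw [← sq_abs]; nlinarith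
    push_cast
    have h3 := mul_nonneg (sub_nonneg.mpr hτ) h2
    nlinarith

lemma appell_half_eq {τ : ℂ} (hτ : 0 < τ.im) : appell (1 / 2) τ = 1 / 2 + appellReg (1 / 2) τ := by
  rw [appell_eq_add_appellReg hτ (by simpa using hτ), cexp_two_pi_half]
  norm_num

lemma differentiableOn_appell_half :
    DifferentiableOn ℂ (fun τ => appell (1 / 2) τ) {τ | 0 < τ.im} := by
  intro w hw
  have hw' : 0 < w.im := hw
  have hopen : IsOpen {τ : ℂ | w.im / 2 < τ.im} := isOpen_lt continuous_const Complex.continuous_im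
  have hmem : w ∈ {τ : ℂ | w.im / 2 < τ.im} := by
    change w.im / 2 < w.im; linarith
  have h : DifferentiableOn ℂ (fun τ => appellReg (1 / 2) τ) {τ : ℂ | w.im / 2 < τ.im} := by
    refine Complex.differentiableOn_tsum_of_summable_norm
      (summable_appell_bound (half_pos hw') (w.im / 2 / 2) _) (fun n => ?_) hopen
      (fun n τ hτ => norm_appellTerm_half_le (half_pos hw') (le_of_lt hτ) n)
    split_ifs with h0
    · exact differentiableOn_const 0
    · intro τ hτ
      have hτ' : 0 < τ.im := (half_pos hw').trans hτ
      have hne : 1 - cexp (2 * π * 𝕚 * (1 / 2)) * qpow (n : ℂ) τ ≠ 0 := by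
        have hd := le_abs_im_add hτ' (z := 1 / 2) (by simpa using hτ') h0
        have := one_sub_le_norm_one_sub hd
        intro h
        rw [h, norm_zero] at this
        have h2 : Real.exp (-(2 * π * (1 / 4 * τ.im))) < 1 := by
          rw [Real.exp_lt_one_iff]
          have := Real.pi_pos
          have : 0 < 2 * π * (1 / 4 * τ.im) := by positivity
          linarith
        linarith
      refine DifferentiableAt.differentiableWithinAt ?_
      simp only [appellTerm]
      refine DifferentiableAt.div ?_ ?_ hne <;> (unfold qpow; fun_prop)
  have h2 : DifferentiableAt ℂ (fun τ => 1 / 2 + appellReg (1 / 2) τ) w :=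
    ((h w hmem).differentiableAt (hopen.mem_nhds hmem)).const_add _
  refine (h2.congr_of_eventuallyEq ?_).differentiableWithinAt
  filter_upwards [(isOpen_lt continuous_const Complex.continuous_im).mem_nhds hw'] with τ hτ
  exact appell_half_eq hτ

lemma isBounded_appell_half : IsBoundedAtImInfty fun τ : ℍ => appell (1 / 2) τ := by
  rw [isBoundedAtImInfty_iff]
  refine ⟨1 / 2 + ∑' n : ℤ, (1 - Real.exp (-(2 * π * (1 / 4 * 1))))⁻¹ *
      Real.exp (-π * (1 * n ^ 2 - 2 * (1 / 2) * |n|)), 1, fun τ hτ => ?_⟩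
  rw [appell_half_eq τ.2]
  refine (norm_add_le _ _).trans ?_
  gcongr
  · norm_num
  · exact tsum_of_norm_bounded (summable_appell_bound one_pos _ _).hasSum
      (fun n => norm_appellTerm_half_le one_pos hτ n)

lemma qpow_int_add_one (n : ℤ) (τ : ℂ) : qpow (n : ℂ) (τ + 1) = qpow (n : ℂ) τ := by
  rw [qpow, qpow, mul_add, mul_one, Complex.exp_add, cexp_int_mul_two_pi, mul_one]

lemma appell_half_add_one (τ : ℂ) : appell (1 / 2) (τ + 1) = appell (1 / 2) τ := by
  refine tsum_congr fun n => ?_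
  obtain ⟨k, hk⟩ := Int.even_mul_succ_self n
  have e : (n : ℂ) * ((n : ℂ) + 1) / 2 = (k : ℤ) := by
    have : ((n * (n + 1) : ℤ) : ℂ) = ((k + k : ℤ) : ℂ) := by rw [hk]
    push_cast at this
    rw [this]; ring
  rw [appellTerm, appellTerm, e, qpow_int_add_one, qpow_int_add_one]

/-- `S₀ q^(-1/8)` as a function of `q`. -/
def sComp0 (τ : ℂ) : ℂ :=
  (qPochInf (cexp (2 * π * 𝕚 * τ)) (cexp (2 * π * 𝕚 * τ)) ^ 3 +
    2 * qPochInf (cexp (2 * π * 𝕚 * τ)) (cexp (2 * π * 𝕚 * τ)) *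
      qPochInf (-cexp (2 * π * 𝕚 * τ)) (cexp (2 * π * 𝕚 * τ)) ^ 2 * appell (1 / 2) τ) /
  (2 * (qPochInf (cexp (2 * π * 𝕚 * (2 * τ))) (cexp (2 * π * 𝕚 * (2 * τ))) *
        qPochInf (-cexp (2 * π * 𝕚 * τ)) (cexp (2 * π * 𝕚 * (2 * τ))) ^ 2))

/-- `S₁ q^(1/8)` as a function of `q`. -/
def sComp1 (τ : ℂ) : ℂ :=
  (qPochInf (cexp (2 * π * 𝕚 * τ)) (cexp (2 * π * 𝕚 * τ)) ^ 3 -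
    2 * qPochInf (cexp (2 * π * 𝕚 * τ)) (cexp (2 * π * 𝕚 * τ)) *
      qPochInf (-cexp (2 * π * 𝕚 * τ)) (cexp (2 * π * 𝕚 * τ)) ^ 2 * appell (1 / 2) τ) /
  (4 * (qPochInf (cexp (2 * π * 𝕚 * (2 * τ))) (cexp (2 * π * 𝕚 * (2 * τ))) *
        qPochInf (-cexp (2 * π * 𝕚 * (2 * τ))) (cexp (2 * π * 𝕚 * (2 * τ))) ^ 2))

lemma cexp_add_one (τ : ℂ) : cexp (2 * π * 𝕚 * (τ + 1)) = cexp (2 * π * 𝕚 * τ) := by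
  rw [mul_add, mul_one, Complex.exp_add, Complex.exp_two_pi_mul_I, mul_one]

lemma cexp_two_mul_add_one (τ : ℂ) :
    cexp (2 * π * 𝕚 * (2 * (τ + 1))) = cexp (2 * π * 𝕚 * (2 * τ)) := by
  rw [show 2 * (τ + 1) = 2 * τ + 1 + 1 by ring, cexp_add_one, cexp_add_one]

lemma sComp0_add_one (τ : ℂ) : sComp0 (τ + 1) = sComp0 τ := by
  rw [sComp0, sComp0, cexp_add_one, cexp_two_mul_add_one, appell_half_add_one]

lemma sComp1_add_one (τ : ℂ) : sComp1 (τ + 1) = sComp1 τ := by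
  rw [sComp1, sComp1, cexp_add_one, cexp_two_mul_add_one, appell_half_add_one]

lemma two_mul_im_pos {τ : ℂ} (hτ : 0 < τ.im) : 0 < (2 * τ).im := by
  simpa using hτ

lemma S_zero_mul (τ : ℍ) : S 0 τ * (2 * theta3 0 (2 * τ)) =
    ModularForm.eta τ ^ 3 + theta2 0 τ * appell (1 / 2) τ := by
  linear_combination S_mul_theta_add τ + S_mul_theta_sub τ

lemma S_one_mul (τ : ℍ) : S 1 τ * (2 * theta2 0 (2 * τ)) =
    ModularForm.eta τ ^ 3 - theta2 0 τ * appell (1 / 2) τ := by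
  linear_combination S_mul_theta_add τ - S_mul_theta_sub τ

/-- All fractional powers of `q` are pulled out in front; the cofactor is `1`-periodic and bounded
at infinity. -/
lemma S_zero_eq (τ : ℍ) : S 0 τ = qpow (1 / 8) τ * sComp0 τ := by
  have h2 := two_mul_im_pos τ.2
  have h := S_zero_mul τ
  have hne : 2 * theta3 0 (2 * τ) ≠ 0 := mul_ne_zero two_ne_zero (theta3_zero_ne_zero h2)
  have e : cexp (π * 𝕚 * (2 * (τ : ℂ))) = cexp (2 * π * 𝕚 * τ) := by congr 1; ring
  have e1 : cexp (2 * π * 𝕚 * τ / 24) ^ 3 = qpow (1 / 8) τ := by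
    rw [qpow, ← Complex.exp_nat_mul]; congr 1; push_cast; ring
  have e2 : cexp (π * 𝕚 * τ / 4) = qpow (1 / 8) τ := by rw [qpow]; congr 1; ring
  rw [eq_div_of_mul_eq hne h, sComp0, ← mul_div_assoc, theta3_zero_eq h2, eta_eq,
    theta2_zero_eq τ.2, mul_pow, e1, e2, e]
  congr 1
  ring

lemma S_one_eq (τ : ℍ) : S 1 τ = qpow (-(1 / 8)) τ * sComp1 τ := by
  have h2 := two_mul_im_pos τ.2
  have h := S_one_mul τ
  have hne : 2 * theta2 0 (2 * τ) ≠ 0 := mul_ne_zero two_ne_zero (theta2_zero_ne_zero h2)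
  have e : cexp (π * 𝕚 * (2 * (τ : ℂ)) / 4) = qpow (1 / 8) τ * qpow (1 / 8) τ := by
    rw [qpow, ← Complex.exp_add]; congr 1; ring
  have e1 : cexp (2 * π * 𝕚 * τ / 24) ^ 3 = qpow (1 / 8) τ := by
    rw [qpow, ← Complex.exp_nat_mul]; congr 1; push_cast; ring
  have e2 : cexp (π * 𝕚 * τ / 4) = qpow (1 / 8) τ := by rw [qpow]; congr 1; ring
  have e3 : qpow (-(1 / 8)) τ = (qpow (1 / 8) τ)⁻¹ := by
    rw [qpow, qpow, ← Complex.exp_neg]; congr 1; ring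
  have e4 : qpow (1 / 8) τ ≠ 0 := Complex.exp_ne_zero _
  rw [eq_div_of_mul_eq hne h, sComp1, theta2_zero_eq h2, eta_eq,
    theta2_zero_eq τ.2, mul_pow, e1, e2, e, e3]
  generalize qpow (1 / 8) τ = u at *
  rw [← div_eq_inv_mul, div_div]
  rw [show ∀ a b c : ℂ, u * a - 2 * u * b * c = u * (a - 2 * b * c) from fun a b c => by ring]
  rw [show ∀ a : ℂ, 2 * (2 * (u * u) * a) = u * (4 * a * u) from fun a => by ring,
    mul_div_mul_left _ _ e4]
  congr 1
  ring

/-! ### Holomorphy of `S₀` and `S₁` and their behaviour at infinity -/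

lemma differentiableOn_theta2_zero : DifferentiableOn ℂ (fun τ => theta2 0 τ) {τ | 0 < τ.im} := by
  intro τ hτ
  refine DifferentiableAt.differentiableWithinAt ?_
  have h := (hasFDerivAt_jacobiTheta₂ (0 + τ / 2) hτ).differentiableAt
  have h2 : DifferentiableAt ℂ (fun w : ℂ => jacobiTheta₂ (0 + w / 2) w) τ :=
    DifferentiableAt.comp (g := fun p : ℂ × ℂ => jacobiTheta₂ p.1 p.2)
      (f := fun w : ℂ => (0 + w / 2, w)) τ h (by fun_prop)
  simp only [theta2_eq]
  exact DifferentiableAt.mul (by fun_prop) h2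

lemma differentiableOn_theta3_zero : DifferentiableOn ℂ (fun τ => theta3 0 τ) {τ | 0 < τ.im} := by
  intro τ hτ
  simp only [theta3_eq]
  exact (differentiableAt_jacobiTheta₂_snd 0 hτ).differentiableWithinAt

lemma differentiableOn_eta_cube :
    DifferentiableOn ℂ (fun τ => ModularForm.eta τ ^ 3) {τ | 0 < τ.im} := fun _ hτ =>
  ((ModularForm.differentiableAt_eta_of_mem_upperHalfPlaneSet hτ).pow 3).differentiableWithinAt

lemma coe_ofComplex {w : ℂ} (hw : 0 < w.im) : ((ofComplex w : ℍ) : ℂ) = w := by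
  rw [ofComplex_apply_of_im_pos hw]

lemma mapsTo_two_mul : Set.MapsTo (fun τ : ℂ => 2 * τ) {τ | 0 < τ.im} {τ | 0 < τ.im} :=
  fun _ hτ => two_mul_im_pos hτ

/-- The solved linear system is used instead of the defining integral, so no differentiation under
the integral sign occurs; the denominator has no zeros by the triple product. -/
lemma isHolomorphic_S_zero : IsHolomorphic (S 0) := by
  have h : DifferentiableOn ℂ (fun w => (ModularForm.eta w ^ 3 + theta2 0 w * appell (1 / 2) w) /
      (2 * theta3 0 (2 * w))) {w | 0 < w.im} := by
    refine (differentiableOn_eta_cube.add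
      (differentiableOn_theta2_zero.mul differentiableOn_appell_half)).div
      ((differentiableOn_theta3_zero.comp (f := fun τ : ℂ => 2 * τ) (by fun_prop)
        mapsTo_two_mul).const_mul 2) (fun w hw => ?_)
    exact mul_ne_zero two_ne_zero (theta3_zero_ne_zero (two_mul_im_pos hw))
  refine h.congr fun w hw => ?_
  have := S_zero_mul (ofComplex w)
  rw [coe_ofComplex hw] at this
  exact eq_div_of_mul_eq (mul_ne_zero two_ne_zero (theta3_zero_ne_zero (two_mul_im_pos hw))) this

lemma isHolomorphic_S_one : IsHolomorphic (S 1) := by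
  have h : DifferentiableOn ℂ (fun w => (ModularForm.eta w ^ 3 - theta2 0 w * appell (1 / 2) w) /
      (2 * theta2 0 (2 * w))) {w | 0 < w.im} := by
    refine (differentiableOn_eta_cube.sub
      (differentiableOn_theta2_zero.mul differentiableOn_appell_half)).div
      ((differentiableOn_theta2_zero.comp (f := fun τ : ℂ => 2 * τ) (by fun_prop)
        mapsTo_two_mul).const_mul 2) (fun w hw => ?_)
    exact mul_ne_zero two_ne_zero (theta2_zero_ne_zero (two_mul_im_pos hw))
  refine h.congr fun w hw => ?_
  have := S_one_mul (ofComplex w)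
  rw [coe_ofComplex hw] at this
  exact eq_div_of_mul_eq (mul_ne_zero two_ne_zero (theta2_zero_ne_zero (two_mul_im_pos hw))) this

lemma tendsto_q : Tendsto (fun τ : ℍ => cexp (2 * π * 𝕚 * τ)) atImInfty (𝓝 0) := by
  simpa using tendsto_cexp_mul one_pos

lemma tendsto_q_sq : Tendsto (fun τ : ℍ => cexp (2 * π * 𝕚 * (2 * τ))) atImInfty (𝓝 0) := by
  simpa using tendsto_cexp_mul two_pos

lemma tendsto_neg_zero {α : Type*} {l : Filter α} {f : α → ℂ} (h : Tendsto f l (𝓝 0)) :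
    Tendsto (fun a => -f a) l (𝓝 0) := by
  simpa using h.neg

lemma isBounded_sComp0 : IsBoundedAtImInfty fun τ : ℍ => sComp0 τ := by
  have h1 := tendsto_qPochInf tendsto_q tendsto_q
  have h2 := tendsto_qPochInf (tendsto_neg_zero tendsto_q) tendsto_q
  have h3 := tendsto_qPochInf tendsto_q_sq tendsto_q_sq
  have h4 := tendsto_qPochInf (tendsto_neg_zero tendsto_q) tendsto_q_sq
  have hden := (((h3.mul (h4.pow 2)).const_mul 2).inv₀ (by norm_num)).isBigO_one ℝ
  have hA := (((h1.const_mul 2).mul (h2.pow 2)).isBigO_one ℝ).mul isBounded_appell_half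
  simp only [Pi.one_apply, mul_one] at hA
  have hnum := ((h1.pow 3).isBigO_one ℝ).add hA
  have := hnum.mul hden
  simp only [mul_one, ← div_eq_mul_inv] at this
  exact this

lemma isBounded_sComp1 : IsBoundedAtImInfty fun τ : ℍ => sComp1 τ := by
  have h1 := tendsto_qPochInf tendsto_q tendsto_q
  have h2 := tendsto_qPochInf (tendsto_neg_zero tendsto_q) tendsto_q
  have h3 := tendsto_qPochInf tendsto_q_sq tendsto_q_sq
  have h4 := tendsto_qPochInf (tendsto_neg_zero tendsto_q_sq) tendsto_q_sq
  have hden := (((h3.mul (h4.pow 2)).const_mul 4).inv₀ (by norm_num)).isBigO_one ℝ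
  have hA := (((h1.const_mul 2).mul (h2.pow 2)).isBigO_one ℝ).mul isBounded_appell_half
  simp only [Pi.one_apply, mul_one] at hA
  have hnum := ((h1.pow 3).isBigO_one ℝ).sub hA
  have := hnum.mul hden
  simp only [mul_one, ← div_eq_mul_inv] at this
  exact this

/-! ### Theta decomposition and the coefficient function `F` -/

/-- Entire in `z`, with the transformation law of index one under `z ↦ z + 1` and `z ↦ z + τ`. -/
structure IsEllipticIndexOne (φ : ℂ → ℍ → ℂ) : Prop where
  differentiable : ∀ τ, Differentiable ℂ fun z => φ z τ
  add_one : ∀ z τ, φ (z + 1) τ = φ z τ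
  add_tau : ∀ z (τ : ℍ), φ (z + τ) τ = cexp (-(2 * π * 𝕚 * (τ + 2 * z))) * φ z τ

lemma integral_cexp_int (m : ℤ) :
    ∫ x in (0 : ℝ)..1, cexp (2 * π * 𝕚 * m * x) = if m = 0 then 1 else 0 := by
  split_ifs with h
  · simp [h]
  · have h0 : 2 * π * 𝕚 * (m : ℂ) ≠ 0 :=
      mul_ne_zero Complex.two_pi_I_ne_zero (by exact_mod_cast h)
    rw [integral_exp_mul_complex h0]
    simp [cexp_int_mul_two_pi]

lemma norm_cexp_int_mul_real (m : ℤ) (x : ℝ) : ‖cexp (2 * π * 𝕚 * m * x)‖ = 1 := by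
  rw [show 2 * π * 𝕚 * (m : ℂ) * x = ((2 * π * m * x : ℝ) : ℂ) * 𝕚 by push_cast; ring]
  exact Complex.norm_exp_ofReal_mul_I _

/-- Termwise integration over a period keeps only the terms in `ζ^r`. Absolute convergence at `z =
0` dominates the expansion on the whole real line, where `|ζ| = 1`. -/
lemma HasJacobiExpansion.hasSum_fourierCoef {h : ℕ} {c : ℕ → ℤ → ℂ} {φ : ℂ → ℍ → ℂ}
    (hc : HasJacobiExpansion h c φ) (r : ℤ) (τ : ℍ) :
    HasSum (fun n : ℕ => c n r * qpow ((n : ℂ) / (h : ℂ)) τ)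
      (fourierCoef (fun z => φ z τ) r) := by
  have hs0 : Summable fun p : ℕ × ℤ => ‖c p.1 p.2 * qpow ((p.1 : ℂ) / (h : ℂ)) τ‖ := by
    have := (hc 0 τ).summable.norm
    simpa using this
  have hIntegral : HasSum (fun p : ℕ × ℤ => ∫ x in (0 : ℝ)..1,
      c p.1 p.2 * qpow ((p.1 : ℂ) / (h : ℂ)) τ * cexp (2 * π * 𝕚 * ((p.2 - r : ℤ) : ℂ) * x))
      (fourierCoef (fun z => φ z τ) r) := by
    rw [fourierCoef]
    refine intervalIntegral.hasSum_integral_of_dominated_convergence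
      (fun p _ => ‖c p.1 p.2 * qpow ((p.1 : ℂ) / (h : ℂ)) τ‖) (fun p => ?_) (fun p => ?_) ?_ ?_ ?_
    · exact (Continuous.aestronglyMeasurable (by fun_prop))
    · refine Eventually.of_forall fun x _ => ?_
      rw [norm_mul _ (cexp _), norm_cexp_int_mul_real, mul_one]
    · exact Eventually.of_forall fun x _ => hs0
    · exact intervalIntegrable_const
    · refine Eventually.of_forall fun x _ => ?_
      refine hasSum_of_eq ((hc x τ).mul_right (cexp (-(2 * π * 𝕚 * r * x)))) (fun p => ?_) rfl
      rw [mul_assoc _ (cexp _) (cexp _), ← Complex.exp_add]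
      congr 2
      push_cast; ring
  have hIntegral2 : HasSum (fun p : ℕ × ℤ => if p.2 = r then c p.1 r * qpow ((p.1 : ℂ) / (h : ℂ)) τ else 0)
      (fourierCoef (fun z => φ z τ) r) := by
    refine hasSum_of_eq hIntegral (fun p => ?_) rfl
    rw [intervalIntegral.integral_const_mul, integral_cexp_int]
    by_cases hp : p.2 = r
    · simp [hp]
    · simp [hp, sub_eq_zero]
  have hinj : Function.Injective (fun n : ℕ => ((n, r) : ℕ × ℤ)) := fun a b hab => by
    simpa using hab
  have := (hinj.hasSum_iff (fun p hp => by
    rw [if_neg]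
    intro h2
    exact hp ⟨p.1, by rw [← h2]⟩)).mpr hIntegral2
  refine hasSum_of_eq this (fun n => by simp) rfl

lemma qpow_add (a b τ : ℂ) : qpow (a + b) τ = qpow a τ * qpow b τ := by
  rw [qpow, qpow, qpow, ← Complex.exp_add]; congr 1; ring

lemma HasJacobiExpansion.thetaComponent_eq {h : ℕ} {c : ℕ → ℤ → ℂ} {φ : ℂ → ℍ → ℂ}
    (hc : HasJacobiExpansion h c φ) (r : ℤ) (τ : ℍ) :
    thetaComponent h c r τ = qpow (-((r : ℂ) ^ 2 / 4)) τ * fourierCoef (fun z => φ z τ) r := by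
  rw [thetaComponent]
  refine (hasSum_of_eq ((hc.hasSum_fourierCoef r τ).mul_left _) (fun n => ?_) rfl).tsum_eq
  rw [sub_eq_add_neg, qpow_add]; ring

lemma IsEllipticIndexOne.theta_decomposition {h : ℕ} {c : ℕ → ℤ → ℂ} {φ : ℂ → ℍ → ℂ}
    (hφ : IsEllipticIndexOne φ) (hc : HasJacobiExpansion h c φ) (z : ℂ) (τ : ℍ) :
    φ z τ = thetaComponent h c 0 τ * theta3 (2 * z) (2 * τ) +
      thetaComponent h c 1 τ * theta2 (2 * z) (2 * τ) := by
  rw [N4Jacobi.theta_decomposition (hφ.differentiable τ) τ.2 (fun z => hφ.add_one z τ)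
    (fun z => hφ.add_tau z τ) z, hc.thetaComponent_eq, hc.thetaComponent_eq]
  simp [qpow]

lemma qpow_div_eq {h : ℕ} (hh : 0 < h) (n : ℕ) (τ : ℂ) :
    qpow ((n : ℂ) / h) τ = Function.Periodic.qParam (h : ℝ) τ ^ n := by
  have : (h : ℂ) ≠ 0 := by exact_mod_cast hh.ne'
  rw [qpow, Function.Periodic.qParam, ← Complex.exp_nat_mul]
  congr 1
  push_cast
  field_simp

lemma isBounded_of_hasSum {h : ℕ} (hh : 0 < h) {a : ℕ → ℂ} {g : ℍ → ℂ}
    (hg : ∀ τ : ℍ, HasSum (fun n : ℕ => a n * qpow ((n : ℂ) / h) τ) (g τ)) :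
    IsBoundedAtImInfty g := by
  refine isBoundedAtImInfty_of_hasSum_qExpansion (h := (h : ℝ)) (c := a) (by exact_mod_cast hh)
    fun τ => hasSum_of_eq (hg τ) (fun n => ?_) rfl
  rw [smul_eq_mul, qpow_div_eq hh]

lemma norm_qpow_real (a : ℝ) (τ : ℂ) : ‖qpow a τ‖ = Real.exp (-(2 * π * a * τ.im)) := by
  rw [qpow, Complex.norm_exp]
  congr 1
  rw [show 2 * π * 𝕚 * (a : ℂ) * τ = ((2 * π * a : ℝ) : ℂ) * τ * 𝕚 by push_cast; ring,
    Complex.mul_I_re, Complex.im_ofReal_mul]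

lemma isHolomorphic_of_hasSum {h : ℕ} {a : ℕ → ℂ} {g : ℍ → ℂ}
    (hg : ∀ τ : ℍ, HasSum (fun n : ℕ => a n * qpow ((n : ℂ) / h) τ) (g τ)) :
    IsHolomorphic g := by
  intro w hw
  have hw' : 0 < w.im := hw
  have hopen : IsOpen {τ : ℂ | w.im / 2 < τ.im} := isOpen_lt continuous_const Complex.continuous_im
  have hmem : w ∈ {τ : ℂ | w.im / 2 < τ.im} := by
    change w.im / 2 < w.im; linarith
  -- Absolute convergence at this single point dominates the series on the half-plane above it,
  -- since all exponents are nonnegative.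
  let τ₀ : ℍ := ⟨(w.im / 2 : ℝ) * 𝕚, by simpa using hw'⟩
  have hs := (hg τ₀).summable.norm
  have hd : DifferentiableOn ℂ (fun τ => ∑' n : ℕ, a n * qpow ((n : ℂ) / h) τ)
      {τ : ℂ | w.im / 2 < τ.im} := by
    refine Complex.differentiableOn_tsum_of_summable_norm hs (fun n => ?_) hopen (fun n τ hτ => ?_)
    · unfold qpow; fun_prop
    · rw [norm_mul, norm_mul]
      have e : ((n : ℂ) / h) = (((n : ℝ) / h : ℝ) : ℂ) := by push_cast; rfl
      rw [e, norm_qpow_real, norm_qpow_real]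
      have h3 : (τ₀ : ℂ).im = w.im / 2 := by
        change (((w.im / 2 : ℝ) : ℂ) * 𝕚).im = _
        simp
      rw [h3]
      have h4 : w.im / 2 ≤ τ.im := le_of_lt hτ
      have := Real.pi_pos
      gcongr
  refine ((hd w hmem).differentiableAt (hopen.mem_nhds hmem)).congr_of_eventuallyEq ?_
    |>.differentiableWithinAt
  filter_upwards [(isOpen_lt continuous_const Complex.continuous_im).mem_nhds hw'] with τ hτ
  have := (hg (ofComplex τ)).tsum_eq
  rw [coe_ofComplex hτ] at this
  exact this.symm

lemma qpow_add_nat {h : ℕ} (hh : 0 < h) (n : ℕ) (τ : ℂ) :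
    qpow ((n : ℂ) / h) (τ + h) = qpow ((n : ℂ) / h) τ := by
  have : (h : ℂ) ≠ 0 := by exact_mod_cast hh.ne'
  rw [qpow, qpow, mul_add, Complex.exp_add, show 2 * π * 𝕚 * ((n : ℂ) / h) * h =
    2 * π * 𝕚 * ((n : ℤ) : ℂ) by push_cast; field_simp, cexp_int_mul_two_pi, mul_one]

/-- `F q^(1/8)`. -/
def coefF (φ : ℂ → ℍ → ℂ) (τ : ℍ) : ℂ :=
  fourierCoef (fun z => φ z τ) 0 * sComp1 τ - fourierCoef (fun z => φ z τ) 1 * sComp0 τ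

lemma HasJacobiExpansion.F_eq {h : ℕ} {c : ℕ → ℤ → ℂ} {φ : ℂ → ℍ → ℂ}
    (hc : HasJacobiExpansion h c φ) (τ : ℍ) :
    F h c τ = qpow (-(1 / 8)) τ * coefF φ τ := by
  have e : qpow (-(1 / 4)) τ * qpow (1 / 8) τ = qpow (-(1 / 8)) τ := by
    rw [← qpow_add]; congr 1; ring
  have e0 : qpow (-(0 / 4)) τ = 1 := by simp [qpow]
  rw [F, hc.thetaComponent_eq, hc.thetaComponent_eq, S_zero_eq, S_one_eq, coefF]
  simp only [Int.cast_zero, Int.cast_one, one_pow, ne_eq, OfNat.ofNat_ne_zero, not_false_eq_true,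
    zero_pow, e0]
  linear_combination (-(fourierCoef (fun z => φ z τ) 1 * sComp0 τ)) * e

lemma sComp_add_nat {f : ℂ → ℂ} (hf : ∀ τ, f (τ + 1) = f τ) (n : ℕ) (τ : ℂ) : f (τ + n) = f τ := by
  induction n with
  | zero => simp
  | succ n ih => rw [Nat.cast_succ, ← add_assoc, hf, ih]

lemma HasJacobiExpansion.fourierCoef_add {h : ℕ} (hh : 0 < h) {c : ℕ → ℤ → ℂ} {φ : ℂ → ℍ → ℂ}
    (hc : HasJacobiExpansion h c φ) (r : ℤ) {τ τ' : ℍ} (hτ : (τ' : ℂ) = τ + h) :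
    fourierCoef (fun z => φ z τ') r = fourierCoef (fun z => φ z τ) r := by
  refine (hc.hasSum_fourierCoef r τ').unique (hasSum_of_eq (hc.hasSum_fourierCoef r τ)
    (fun n => ?_) rfl)
  rw [hτ, qpow_add_nat hh]

lemma HasJacobiExpansion.coefF_add {h : ℕ} (hh : 0 < h) {c : ℕ → ℤ → ℂ} {φ : ℂ → ℍ → ℂ}
    (hc : HasJacobiExpansion h c φ) {τ τ' : ℍ} (hτ : (τ' : ℂ) = τ + h) :
    coefF φ τ' = coefF φ τ := by
  rw [coefF, coefF, hc.fourierCoef_add hh 0 hτ, hc.fourierCoef_add hh 1 hτ, hτ,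
    sComp_add_nat sComp0_add_one, sComp_add_nat sComp1_add_one]

lemma HasJacobiExpansion.isBounded_coefF {h : ℕ} (hh : 0 < h) {c : ℕ → ℤ → ℂ} {φ : ℂ → ℍ → ℂ}
    (hc : HasJacobiExpansion h c φ) : IsBoundedAtImInfty (coefF φ) :=
  IsBigO.sub
    (BoundedAtFilter.mul (isBounded_of_hasSum hh (hc.hasSum_fourierCoef 0)) isBounded_sComp1)
    (BoundedAtFilter.mul (isBounded_of_hasSum hh (hc.hasSum_fourierCoef 1)) isBounded_sComp0)

lemma isHolomorphic_qpow (a : ℂ) : IsHolomorphic fun τ => qpow a τ := by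
  have : DifferentiableOn ℂ (fun w => qpow a w) {w | 0 < w.im} := by unfold qpow; fun_prop
  exact this.congr fun w hw => by
    beta_reduce; rw [coe_ofComplex hw]

lemma IsHolomorphic.mul {f g : ℍ → ℂ} (hf : IsHolomorphic f) (hg : IsHolomorphic g) :
    IsHolomorphic fun τ => f τ * g τ := DifferentiableOn.mul hf hg

lemma HasJacobiExpansion.isHolomorphic_F {h : ℕ} {c : ℕ → ℤ → ℂ} {φ : ℂ → ℍ → ℂ}
    (hc : HasJacobiExpansion h c φ) : IsHolomorphic (F h c) := by
  have h0 : ∀ r, IsHolomorphic (thetaComponent h c r) := by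
    intro r
    have := (isHolomorphic_qpow (-((r : ℂ) ^ 2 / 4))).mul
      (isHolomorphic_of_hasSum (hc.hasSum_fourierCoef r))
    exact this.congr fun w _ => hc.thetaComponent_eq r _
  exact DifferentiableOn.sub ((h0 0).mul isHolomorphic_S_one) ((h0 1).mul isHolomorphic_S_zero)

lemma HasJacobiExpansion.isHolomorphic_coefF {h : ℕ} {c : ℕ → ℤ → ℂ} {φ : ℂ → ℍ → ℂ}
    (hc : HasJacobiExpansion h c φ) : IsHolomorphic (coefF φ) := by
  refine ((isHolomorphic_qpow (1 / 8)).mul hc.isHolomorphic_F).congr fun w _ => ?_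
  beta_reduce
  rw [hc.F_eq, ← mul_assoc, ← qpow_add]
  simp [qpow]

/-- The function `q^(1/8) F` is holomorphic, bounded at infinity and `h`-periodic, so the `B n` are
the coefficients of its expansion in powers of `q^(1/h)`. -/
lemma HasJacobiExpansion.exists_hasSum_F {h : ℕ} (hh : 0 < h) {c : ℕ → ℤ → ℂ} {φ : ℂ → ℍ → ℂ}
    (hc : HasJacobiExpansion h c φ) : ∃ B : ℕ → ℂ, ∀ τ : ℍ,
      HasSum (fun n : ℕ => B n * qpow ((n : ℂ) / h - 1 / 8) τ) (F h c τ) := by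
  have hper : Function.Periodic (coefF φ ∘ ofComplex) ((h : ℝ) : ℂ) := by
    intro w
    rcases lt_or_ge 0 w.im with hw | hw
    · have hw2 : 0 < (w + ((h : ℝ) : ℂ)).im := by simpa using hw
      refine hc.coefF_add hh ?_
      rw [coe_ofComplex hw, coe_ofComplex hw2]; simp
    -- Outside the half-plane `ofComplex` is constant, so periodicity is trivial there.
    · have hw2 : (w + ((h : ℝ) : ℂ)).im ≤ 0 := by simpa using hw
      simp only [Function.comp_apply]
      rw [ofComplex_apply_of_im_nonpos hw, ofComplex_apply_of_im_nonpos hw2]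
  refine ⟨fun n => (qExpansion (h : ℝ) (coefF φ)).coeff n, fun τ => ?_⟩
  have := hasSum_qExpansion (h := (h : ℝ)) (by exact_mod_cast hh) hper
    (mdifferentiable_iff.mpr hc.isHolomorphic_coefF) (hc.isBounded_coefF hh) τ
  refine hasSum_of_eq (this.mul_left (qpow (-(1 / 8)) τ)) (fun n => ?_) (hc.F_eq τ)
  rw [smul_eq_mul, ← qpow_div_eq hh, sub_eq_add_neg, qpow_add]; ring

lemma HasJacobiExpansion.F_isBigO {h : ℕ} (hh : 0 < h) {c : ℕ → ℤ → ℂ} {φ : ℂ → ℍ → ℂ}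
    (hc : HasJacobiExpansion h c φ) :
    F h c =O[atImInfty] fun τ : ℍ => Real.exp (π / 4 * τ.im) := by
  have h1 : (fun τ : ℍ => qpow (-(1 / 8)) τ) =O[atImInfty] fun τ : ℍ => Real.exp (π / 4 * τ.im) := by
    refine IsBigO.of_bound 1 (Eventually.of_forall fun τ => le_of_eq ?_)
    rw [show (-(1 / 8) : ℂ) = ((-(1 / 8) : ℝ) : ℂ) by push_cast; rfl, norm_qpow_real, one_mul,
      Real.norm_of_nonneg (Real.exp_pos _).le, UpperHalfPlane.coe_im]
    congr 1; ring
  have := h1.mul (hc.isBounded_coefF hh)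
  simp only [Pi.one_apply, mul_one] at this
  exact this.congr_left fun τ => (hc.F_eq τ).symm

/-- Cramer's rule in the basis `θ₃(2z;2τ)`, `θ₂(2z;2τ)`: `θ₁²` spans the functions vanishing at `0`,
and the determinant of `θ₁²` and `θ₁²μ` is `S₀ θ₃ + S₁ θ₂ = η³`. -/
lemma IsEllipticIndexOne.mul_eta_cube {h : ℕ} {c : ℕ → ℤ → ℂ} {φ : ℂ → ℍ → ℂ}
    (hφ : IsEllipticIndexOne φ) (hc : HasJacobiExpansion h c φ) (z : ℂ) (τ : ℍ) :
    φ z τ * ModularForm.eta τ ^ 3 = φ 0 τ * thetaSqMu z τ + F h c τ * theta1 z τ ^ 2 := by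
  rw [hφ.theta_decomposition hc z, hφ.theta_decomposition hc 0, ← S_mul_theta_add, thetaSqMu_eq,
    theta1_sq_eq τ.2, mul_zero, F]
  ring

/-- The summand `2 B₀` in `A₀` offsets the `-2 ch_{1/4,0}` contained in the second massless
character. -/
lemma IsEllipticIndexOne.hasCharacterExpansion {h : ℕ} {c : ℕ → ℤ → ℂ}
    {φ : ℂ → ℍ → ℂ} (hφ : IsEllipticIndexOne φ) (hc : HasJacobiExpansion h c φ) {χ : ℂ}
    (hχ : ∀ τ, φ 0 τ = χ) {B : ℕ → ℂ}
    (hB : ∀ τ : ℍ, HasSum (fun n : ℕ => B n * qpow ((n : ℂ) / h - 1 / 8) τ) (F h c τ)) :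
    HasCharacterExpansion h (χ + 2 * B 0) B φ := by
  intro z τ
  have hη := eta_cube_ne_zero τ
  have h1 := (hasSum_nat_add_iff' 1).mpr (hB τ)
  have h2 := h1.mul_right (theta1 z τ ^ 2 / ModularForm.eta τ ^ 3)
  refine hasSum_of_eq h2 (fun n => ?_) ?_
  · rw [chMassive]
    push_cast
    ring
  · have hm := hφ.mul_eta_cube hc z τ
    rw [hχ] at hm
    rw [chMassless1, chMassless0, (eq_div_iff hη).mpr hm]
    simp only [Finset.range_one, Finset.sum_singleton, Nat.cast_zero, zero_div, zero_sub]
    field_simp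
    ring

/-! ### Weak Jacobi forms of weight zero and index one -/

lemma IsWeakJacobiForm.differentiable {k : ℤ} {m : ℕ} {Γ : Subgroup SL(2, ℤ)} {φ : ℂ → ℍ → ℂ}
    (hφ : IsWeakJacobiForm k m Γ φ) (τ : ℍ) : Differentiable ℂ fun z => φ z τ := by
  intro z
  have hopen : IsOpen {p : ℂ × ℂ | 0 < p.2.im} :=
    isOpen_lt continuous_const (Complex.continuous_im.comp continuous_snd)
  have h := (hφ.holo (z, (τ : ℂ)) τ.2).differentiableAt (hopen.mem_nhds τ.2)
  have h2 : DifferentiableAt ℂ (fun z : ℂ => φ z (ofComplex (τ : ℂ))) z :=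
    DifferentiableAt.comp (g := fun p : ℂ × ℂ => φ p.1 (ofComplex p.2))
      (f := fun z : ℂ => (z, (τ : ℂ))) z h (by fun_prop)
  simpa only [ofComplex_apply] using h2

lemma IsWeakJacobiForm.isHolomorphic {k : ℤ} {m : ℕ} {Γ : Subgroup SL(2, ℤ)} {φ : ℂ → ℍ → ℂ}
    (hφ : IsWeakJacobiForm k m Γ φ) (z : ℂ) : IsHolomorphic (φ z) :=
  hφ.holo.comp (f := fun w : ℂ => (z, w)) (by fun_prop) fun _ hw => hw

lemma IsWeakJacobiForm.isElliptic {k : ℤ} {Γ : Subgroup SL(2, ℤ)} {φ : ℂ → ℍ → ℂ}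
    (hφ : IsWeakJacobiForm k 1 Γ φ) : IsEllipticIndexOne φ where
  differentiable := hφ.differentiable
  add_one z τ := by simpa using hφ.elliptic 0 1 z τ
  add_tau z τ := by simpa using hφ.elliptic 1 0 z τ

/-- With `j = cτ + d` one has `1/j = -c·γτ + a` and `τ/j = d·γτ - b`, so both translations come from
lattice translations for `γτ`; the exponents agree up to integer multiples of `2πi`. -/
lemma IsWeakJacobiForm.isElliptic_slash {Γ : Subgroup SL(2, ℤ)} {φ : ℂ → ℍ → ℂ}
    (hφ : IsWeakJacobiForm 0 1 Γ φ) (γ : SL(2, ℤ)) :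
    IsEllipticIndexOne (jacobiSlash 0 1 φ γ) where
  differentiable τ := by
    have h := (hφ.differentiable (γ • τ)).comp (differentiable_id.div_const (cocyc γ τ))
    simp only [jacobiSlash]
    exact Differentiable.mul (by fun_prop) h
  add_one z τ := by
    have hj := cocyc_ne_zero γ τ
    have hτ := coe_smul_mul_cocyc γ τ
    have hdet := det_eq γ
    have hz : (z + 1) / cocyc γ τ =
        z / cocyc γ τ + ((-γ 1 0 : ℤ) : ℂ) * ((γ • τ : ℍ) : ℂ) + ((γ 0 0 : ℤ) : ℂ) := by
      field_simp
      push_cast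
      rw [cocyc] at hτ ⊢
      linear_combination (γ 1 0 : ℂ) * hτ - hdet
    have hE : cexp (-(2 * π * 𝕚 * (1 : ℕ) * ((γ 1 0 : ℂ) * (z + 1) ^ 2 / cocyc γ τ))) *
        cexp (-(2 * π * 𝕚 * (1 : ℕ) * (((-γ 1 0 : ℤ) : ℂ) ^ 2 * ((γ • τ : ℍ) : ℂ) +
          2 * ((-γ 1 0 : ℤ) : ℂ) * (z / cocyc γ τ)))) =
        cexp (-(2 * π * 𝕚 * (1 : ℕ) * ((γ 1 0 : ℂ) * z ^ 2 / cocyc γ τ))) := by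
      rw [← Complex.exp_add, Complex.exp_eq_exp_iff_exists_int]
      refine ⟨-(γ 1 0 * γ 0 0), ?_⟩
      push_cast
      field_simp
      rw [cocyc] at hτ ⊢
      linear_combination (-(γ 1 0 : ℂ) ^ 2) * hτ + (γ 1 0 : ℂ) * hdet
    simp only [jacobiSlash]
    rw [hz, hφ.elliptic, ← hE]
    ring
  add_tau z τ := by
    have hj := cocyc_ne_zero γ τ
    have hτ := coe_smul_mul_cocyc γ τ
    have hdet := det_eq γ
    have hz : (z + τ) / cocyc γ τ =
        z / cocyc γ τ + ((γ 1 1 : ℤ) : ℂ) * ((γ • τ : ℍ) : ℂ) + ((-γ 0 1 : ℤ) : ℂ) := by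
      field_simp
      push_cast
      rw [cocyc] at hτ ⊢
      linear_combination (-(γ 1 1 : ℂ)) * hτ - τ * hdet
    have hE : cexp (-(2 * π * 𝕚 * (1 : ℕ) * ((γ 1 0 : ℂ) * (z + τ) ^ 2 / cocyc γ τ))) *
        cexp (-(2 * π * 𝕚 * (1 : ℕ) * (((γ 1 1 : ℤ) : ℂ) ^ 2 * ((γ • τ : ℍ) : ℂ) +
          2 * ((γ 1 1 : ℤ) : ℂ) * (z / cocyc γ τ)))) =
        cexp (-(2 * π * 𝕚 * (τ + 2 * z))) *
        cexp (-(2 * π * 𝕚 * (1 : ℕ) * ((γ 1 0 : ℂ) * z ^ 2 / cocyc γ τ))) := by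
      rw [← Complex.exp_add, ← Complex.exp_add, Complex.exp_eq_exp_iff_exists_int]
      refine ⟨-(γ 1 1 * γ 0 1), ?_⟩
      push_cast
      field_simp
      rw [cocyc] at hτ ⊢
      linear_combination (-(γ 1 1 : ℂ) ^ 2) * hτ - (γ 1 1 : ℂ) * τ * hdet
    simp only [jacobiSlash]
    rw [hz, hφ.elliptic]
    linear_combination (cocyc γ τ ^ (-(0 : ℤ)) * φ (z / cocyc γ τ) (γ • τ)) * hE

lemma jacobiSlash_zero (φ : ℂ → ℍ → ℂ) (γ : SL(2, ℤ)) (τ : ℍ) :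
    jacobiSlash 0 1 φ γ 0 τ = φ 0 (γ • τ) := by
  simp [jacobiSlash]

lemma HasJacobiExpansion.isBounded_zero {h : ℕ} (hh : 0 < h) {c : ℕ → ℤ → ℂ} {φ : ℂ → ℍ → ℂ}
    (hc : HasJacobiExpansion h c φ) : IsBoundedAtImInfty (φ 0) := by
  refine isBounded_of_hasSum hh (a := fun n => ∑' r, c n r) fun τ => ?_
  have h0 := hc 0 τ
  refine hasSum_of_eq (h0.prod_fiberwise fun n => (h0.summable.prod_factor n).hasSum)
    (fun n => ?_) rfl
  simp only [mul_zero, Complex.exp_zero, mul_one]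
  rw [tsum_mul_right]

open scoped ModularForm in
/-- A weak Jacobi form of weight zero is constant at `z = 0`. -/
theorem IsWeakJacobiForm.exists_const {m : ℕ} {Γ : Subgroup SL(2, ℤ)}
    (hΓ : CongruenceSubgroup.IsCongruenceSubgroup Γ) {φ : ℂ → ℍ → ℂ}
    (hφ : IsWeakJacobiForm 0 m Γ φ) : ∃ χ : ℂ, ∀ τ : ℍ, φ 0 τ = χ := by
  -- Finite index makes the image of `Γ` arithmetic, so its cusps are those of `SL(2, ℤ)`, where the
  -- Jacobi expansions at `z = 0` give boundedness.
  have := hΓ.finiteIndex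
  let f : ModularForm (Γ.map (Matrix.SpecialLinearGroup.mapGL ℝ)) 0 :=
    { toFun := φ 0
      slash_action_eq' := by
        rintro _ ⟨γ, hγ, rfl⟩
        change φ 0 ∣[(0 : ℤ)] γ = φ 0
        funext τ
        rw [ModularForm.SL_slash_apply]
        have := hφ.modular γ hγ 0 τ
        simpa using this
      holo' := mdifferentiable_iff.mpr (hφ.isHolomorphic 0)
      bdd_at_cusps' := by
        intro c hc
        rw [OnePoint.isBoundedAt_iff_forall_SL2Z
          ((Subgroup.IsArithmetic.isCusp_iff_isCusp_SL2Z _).mp hc)]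
        intro γ _
        obtain ⟨N, hN, c, hc⟩ := hφ.cusps γ
        have hb := hc.isBounded_zero hN
        have e : jacobiSlash 0 m φ γ 0 = φ 0 ∣[(0 : ℤ)] γ := by
          funext τ
          rw [ModularForm.SL_slash_apply]
          simp [jacobiSlash]
        rwa [← e] }
  obtain ⟨χ, hχ⟩ := ModularForm.eq_const_of_weight_zero f
  exact ⟨χ, fun τ => congrFun hχ τ⟩

/-! ### The multiplier system of `η⁻³` and the shadow -/

open scoped ModularForm in
lemma eta_pow_smul (γ : SL(2, ℤ)) (τ : ℍ) :
    ModularForm.eta ((γ • τ : ℍ) : ℂ) ^ 24 = cocyc γ τ ^ 12 * ModularForm.eta τ ^ 24 := by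
  have h : ModularForm.discriminant ∣[(12 : ℤ)] γ = ModularForm.discriminant :=
    CuspForm.discriminant.slash_action_eq' (Matrix.SpecialLinearGroup.mapGL ℝ γ) ⟨γ, rfl⟩
  have h2 := congrFun h τ
  rw [ModularForm.SL_slash_apply, ← cocyc_eq_denom, zpow_neg, ← div_eq_mul_inv,
    div_eq_iff (zpow_ne_zero _ (cocyc_ne_zero γ τ))] at h2
  simp only [ModularForm.discriminant] at h2
  rw [h2, mul_comm]
  norm_cast

/-- `(cτ+d)^(3/2) η(τ)³ / η(γτ)³`, which does not depend on `τ`. -/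
def etaRatio (γ : SL(2, ℤ)) (τ : ℍ) : ℂ :=
  cocyc γ τ ^ (3 / 2 : ℂ) * ModularForm.eta τ ^ 3 / ModularForm.eta ((γ • τ : ℍ) : ℂ) ^ 3

lemma etaRatio_pow (γ : SL(2, ℤ)) (τ : ℍ) : etaRatio γ τ ^ 8 = 1 := by
  have h1 : (cocyc γ τ ^ (3 / 2 : ℂ)) ^ 8 = cocyc γ τ ^ 12 := by
    rw [← Complex.cpow_nat_mul, ← Complex.cpow_natCast]
    congr 1; norm_num
  have h2 := eta_pow_smul γ τ
  have h3 : ModularForm.eta ((γ • τ : ℍ) : ℂ) ^ 24 ≠ 0 :=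
    pow_ne_zero _ (ModularForm.eta_ne_zero (γ • τ).2)
  rw [etaRatio, div_pow, mul_pow, h1, ← pow_mul, ← pow_mul, ← h2]
  exact div_self h3

/-- Either `c = 0` and the factor is constant, or `cτ + d` is never real and so avoids the branch
cut. -/
lemma continuous_cocyc_cpow (γ : SL(2, ℤ)) (k : ℂ) : Continuous fun τ => cocyc γ τ ^ k := by
  by_cases hc : γ 1 0 = 0
  · have : (fun τ => cocyc γ τ ^ k) = fun _ => ((γ 1 1 : ℤ) : ℂ) ^ k := by
      funext τ; simp [cocyc, hc]
    rw [this]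
    exact continuous_const
  · refine continuous_iff_continuousAt.mpr fun τ => ContinuousAt.cpow ?_ continuousAt_const ?_
    · unfold cocyc
      exact ((continuous_const.mul UpperHalfPlane.continuous_coe).add continuous_const).continuousAt
    · refine Complex.mem_slitPlane_iff.mpr (Or.inr ?_)
      have : (cocyc γ τ).im = γ 1 0 * τ.im := by simp [cocyc]
      rw [this]
      exact mul_ne_zero (by exact_mod_cast hc) τ.im_ne_zero

lemma continuous_eta : Continuous fun τ : ℍ => ModularForm.eta τ :=
  continuous_iff_continuousAt.mpr fun τ =>
    (ModularForm.differentiableAt_eta_of_mem_upperHalfPlaneSet τ.2).continuousAt.comp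
      UpperHalfPlane.continuous_coe.continuousAt

lemma continuous_etaRatio (γ : SL(2, ℤ)) : Continuous (etaRatio γ) := by
  refine ((continuous_cocyc_cpow γ _).mul (continuous_eta.pow 3)).div
    ((continuous_eta.comp (continuous_const_smul (Matrix.SpecialLinearGroup.mapGL ℝ γ))).pow 3) fun τ => eta_cube_ne_zero (γ • τ)

/-- A continuous function on the connected space `ℍ` with values among the eighth roots of unity is
constant. -/
lemma etaRatio_eq (γ : SL(2, ℤ)) (τ τ' : ℍ) : etaRatio γ τ = etaRatio γ τ' := by
  have hfin : ({x : ℂ | x ^ 8 = 1}).Finite := by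
    have : {x : ℂ | x ^ 8 = 1} = ((Polynomial.nthRoots 8 (1 : ℂ)).toFinset : Set ℂ) := by
      ext x
      simp [Polynomial.mem_nthRoots]
    rw [this]
    exact Finset.finite_toSet _
  exact isPreconnected_univ.constant_of_mapsTo hfin.isDiscrete
    (continuous_etaRatio γ).continuousOn (fun τ _ => etaRatio_pow γ τ) (Set.mem_univ _)
    (Set.mem_univ _)

/-- The multiplier system of `η⁻³`, for weight `1/2`. -/
def etaMultiplier (γ : SL(2, ℤ)) : ℂ := etaRatio γ UpperHalfPlane.I

lemma etaMultiplier_eq (γ : SL(2, ℤ)) (τ : ℍ) : etaMultiplier γ = etaRatio γ τ :=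
  etaRatio_eq γ _ τ

lemma norm_etaMultiplier (γ : SL(2, ℤ)) : ‖etaMultiplier γ‖ = 1 :=
  Complex.norm_eq_one_of_pow_eq_one (etaRatio_pow γ _) (by norm_num)

lemma cpow_three_halves_mul {x : ℂ} (hx : x ≠ 0) : x ^ (3 / 2 : ℂ) * x ^ (1 / 2 : ℂ) = x ^ 2 := by
  rw [← Complex.cpow_add _ _ hx, ← Complex.cpow_natCast]; norm_num

/-- In this form the factor is an integral power of `cτ + d` times a coboundary, so the cocycle
relation needs no discussion of branches. -/
lemma etaMultiplier_mul_cpow (γ : SL(2, ℤ)) (τ : ℍ) :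
    etaMultiplier γ * cocyc γ τ ^ (1 / 2 : ℂ) =
      cocyc γ τ ^ 2 * ModularForm.eta τ ^ 3 / ModularForm.eta ((γ • τ : ℍ) : ℂ) ^ 3 := by
  rw [etaMultiplier_eq γ τ, etaRatio, ← cpow_three_halves_mul (cocyc_ne_zero γ τ)]
  ring

lemma isMultiplierSystem_etaMultiplier (Γ : Subgroup SL(2, ℤ)) :
    IsMultiplierSystem Γ (1 / 2) etaMultiplier where
  norm_eq_one γ _ := norm_etaMultiplier γ
  cocycle γ _ δ _ τ := by
    have e : (((1 / 2 : ℝ)) : ℂ) = 1 / 2 := by push_cast; rfl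
    rw [e, etaMultiplier_mul_cpow, etaMultiplier_mul_cpow, etaMultiplier_mul_cpow, cocyc_mul,
      mul_smul]
    have h1 := ModularForm.eta_ne_zero (δ • τ).2
    have h2 := ModularForm.eta_ne_zero (γ • δ • τ).2
    field_simp
  neg_one _ τ := by
    have e : (((1 / 2 : ℝ)) : ℂ) = 1 / 2 := by push_cast; rfl
    have h1 : cocyc (-1) τ = -1 := by simp [cocyc]
    have h2 : (-1 : SL(2, ℤ)) • τ = τ := by
      rw [ModularGroup.SL_neg_smul, one_smul]
    rw [e, etaMultiplier_mul_cpow, h1, h2]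
    have := eta_cube_ne_zero τ
    rw [neg_one_sq, one_mul, div_self this]

lemma eta_cube_smul (γ : SL(2, ℤ)) (τ : ℍ) : ModularForm.eta ((γ • τ : ℍ) : ℂ) ^ 3 =
    conj (etaMultiplier γ) * cocyc γ τ ^ (3 / 2 : ℂ) * ModularForm.eta τ ^ 3 := by
  have h1 := eta_cube_ne_zero (γ • τ)
  have h2 : conj (etaMultiplier γ) * etaMultiplier γ = 1 := by
    rw [mul_comm, Complex.mul_conj, Complex.normSq_eq_norm_sq, norm_etaMultiplier]; norm_num
  have h3 : etaMultiplier γ * ModularForm.eta ((γ • τ : ℍ) : ℂ) ^ 3 =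
      cocyc γ τ ^ (3 / 2 : ℂ) * ModularForm.eta τ ^ 3 := by
    rw [etaMultiplier_eq γ τ, etaRatio, div_mul_cancel₀ _ h1]
  linear_combination (-ModularForm.eta ((γ • τ : ℍ) : ℂ) ^ 3) * h2 + conj (etaMultiplier γ) * h3

lemma isZeroAtImInfty_eta_cube : IsZeroAtImInfty fun τ : ℍ => ModularForm.eta τ ^ 3 := by
  have h := (((tendsto_cexp_mul (a := 1 / 24) (by norm_num)).mul
    (tendsto_qPochInf tendsto_q tendsto_q)).pow 3)
  rw [show ((0 : ℂ) * 1) ^ 3 = 0 by norm_num] at h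
  refine h.congr fun τ => ?_
  rw [eta_eq]
  congr 3
  push_cast; ring

lemma isCuspForm_eta_cube (Γ : Subgroup SL(2, ℤ)) (a : ℂ) :
    IsCuspForm Γ (2 - 1 / 2) (fun γ => conj (etaMultiplier γ))
      (fun τ => a * ModularForm.eta τ ^ 3) := by
  have e : (((2 - 1 / 2 : ℝ)) : ℂ) = 3 / 2 := by push_cast; norm_num
  refine ⟨?_, fun γ _ τ => ?_, fun γ => ?_⟩
  · exact (differentiableOn_eta_cube.const_mul a).congr fun w hw => by
      beta_reduce; rw [coe_ofComplex hw]
  · rw [eta_cube_smul, e]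
    ring
  · have h : Tendsto (fun τ : ℍ => a * conj (etaMultiplier γ) * ModularForm.eta τ ^ 3)
        atImInfty (𝓝 (a * conj (etaMultiplier γ) * 0)) :=
      isZeroAtImInfty_eta_cube.const_mul _
    rw [mul_zero] at h
    refine h.congr fun τ => ?_
    have h2 : cocyc γ τ ^ (3 / 2 : ℂ) ≠ 0 := by
      rw [Ne, Complex.cpow_eq_zero_iff]
      exact fun h => cocyc_ne_zero γ τ h.1
    rw [slash, e, eta_cube_smul, Complex.cpow_neg]
    field_simp

/-! ### The Eichler integral of `η³` -/

lemma integral_beta_scaled {y r : ℝ} (hy : 0 < y) (hr : r ≠ 0) :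
    MeasureTheory.IntegrableOn (fun t : ℝ => (t + 2 * y) ^ (-(1 / 2) : ℝ) * Real.exp (-(π * r ^ 2 * (t + 2 * y))))
      (Set.Ioi 0) ∧
    ∫ t in Set.Ioi (0 : ℝ), (t + 2 * y) ^ (-(1 / 2) : ℝ) * Real.exp (-(π * r ^ 2 * (t + 2 * y))) =
      |r|⁻¹ * beta (2 * r ^ 2 * y) := by
  have hr2 : 0 < r ^ 2 := by positivity
  have hr1 : 0 < |r| := abs_pos.mpr hr
  have himg : (fun t : ℝ => r ^ 2 * (t + 2 * y)) '' Set.Ioi 0 = Set.Ioi (2 * r ^ 2 * y) := by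
    ext u
    simp only [Set.mem_image, Set.mem_Ioi]
    constructor
    · rintro ⟨t, ht, rfl⟩
      nlinarith
    · intro hu
      refine ⟨u / r ^ 2 - 2 * y, ?_, by field_simp; ring⟩
      rw [sub_pos, lt_div_iff₀ hr2]
      linarith
  have hinj : Set.InjOn (fun t : ℝ => r ^ 2 * (t + 2 * y)) (Set.Ioi 0) := by
    intro a _ b _ hab
    have := mul_left_cancel₀ hr2.ne' hab
    linarith
  have hder : ∀ t ∈ Set.Ioi (0 : ℝ),
      HasDerivWithinAt (fun t : ℝ => r ^ 2 * (t + 2 * y)) (r ^ 2) (Set.Ioi 0) t := by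
    intro t _
    have := (((hasDerivAt_id t).add_const (2 * y)).const_mul (r ^ 2)).hasDerivWithinAt
      (s := Set.Ioi (0 : ℝ))
    exact this.congr_deriv (by simp)
  have hfun : Set.EqOn (fun t : ℝ => |r|⁻¹ * (|r ^ 2| • ((r ^ 2 * (t + 2 * y)) ^ (-(1 / 2) : ℝ) *
      Real.exp (-(π * (r ^ 2 * (t + 2 * y)))))))
      (fun t : ℝ => (t + 2 * y) ^ (-(1 / 2) : ℝ) * Real.exp (-(π * r ^ 2 * (t + 2 * y))))
      (Set.Ioi 0) := by
    intro t ht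
    have ht' : 0 < t + 2 * y := by
      have : (0 : ℝ) < t := ht
      linarith
    have e : (r ^ 2) ^ (-(1 / 2) : ℝ) = |r|⁻¹ := by
      rw [Real.rpow_neg hr2.le, ← Real.sqrt_eq_rpow, Real.sqrt_sq_eq_abs]
    beta_reduce
    rw [smul_eq_mul, Real.mul_rpow hr2.le ht'.le, e, abs_of_pos hr2, ← sq_abs, mul_assoc π]
    field_simp
  have hIntegral : MeasureTheory.IntegrableOn (fun u : ℝ => u ^ (-(1 / 2) : ℝ) * Real.exp (-(π * u)))
      ((fun t : ℝ => r ^ 2 * (t + 2 * y)) '' Set.Ioi 0) := by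
    rw [himg]; exact integrableOn_beta (by positivity)
  constructor
  · have := (MeasureTheory.integrableOn_image_iff_integrableOn_abs_deriv_smul measurableSet_Ioi
      hder hinj _).mp hIntegral
    exact MeasureTheory.IntegrableOn.congr_fun (this.const_mul |r|⁻¹) hfun measurableSet_Ioi
  · rw [← MeasureTheory.setIntegral_congr_fun measurableSet_Ioi hfun,
      MeasureTheory.integral_const_mul, ← MeasureTheory.integral_image_eq_integral_abs_deriv_smul
        measurableSet_Ioi hder hinj (fun u : ℝ => u ^ (-(1 / 2) : ℝ) * Real.exp (-(π * u))), himg,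
      beta]

/-- The terms of the integrand of the Eichler integral of `η³`. -/
def eichlerTerm (τ : ℍ) (m : ℤ) (t : ℝ) : ℂ :=
  ((-1 : ℂ) ^ m * ((m : ℂ) + 1 / 2) * qpow (-(((m : ℂ) + 1 / 2) ^ 2 / 2)) τ) *
    (((t + 2 * τ.im) ^ (-(1 / 2) : ℝ) *
      Real.exp (-(π * ((m : ℝ) + 1 / 2) ^ 2 * (t + 2 * τ.im))) : ℝ) : ℂ)

lemma half_int_ne_zero (m : ℤ) : (m : ℝ) + 1 / 2 ≠ 0 := by
  intro h
  have h2 : ((2 * m + 1 : ℤ) : ℝ) = 0 := by push_cast; linarith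
  have : 2 * m + 1 = 0 := by exact_mod_cast h2
  omega

lemma sign_mul_abs_inv {r : ℝ} (hr : r ≠ 0) : r * |r|⁻¹ = (SignType.sign r : ℝ) := by
  rcases hr.lt_or_gt with h | h
  · rw [abs_of_neg h, sign_neg h, SignType.coe_neg_one]; field_simp
  · rw [abs_of_pos h, sign_pos h, SignType.coe_one]; field_simp

lemma integrableOn_eichlerTerm (τ : ℍ) (m : ℤ) :
    MeasureTheory.IntegrableOn (eichlerTerm τ m) (Set.Ioi 0) :=
  ((integral_beta_scaled τ.im_pos (half_int_ne_zero m)).1.ofReal).const_mul _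

lemma integral_eichlerTerm (τ : ℍ) (m : ℤ) : ∫ t in Set.Ioi (0 : ℝ), eichlerTerm τ m t =
    (-1 : ℂ) ^ m * (betaCoef τ.im m : ℂ) * qpow (-(((m : ℂ) + 1 / 2) ^ 2 / 2)) τ := by
  simp only [eichlerTerm]
  rw [MeasureTheory.integral_const_mul, integral_complex_ofReal,
    (integral_beta_scaled τ.im_pos (half_int_ne_zero m)).2, betaCoef,
    ← sign_mul_abs_inv (half_int_ne_zero m)]
  push_cast
  ring

/-- Each term is a constant times a positive function of `t`, so the norm passes through the
integral. The summability needed to exchange sum and integral is thereby that of the series `C`. -/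
lemma integral_norm_eichlerTerm (τ : ℍ) (m : ℤ) : ∫ t in Set.Ioi (0 : ℝ), ‖eichlerTerm τ m t‖ =
    ‖(-1 : ℂ) ^ m * (betaCoef τ.im m : ℂ) * qpow (-(((m : ℂ) + 1 / 2) ^ 2 / 2)) τ‖ := by
  have hy := τ.im_pos
  have h1 : ∀ t ∈ Set.Ioi (0 : ℝ), ‖eichlerTerm τ m t‖ =
      ‖(-1 : ℂ) ^ m * ((m : ℂ) + 1 / 2) * qpow (-(((m : ℂ) + 1 / 2) ^ 2 / 2)) τ‖ *
        ((t + 2 * τ.im) ^ (-(1 / 2) : ℝ) *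
        Real.exp (-(π * ((m : ℝ) + 1 / 2) ^ 2 * (t + 2 * τ.im)))) := by
    intro t ht
    have ht' : 0 < t + 2 * τ.im := by
      have : (0 : ℝ) < t := ht
      linarith
    rw [eichlerTerm, norm_mul, Complex.norm_real, Real.norm_of_nonneg (by positivity)]
  rw [MeasureTheory.setIntegral_congr_fun measurableSet_Ioi h1, MeasureTheory.integral_const_mul,
    (integral_beta_scaled hy (half_int_ne_zero m)).2, ← integral_eichlerTerm]
  simp only [eichlerTerm]
  rw [MeasureTheory.integral_const_mul, integral_complex_ofReal,
    (integral_beta_scaled hy (half_int_ne_zero m)).2, norm_mul _ (Complex.ofReal _),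
    Complex.norm_real, Real.norm_of_nonneg]
  exact mul_nonneg (by positivity) (beta_nonneg (by positivity))

/-- Jacobi's series for `η³` is conjugated; `conj τ = τ - 2iy` turns each conjugated power of `q` at
`τ + it` into a negative power of `q` at `τ` times a decaying exponential in `t + 2y`. -/
lemma hasSum_eichlerTerm (τ : ℍ) {t : ℝ} (ht : 0 < t) : HasSum (fun m => eichlerTerm τ m t)
    ((((t + 2 * τ.im) ^ (-(1 / 2) : ℝ) : ℝ) : ℂ) *
      conj (ModularForm.eta ((τ : ℂ) + t * 𝕚) ^ 3)) := by
  have him : 0 < ((τ : ℂ) + t * 𝕚).im := by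
    have := τ.im_pos
    simp only [Complex.add_im, UpperHalfPlane.coe_im, Complex.mul_im, Complex.ofReal_re,
      Complex.I_im, mul_one, Complex.ofReal_im, Complex.I_re, mul_zero, add_zero]
    linarith
  have h := (Complex.hasSum_conj'.mpr (hasSum_eta_cube him)).mul_left
    ((((t + 2 * τ.im) ^ (-(1 / 2) : ℝ) : ℝ) : ℂ))
  refine hasSum_of_eq h (fun m => ?_) rfl
  have hτc : conj (τ : ℂ) = τ - 2 * 𝕚 * (τ.im : ℝ) := by
    have := Complex.sub_conj (τ : ℂ)
    rw [UpperHalfPlane.coe_im] at this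
    push_cast at this
    linear_combination -this
  have hm : conj ((m : ℂ) + 1 / 2) = (m : ℂ) + 1 / 2 := by
    simp only [map_add, map_div₀, map_one, map_intCast, map_ofNat]
  have hE : conj (qpow (((m : ℂ) + 1 / 2) ^ 2 / 2) ((τ : ℂ) + t * 𝕚)) =
      qpow (-(((m : ℂ) + 1 / 2) ^ 2 / 2)) τ *
        cexp (-(π * ((m : ℂ) + 1 / 2) ^ 2 * (t + 2 * τ.im))) := by
    rw [qpow, qpow, ← Complex.exp_conj, ← Complex.exp_add]
    congr 1
    simp only [map_mul, map_add, map_div₀, map_pow, Complex.conj_I, Complex.conj_ofReal,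
      map_ofNat, map_one, map_intCast, hτc]
    linear_combination (π * ((m : ℂ) + 1 / 2) ^ 2 * (t + 2 * τ.im)) * Complex.I_sq
  rw [eichlerTerm, map_mul, map_mul, hE, hm]
  simp only [map_zpow₀, map_neg, map_one]
  push_cast
  ring

/-- The non-holomorphic Eichler integral of `η³`. -/
theorem eichlerIntegral_eta_cube (a : ℂ) (τ : ℍ) :
    eichlerIntegral (1 / 2) (fun τ => conj a / 2 * ModularForm.eta τ ^ 3) τ = a * C τ := by
  have h := MeasureTheory.hasSum_integral_of_summable_integral_norm
    (μ := MeasureTheory.volume.restrict (Set.Ioi (0 : ℝ))) (F := eichlerTerm τ)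
    (integrableOn_eichlerTerm τ) (by
      simp only [integral_norm_eichlerTerm]
      exact summable_norm_C_term τ)
  have h2 := h.tsum_eq
  simp only [integral_eichlerTerm] at h2
  have h3 : ∀ t ∈ Set.Ioi (0 : ℝ), (((t + 2 * τ.im) ^ (-(1 / 2) : ℝ) : ℝ) : ℂ) *
      conj (conj a / 2 * ModularForm.eta (ofComplex ((τ : ℂ) + t * 𝕚) : ℍ) ^ 3) =
      a / 2 * ∑' m, eichlerTerm τ m t := by
    intro t ht
    have ht' : 0 < t := ht
    have him : 0 < ((τ : ℂ) + t * 𝕚).im := by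
      have := τ.im_pos
      simp only [Complex.add_im, UpperHalfPlane.coe_im, Complex.mul_im, Complex.ofReal_re,
        Complex.I_im, mul_one, Complex.ofReal_im, Complex.I_re, mul_zero, add_zero]
      linarith
    rw [(hasSum_eichlerTerm τ ht').tsum_eq, coe_ofComplex him, map_mul, map_div₀,
      Complex.conj_conj, map_ofNat]
    ring
  rw [eichlerIntegral, MeasureTheory.setIntegral_congr_fun measurableSet_Ioi h3,
    MeasureTheory.integral_const_mul, ← h2, C_eq]
  ring

/-! ### Transformation and growth of the completion -/

/-- Follows from `Im γτ = y/|j|²` and `conj j = j - 2icy`, where `j = cτ + d`: the Gaussian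
prefactor behaves like a function of weight zero and index `1/2`. -/
lemma gauss_factor_smul (γ : SL(2, ℤ)) (z : ℂ) (τ : ℍ) :
    cexp (-(π * (z / cocyc γ τ) ^ 2 / (2 * (γ • τ).im))) =
      cexp (-(π * z ^ 2 / (2 * τ.im))) * cexp (π * 𝕚 * ((γ 1 0 : ℂ) * z ^ 2 / cocyc γ τ)) := by
  have hj := cocyc_ne_zero γ τ
  have hjc : conj (cocyc γ τ) ≠ 0 := by simpa using hj
  have hy := im_ne_zero_complex (γ • τ)
  have hy0 := im_ne_zero_complex τ
  have him := im_smul_mul γ τ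
  have hconj : conj (cocyc γ τ) = cocyc γ τ - 2 * 𝕚 * ((γ 1 0 : ℂ) * (τ.im : ℝ)) := by
    have := Complex.sub_conj (cocyc γ τ)
    rw [show (cocyc γ τ).im = γ 1 0 * τ.im by simp [cocyc]] at this
    push_cast at this
    linear_combination -this
  rw [← Complex.exp_add]
  congr 1
  have h1 : (((γ • τ).im : ℝ) : ℂ) = (τ.im : ℂ) / (cocyc γ τ * conj (cocyc γ τ)) := by
    rw [eq_div_iff (mul_ne_zero hj hjc), him]
  have h2 : π * (z / cocyc γ τ) ^ 2 / (2 * (((γ • τ).im : ℝ) : ℂ)) =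
      π * z ^ 2 * conj (cocyc γ τ) / (2 * (τ.im : ℂ) * cocyc γ τ) := by
    rw [h1]; field_simp
  rw [h2, hconj]
  field_simp
  ring

/-- The Cramer identity divided by `η³`, with `μ` replaced by `C` plus the lattice sum. The second
term on the right has the weight and index of `φ` itself. -/
lemma completion_mul {h : ℕ} {c : ℕ → ℤ → ℂ} {φ : ℂ → ℍ → ℂ}
    (hφ : IsEllipticIndexOne φ) (hc : HasJacobiExpansion h c φ) {z : ℂ} {τ : ℍ}
    (hz : ∀ m : ℤ, z.im + m * τ.im ≠ 0) :
    (F h c τ + φ 0 τ * C τ) * ModularForm.eta τ ^ 3 * thetaK z τ ^ 2 =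
      φ z τ - φ 0 τ * (thetaK z τ * cexp (-(π * z ^ 2 / (2 * τ.im))) * latticeG z τ) / (2 * π) := by
  have hne : ¬ ∃ l u : ℤ, z = l * (τ : ℂ) + u := by
    rintro ⟨l, u, h⟩
    apply hz (-l)
    rw [h]; simp
  have hη := eta_cube_ne_zero τ
  have hpi : (π : ℂ) ≠ 0 := by exact_mod_cast Real.pi_ne_zero
  have h1 := hφ.mul_eta_cube hc z τ
  rw [thetaSqMu, if_neg hne] at h1
  rw [mul_assoc (thetaK z τ), cexp_mul_latticeG hz, thetaK]
  have h2 : φ z τ = (φ 0 τ * (theta1 z τ ^ 2 * mu z τ) + F h c τ * theta1 z τ ^ 2) /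
    ModularForm.eta τ ^ 3 := (eq_div_iff hη).mpr h1
  rw [h2]
  field_simp
  ring

lemma exists_generic_point (γ : SL(2, ℤ)) (τ : ℍ) : ∃ z : ℂ, (∀ m : ℤ, z.im + m * τ.im ≠ 0) ∧
    ∀ m : ℤ, (z / cocyc γ τ).im + m * (γ • τ).im ≠ 0 := by
  have hy := τ.im_ne_zero
  have hy' := (γ • τ).im_ne_zero
  have hj := cocyc_ne_zero γ τ
  have hdet := det_eq γ
  have hτ := coe_smul_mul_cocyc γ τ
  -- For `z = τ/2 + t` the coordinate of `z/(cτ+d)` along `γτ` is `d/2 - tc`. This is `d/2 - 1/4`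
  -- when `c ≠ 0` and `d/2` with `d = ±1` when `c = 0`, never an integer.
  set t : ℝ := 1 / (4 * (γ 1 0 : ℝ)) with ht
  refine ⟨(1 / 2 : ℝ) * τ + (t : ℝ), fun m h => ?_, fun m h => ?_⟩
  · have h1 : ((((1 / 2 : ℝ) : ℂ) * (τ : ℂ) + ((t : ℝ) : ℂ)).im) = 1 / 2 * τ.im := by
      rw [Complex.add_im, Complex.im_ofReal_mul, Complex.ofReal_im, add_zero, UpperHalfPlane.coe_im]
    rw [h1, ← add_mul] at h
    have h2 := (mul_eq_zero.mp h).resolve_right hy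
    have h3 : ((1 + 2 * m : ℤ) : ℝ) = 0 := by push_cast; linarith
    have h4 : 1 + 2 * m = 0 := by exact_mod_cast h3
    omega
  · have e : (((1 / 2 : ℝ) : ℂ) * (τ : ℂ) + ((t : ℝ) : ℂ)) / cocyc γ τ =
        ((1 / 2 * γ 1 1 - t * γ 1 0 : ℝ) : ℂ) * ((γ • τ : ℍ) : ℂ) +
          ((-(1 / 2) * γ 0 1 + t * γ 0 0 : ℝ) : ℂ) := by
      rw [div_eq_iff hj, add_mul, mul_assoc, hτ, cocyc]
      push_cast
      linear_combination (-(1 / 2 * (τ : ℂ) + t)) * hdet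
    rw [e, Complex.add_im, Complex.im_ofReal_mul, Complex.ofReal_im, add_zero,
      UpperHalfPlane.coe_im, ← add_mul] at h
    have h2 := (mul_eq_zero.mp h).resolve_right hy'
    by_cases hc : γ 1 0 = 0
    · have hd : γ 0 0 * γ 1 1 = 1 := by
        have := det_int_eq γ
        rw [hc] at this
        linarith
      rw [ht, hc] at h2
      have h3 : ((γ 1 1 + 2 * m : ℤ) : ℝ) = 0 := by
        push_cast
        simp at h2
        linarith
      have h4 : γ 1 1 + 2 * m = 0 := by exact_mod_cast h3
      rcases Int.mul_eq_one_iff_eq_one_or_neg_one.mp hd with h5 | h5 <;> omega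
    · have hc' : (γ 1 0 : ℝ) ≠ 0 := by exact_mod_cast hc
      have h3 : t * (γ 1 0 : ℝ) = 1 / 4 := by rw [ht]; field_simp
      rw [h3] at h2
      have h4 : ((2 * γ 1 1 - 1 + 4 * m : ℤ) : ℝ) = 0 := by push_cast; linarith
      have h5 : 2 * γ 1 1 - 1 + 4 * m = 0 := by exact_mod_cast h4
      omega

/-- The action of `SL(2, ℤ)` on completions, for forms which are constant at `z = 0`. -/
theorem completion_smul {h h₁ : ℕ} {c c₁ : ℕ → ℤ → ℂ} {φ : ℂ → ℍ → ℂ} (γ : SL(2, ℤ))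
    (hφ : IsEllipticIndexOne φ) (hc : HasJacobiExpansion h c φ)
    (hφ₁ : IsEllipticIndexOne (jacobiSlash 0 1 φ γ))
    (hc₁ : HasJacobiExpansion h₁ c₁ (jacobiSlash 0 1 φ γ)) {χ : ℂ} (hχ : ∀ τ, φ 0 τ = χ) (τ : ℍ) :
    F h c (γ • τ) + χ * C (γ • τ) =
      etaMultiplier γ * cocyc γ τ ^ (1 / 2 : ℂ) * (F h₁ c₁ τ + χ * C τ) := by
  obtain ⟨z, hz, hz'⟩ := exists_generic_point γ τ
  have hj := cocyc_ne_zero γ τ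
  have h1 := completion_mul hφ hc hz'
  have h2 := completion_mul hφ₁ hc₁ hz
  rw [jacobiSlash_zero] at h2
  rw [hχ] at h1 h2
  have hK : thetaK z τ ≠ 0 := thetaK_ne_zero fun l u h => hz (-l) (by rw [h]; simp)
  have hη := eta_cube_ne_zero (γ • τ)
  set x := (γ 1 0 : ℂ) * z ^ 2 / cocyc γ τ with hx
  have hE : cexp (π * 𝕚 * x) ≠ 0 := Complex.exp_ne_zero _
  have hE2 : cexp (-(2 * π * 𝕚 * (1 : ℕ) * x)) * cexp (π * 𝕚 * x) ^ 2 = 1 := by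
    rw [← Complex.exp_nat_mul, ← Complex.exp_add, ← Complex.exp_zero]
    congr 1; push_cast; ring
  have hφz : φ (z / cocyc γ τ) (γ • τ) = cexp (π * 𝕚 * x) ^ 2 * jacobiSlash 0 1 φ γ z τ := by
    rw [jacobiSlash, neg_zero, zpow_zero, one_mul, ← hx]
    linear_combination (-φ (z / cocyc γ τ) (γ • τ)) * hE2
  rw [thetaK_smul, gauss_factor_smul, latticeG_smul, hφz, ← hx] at h1
  -- The index factors are the same on both sides and cancel, and `K²` contributes `(cτ+d)^(-2)`;
  -- nonvanishing of `K` at the generic point allows division.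
  have key : (F h c (γ • τ) + χ * C (γ • τ)) * ModularForm.eta ((γ • τ : ℍ) : ℂ) ^ 3 =
      cocyc γ τ ^ 2 * ModularForm.eta τ ^ 3 * (F h₁ c₁ τ + χ * C τ) := by
    have hne : ((cocyc γ τ)⁻¹ * cexp (π * 𝕚 * x) * thetaK z τ) ^ 2 ≠ 0 :=
      pow_ne_zero _ (mul_ne_zero (mul_ne_zero (inv_ne_zero hj) hE) hK)
    refine mul_right_cancel₀ hne ?_
    rw [h1]
    have e1 : (cocyc γ τ)⁻¹ * cocyc γ τ = 1 := inv_mul_cancel₀ hj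
    have e2 : cocyc γ τ ^ 2 * (cocyc γ τ)⁻¹ ^ 2 = 1 := by rw [← mul_pow, mul_inv_cancel₀ hj, one_pow]
    linear_combination (-cexp (π * 𝕚 * x) ^ 2) * h2 -
      (χ * cexp (π * 𝕚 * x) ^ 2 * thetaK z τ * cexp (-(π * z ^ 2 / (2 * τ.im))) *
        latticeG z τ / (2 * π)) * e1 -
      (ModularForm.eta τ ^ 3 * (F h₁ c₁ τ + χ * C τ) * cexp (π * 𝕚 * x) ^ 2 * thetaK z τ ^ 2) * e2
  rw [etaMultiplier_mul_cpow, div_mul_eq_mul_div, eq_div_iff hη]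
  exact key

lemma isBounded_C : IsBoundedAtImInfty C := by
  rw [isBoundedAtImInfty_iff]
  have hs := (summable_gauss_half one_pos).mul_left ((1 / 2 : ℝ) ^ (-(1 / 2) : ℝ) / π)
  refine ⟨1 / 2 * ∑' m : ℤ, (1 / 2 : ℝ) ^ (-(1 / 2) : ℝ) / π *
    Real.exp (-(π * ((m : ℝ) + 1 / 2) ^ 2 * 1)), 1, fun τ hτ => ?_⟩
  rw [C_eq, norm_mul]
  have hpi := Real.pi_pos
  gcongr
  · norm_num
  · refine tsum_of_norm_bounded hs.hasSum fun m => (norm_C_term_le τ m).trans ?_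
    gcongr ?_ / π * Real.exp (-(π * ((m : ℝ) + 1 / 2) ^ 2 * ?_))
    exact Real.rpow_le_rpow_of_nonpos (by norm_num) (by linarith) (by norm_num)

lemma completion_isBigO {h : ℕ} (hh : 0 < h) {c : ℕ → ℤ → ℂ} {φ : ℂ → ℍ → ℂ}
    (hc : HasJacobiExpansion h c φ) (χ : ℂ) :
    (fun τ : ℍ => F h c τ + χ * C τ) =O[atImInfty] fun τ : ℍ => Real.exp (π / 4 * τ.im) := by
  refine (hc.F_isBigO hh).add (IsBigO.trans (g := fun _ => (1 : ℝ)) ?_ ?_)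
  · exact IsBigO.const_mul_left isBounded_C χ
  · refine IsBigO.of_bound 1 (Eventually.of_forall fun τ => ?_)
    rw [norm_one, one_mul, Real.norm_of_nonneg (Real.exp_pos _).le]
    have := τ.im_pos
    have := Real.pi_pos
    exact Real.one_le_exp (by positivity)

lemma jacobiSlash_eq_self {Γ : Subgroup SL(2, ℤ)} {φ : ℂ → ℍ → ℂ}
    (hφ : IsWeakJacobiForm 0 1 Γ φ) {γ : SL(2, ℤ)} (hγ : γ ∈ Γ) : jacobiSlash 0 1 φ γ = φ := by
  funext z τ
  rw [jacobiSlash, hφ.modular γ hγ, neg_zero, zpow_zero, one_mul, one_mul, ← mul_assoc,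
    ← Complex.exp_add, neg_add_cancel, Complex.exp_zero, one_mul]

theorem isMockModularForm_F {Γ : Subgroup SL(2, ℤ)} {φ : ℂ → ℍ → ℂ}
    (hφ : IsWeakJacobiForm 0 1 Γ φ) {h : ℕ} {c : ℕ → ℤ → ℂ} (hc : HasJacobiExpansion h c φ)
    {χ : ℂ} (hχ : ∀ τ, φ 0 τ = χ) :
    IsMockModularForm Γ (1 / 2) etaMultiplier (F h c) (fun τ => F h c τ + χ * C τ) where
  holo := hc.isHolomorphic_F
  shadow := ⟨fun τ => conj χ / 2 * ModularForm.eta τ ^ 3, isCuspForm_eta_cube Γ _, fun τ => by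
    rw [eichlerIntegral_eta_cube]⟩
  modular γ hγ τ := by
    have e := jacobiSlash_eq_self hφ hγ
    have := completion_smul γ hφ.isElliptic hc (e.symm ▸ hφ.isElliptic) (e.symm ▸ hc) hχ τ
    beta_reduce
    rw [this]
    norm_num
  growth γ := by
    obtain ⟨N, hN, c₁, hc₁⟩ := hφ.cusps γ
    -- At the cusp given by `γ` the completion is, up to a constant, that of the slashed form. The
    -- rate `π/4 = 2π/8` is that of `|q^(-1/8)|`.
    refine ⟨π / 4, ((completion_isBigO hN hc₁ χ).const_mul_left (etaMultiplier γ)).congr_left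
      fun τ => ?_⟩
    have h2 : cocyc γ τ ^ (1 / 2 : ℂ) ≠ 0 := by
      rw [Ne, Complex.cpow_eq_zero_iff]
      exact fun h => cocyc_ne_zero γ τ h.1
    have e : (((1 / 2 : ℝ)) : ℂ) = 1 / 2 := by push_cast; rfl
    rw [slash, completion_smul γ hφ.isElliptic hc (hφ.isElliptic_slash γ) hc₁ hχ τ, e,
      Complex.cpow_neg]
    field_simp

end N4Jacobi

end

theorem theorem1p1 (Γ : Subgroup SL(2, ℤ)) (hΓ : CongruenceSubgroup.IsCongruenceSubgroup Γ)
    (φ : ℂ → ℍ → ℂ) (hφ : N4Jacobi.IsWeakJacobiForm 0 1 Γ φ)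
    (h : ℕ) (hh : 0 < h) (c : ℕ → ℤ → ℂ) (hc : N4Jacobi.HasJacobiExpansion h c φ) :
    -- `f₀`, `f₁` are the components of the theta decomposition of `φ`
    (∀ (z : ℂ) (τ : ℍ),
      φ z τ = N4Jacobi.thetaComponent h c 0 τ * N4Jacobi.theta3 (2 * z) (2 * τ) +
        N4Jacobi.thetaComponent h c 1 τ * N4Jacobi.theta2 (2 * z) (2 * τ)) ∧
    -- (i) the expansion in characters, with coefficient function `F = f₀ S₁ - f₁ S₀`
    (∃ (A₀ : ℂ) (B : ℕ → ℂ),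
      N4Jacobi.HasCharacterExpansion h A₀ B φ ∧
      ∀ τ : ℍ, HasSum (fun n : ℕ => B n * N4Jacobi.qpow ((n : ℂ) / (h : ℂ) - 1 / 8) τ)
        (N4Jacobi.F h c τ)) ∧
    -- (ii) `F` is a mock modular form of weight `1/2` with completion `F + χ C`
    (∃ χ : ℂ, (∀ τ : ℍ, φ 0 τ = χ) ∧
      ∃ ν : SL(2, ℤ) → ℂ, N4Jacobi.IsMultiplierSystem Γ (1 / 2) ν ∧
        N4Jacobi.IsMockModularForm Γ (1 / 2) ν (N4Jacobi.F h c)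
          (fun τ => N4Jacobi.F h c τ + χ * N4Jacobi.C τ)) := by
  have he := hφ.isElliptic
  obtain ⟨χ, hχ⟩ := hφ.exists_const hΓ
  obtain ⟨B, hB⟩ := hc.exists_hasSum_F hh
  exact ⟨fun z τ => he.theta_decomposition hc z τ,
    ⟨χ + 2 * B 0, B, he.hasCharacterExpansion hc hχ hB, hB⟩,
    χ, hχ, N4Jacobi.etaMultiplier, N4Jacobi.isMultiplierSystem_etaMultiplier Γ,
    N4Jacobi.isMockModularForm_F hφ hc hχ⟩
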